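/- All graphs are finite and simple. A \emph{D3 reduction} of a graph is one of the following two operations. (D3a) Let $p,q,r$ be three degree-three vertices that induce a triangle and whose neighbors outside $\{p,q,r\}$ are all distinct; replace $p,q,r$ by a single new vertex adjacent to these three outside neighbors. (D3b) Let $p,q,r$ be three degree-three vertices that induce a path with middle vertex $q$, and suppose that some vertex $s$ is adjacent to all three of them; delete $q$ and add the edge $pr$. A graph is \emph{D3-reducible} if it can be reduced to $K_4$ (up to isomorphism) by a finite, possibly empty, sequence of D3 reductions. \textbf{Lemma.} Let $G'$ be a D3-reducible graph, embedded in the sphere (the embedding being given combinatorially, by a cyclic order of the edges around each vertex that satisfies Euler's formula), and let $G$ be its planar dual, which has one vertex for each face of $G'$ and one face for each vertex of $G'$. Then one can assign to each vertex $x$ of $G$ a closed disk $D_x$ of positive radius in the plane $\mathbb{C}$ such that 1. the disks have pairwise disjoint interiors, and two disks $D_x$, $D_y$ are tangent if and only if $x$ and $y$ are adjacent in $G$; and 2. for every face $F$ of $G$, with vertices $x_1,\dots,x_d$ in cyclic order around $F$, there is a Möbius transformation of the Riemann sphere $\mathbb{C}\cup\{\infty\}$ that takes $D_{x_1},\dots,D_{x_d}$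 to a ring of $d$ congruent disks with cocircular centers: $d$ disks of equal radius with pairwise disjoint interiors, whose centers lie on a common circle, each of them tangent to the next one in cyclic order. -/

import Mathlib

open scoped MatrixGroups

universe u

/-! ### The two D3 reductions and D3-reducible graphs -/

/-- `p`, `q`, `r` are three degree-three vertices that induce a triangle in `G`, and their
neighbours outside `{p, q, r}` are all distinct. -/
structure IsD3aConfig {V : Type u} (G : SimpleGraph V) (p q r : V) : Prop where
  deg_p : (G.neighborSet p).ncard = 3
  deg_q : (G.neighborSet q).ncard = 3
  deg_r : (G.neighborSet r).ncard = 3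
  adj_pq : G.Adj p q
  adj_qr : G.Adj q r
  adj_pr : G.Adj p r
  distinct_pq : ∀ x, x ≠ r → ¬ (G.Adj p x ∧ G.Adj q x)
  distinct_qr : ∀ x, x ≠ p → ¬ (G.Adj q x ∧ G.Adj r x)
  distinct_pr : ∀ x, x ≠ q → ¬ (G.Adj p x ∧ G.Adj r x)

/-- The result of a D3a reduction: `p`, `q`, `r` are deleted and replaced by one new vertex
(`none`), adjacent to the outside neighbours of `p`, `q`, `r`. -/
def d3aReduce {V : Type u} (G : SimpleGraph V) (p q r : V) :
    SimpleGraph (Option {v : V // v ≠ p ∧ v ≠ q ∧ v ≠ r}) where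
  Adj
    | none, none => False
    | none, some v => G.Adj p v ∨ G.Adj q v ∨ G.Adj r v
    | some v, none => G.Adj p v ∨ G.Adj q v ∨ G.Adj r v
    | some u, some v => G.Adj u v
  symm := ⟨by
    rintro (_ | u) (_ | v) h
    · exact h
    · exact h
    · exact h
    · exact SimpleGraph.Adj.symm h⟩
  loopless := ⟨by
    rintro (_ | u) h
    · exact h
    · exact G.loopless.irrefl _ h⟩

/-- `p`, `q`, `r` are three degree-three vertices that induce a path in `G` with middle vertex
`q`, and the apex `s` is adjacent to all three. -/
structure IsD3bConfig {V : Type u} (G : SimpleGraph V) (p q r s : V) : Prop where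
  deg_p : (G.neighborSet p).ncard = 3
  deg_q : (G.neighborSet q).ncard = 3
  deg_r : (G.neighborSet r).ncard = 3
  adj_pq : G.Adj p q
  adj_qr : G.Adj q r
  ne_pr : p ≠ r
  not_adj_pr : ¬ G.Adj p r
  adj_sp : G.Adj s p
  adj_sq : G.Adj s q
  adj_sr : G.Adj s r

/-- The result of a D3b reduction: `q` is deleted and replaced by a new edge from `p` to `r`. -/
def d3bReduce {V : Type u} (G : SimpleGraph V) (p q r : V) (hpr : p ≠ r) :
    SimpleGraph {v : V // v ≠ q} where
  Adj u v := G.Adj u v ∨ (u.1 = p ∧ v.1 = r) ∨ (u.1 = r ∧ v.1 = p)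
  symm := ⟨by
    rintro u v (h | h | h)
    · exact Or.inl (SimpleGraph.Adj.symm h)
    · exact Or.inr (Or.inr ⟨h.2, h.1⟩)
    · exact Or.inr (Or.inl ⟨h.2, h.1⟩)⟩
  loopless := ⟨by
    rintro u (h | h | h)
    · exact G.loopless.irrefl _ h
    · exact hpr (h.1.symm.trans h.2)
    · exact hpr (h.2.symm.trans h.1)⟩

/-- A graph is D3-reducible if a (possibly empty) sequence of D3 reductions takes it to (a graph
isomorphic to) the complete graph `K₄`. -/
inductive D3Reducible : ∀ {V : Type u}, SimpleGraph V → Prop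
  | base {V : Type u} (G : SimpleGraph V)
      (h : Nonempty (G ≃g (⊤ : SimpleGraph (Fin 4)))) : D3Reducible G
  | d3a {V : Type u} (G : SimpleGraph V) (p q r : V) (h : IsD3aConfig G p q r)
      (hred : D3Reducible (d3aReduce G p q r)) : D3Reducible G
  | d3b {V : Type u} (G : SimpleGraph V) (p q r s : V) (h : IsD3bConfig G p q r s)
      (hred : D3Reducible (d3bReduce G p q r h.ne_pr)) : D3Reducible G

/-! ### Combinatorial maps, planarity, and duality -/

/-- A combinatorial map (a graph cellularly embedded in an oriented surface) with set of darts
`D`. The vertices are the cycles of `vertexPerm`, which lists the darts leaving a vertex in cyclic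
order; the edges are the two-element cycles of the involution `edgePerm`, which reverses darts. -/
structure CombMap (D : Type u) where
  vertexPerm : Equiv.Perm D
  edgePerm : Equiv.Perm D
  edgePerm_edgePerm : ∀ d, edgePerm (edgePerm d) = d
  edgePerm_ne : ∀ d, edgePerm d ≠ d

namespace CombMap

variable {D : Type u} (M : CombMap D)

/-- Face tracing: reverse the dart, then turn to the next dart at its origin. -/
def facePerm : Equiv.Perm D := M.vertexPerm * M.edgePerm

/-- The vertices of a map. -/
def Vertex : Type u := Quotient (Equiv.Perm.SameCycle.setoid M.vertexPerm)

/-- The edges of a map. -/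
def Edge : Type u := Quotient (Equiv.Perm.SameCycle.setoid M.edgePerm)

/-- The faces of a map. -/
def Face : Type u := Quotient (Equiv.Perm.SameCycle.setoid M.facePerm)

/-- The vertex from which a dart leaves. -/
def vertexOf (d : D) : M.Vertex := Quotient.mk _ d

/-- The face along which a dart runs. As `d` runs through the darts of a face in the cyclic order
given by `facePerm`, `vertexOf d` runs through the vertices of the face in cyclic order. -/
def faceOf (d : D) : M.Face := Quotient.mk _ d

/-- The underlying (simple) graph: two different vertices are adjacent if an edge joins them. -/
def graph : SimpleGraph M.Vertex where
  Adj x y := x ≠ y ∧ ∃ d, M.vertexOf d = x ∧ M.vertexOf (M.edgePerm d) = y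
  symm := ⟨by
    rintro x y ⟨hne, d, hx, hy⟩
    exact ⟨hne.symm, M.edgePerm d, hy, by rw [M.edgePerm_edgePerm]; exact hx⟩⟩
  loopless := ⟨fun _ h => h.1 rfl⟩

/-- The dual map: one vertex for every face, one edge for every edge. Its `facePerm` is
the `vertexPerm` of `M`, so it has one face for every vertex of `M`. -/
def dual : CombMap D where
  vertexPerm := M.facePerm
  edgePerm := M.edgePerm
  edgePerm_edgePerm := M.edgePerm_edgePerm
  edgePerm_ne := M.edgePerm_ne

/-- The check that the faces of the dual map are the vertices of the map. -/
theorem dual_facePerm : M.dual.facePerm = M.vertexPerm := by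
  ext d
  simp [facePerm, dual, M.edgePerm_edgePerm]

/-- A map is planar if it is connected and satisfies Euler's formula `V - E + F = 2`, that is, if
its surface is the sphere. -/
structure IsPlanar : Prop where
  connected : ∀ d e : D, ∃ g ∈ Subgroup.closure {M.vertexPerm, M.edgePerm}, g d = e
  euler : Nat.card M.Vertex + Nat.card M.Face = Nat.card M.Edge + 2

/-- The map `M` on the darts (oriented edges) of a graph `G` is an embedding of `G` given by a
rotation system: `edgePerm` reverses the darts, and `vertexPerm` permutes, for each vertex, the
darts leaving that vertex in a single cycle. -/
structure IsEmbeddingOf {V : Type u} {G : SimpleGraph V} (M : CombMap G.Dart) : Prop where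
  edgePerm_eq : ∀ d, M.edgePerm d = d.symm
  sameCycle_iff : ∀ d e : G.Dart, M.vertexPerm.SameCycle d e ↔ d.fst = e.fst

end CombMap

/-! ### Disk representations -/

/-- The closed disks with centres `c x` and radii `r x` have disjoint interiors, and two of them
are (externally) tangent if and only if the corresponding vertices are adjacent. -/
structure IsTangencyPacking {W : Type u} (G : SimpleGraph W) (c : W → ℂ) (r : W → ℝ) : Prop where
  radius_pos : ∀ x, 0 < r x
  interior_disjoint : ∀ x y, x ≠ y → Disjoint (Metric.ball (c x) (r x)) (Metric.ball (c y) (r y))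
  tangent_iff : ∀ x y, dist (c x) (c y) = r x + r y ↔ G.Adj x y

/-- The closed disk with centre `c` and radius `r`, as a subset of the Riemann sphere. -/
def sphereDisk (c : ℂ) (r : ℝ) : Set (OnePoint ℂ) :=
  (fun z : ℂ => (z : OnePoint ℂ)) '' Metric.closedBall c r

/-- Disks with centres `c' d` and common radius `ρ`, indexed by the darts `d` of the face `F`, form
a ring: their centres lie on a common circle, each is tangent to the next one in the cyclic order
of the face, and their interiors are pairwise disjoint. -/
structure IsCongruentRing {D : Type u} (M : CombMap D) (F : M.Face) (c' : D → ℂ) (ρ : ℝ) :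
    Prop where
  radius_pos : 0 < ρ
  cocircular : ∃ (o : ℂ) (R : ℝ), 0 < R ∧ ∀ d, M.faceOf d = F → dist (c' d) o = R
  tangent_next : ∀ d, M.faceOf d = F → dist (c' d) (c' (M.facePerm d)) = ρ + ρ
  interior_disjoint : ∀ d e, M.faceOf d = F → M.faceOf e = F → d ≠ e →
    Disjoint (Metric.ball (c' d) ρ) (Metric.ball (c' e) ρ)

/-- Some Möbius transformation of the Riemann sphere takes the disks of the vertices of the face
`F`, in their cyclic order, to a ring of congruent disks with cocircular centres. -/
def IsMobiusRing {D : Type u} (M : CombMap D) (c : M.Vertex → ℂ) (r : M.Vertex → ℝ)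
    (F : M.Face) : Prop :=
  ∃ (g : GL (Fin 2) ℂ) (c' : D → ℂ) (ρ : ℝ), IsCongruentRing M F c' ρ ∧
    ∀ d, M.faceOf d = F →
      (fun z : OnePoint ℂ => g • z) '' sphereDisk (c (M.vertexOf d)) (r (M.vertexOf d)) =
        sphereDisk (c' d) ρ

/-! Disks of the sphere are unit vectors of Lorentzian four-space. The product `inn` is -1 for
external tangency and at most -1 for disjoint interiors, and Möbius transformations preserve it
(`inn_pull`). Three mutually tangent disks together with their orthogonal circle form a basis, and
in this basis `inn` has an expansion without diagonal terms (`Frame.inn_eq`). All statements that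
disks on opposite sides of such a triple stay apart follow by comparing signs.

The packing is built by undoing the reductions. Undoing D3a replaces a vertex by a triangle, so the
dual gains a disk, to be placed in the gap between three mutually tangent disks. Undoing D3b splits
a triangular face in two, so one disk has to become two tangent ones, both tangent to a third. A
finished packing cannot be changed this way. The induction therefore runs over maps whose corners
carry lists of labels (`Admissible`): a triangular face may carry a whole chain of disks at one
corner, its ends being the disks at the other two corners. D3b concatenates the two chains at the
apex, so undoing it requires no new disk (`Realizes.of_suppress`). When a triangle is restored, its
whole chain goes into the gap at once: with the outer of the three disks in standard position, the
other two and the chain make up a regular ring (`Insertion`, `Realizes.of_shrink`). For `K₄` all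
disks but one form a regular ring around a hub (`IsTetrahedron.exists_realizes`).

The invariant `Realizes` also records that the gaps needed later are empty. These are the gaps at
the vertices of degree three with single labels, and the gaps between two consecutive disks of a
chain and the disk across the opposite edge. An insertion fills one gap and leaves the others empty
(`Insertion.upgrade`).

The topology rests on two facts. Reducible graphs are three-connected, and Euler's formula makes the
first cohomology modulo two vanish (`IsPlanar.jordan`), which serves as the Jordan curve theorem.
Hence the triangles of a reduction bound faces (`Emb.triangle_face`), and a vertex and a face share
at most one corner (`Emb.eq_of_sameCycle`).

At the end, every corner carries just its own face. The empty gap at some vertex of degree three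
provides a place for infinity, so that all disks become bounded. -/

/-! ### Oriented circles of the Riemann sphere -/

/-- An oriented circle of the Riemann sphere, in Hermitian coordinates. The disk with centre `c` and
radius `r` has `w = c / r`, `b = 1 / r`, `k = (|c|² - r²) / r`. -/
@[ext]
structure OCircle where
  w : ℂ
  b : ℝ
  k : ℝ

namespace OCircle

/-- The Lorentzian inner product, equal to `-1` for externally tangent disks. -/
noncomputable def inn (H K : OCircle) : ℝ := H.w.re * K.w.re + H.w.im * K.w.im -
    (H.b * K.k + K.b * H.k) / 2

theorem inn_comm (H K : OCircle) : inn H K = inn K H := by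
  unfold inn; ring

/-- The Hermitian form of an oriented circle. -/
noncomputable def form (H : OCircle) (z₁ z₂ : ℂ) : ℝ :=
  H.b * Complex.normSq z₁ - 2 * (star H.w * z₁ * star z₂).re + H.k * Complex.normSq z₂

/-- The pullback of an oriented circle along a Möbius transformation. -/
noncomputable def pull (h : SL(2, ℂ)) (H : OCircle) : OCircle where
  w := H.w * star (h 0 0) * h 1 1 + star H.w * h 0 1 * star (h 1 0)
    - H.b * star (h 0 0) * h 0 1 - H.k * star (h 1 0) * h 1 1
  b := H.form (h 0 0) (h 1 0)
  k := H.form (h 0 1) (h 1 1)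

/-- Over `ℂ` a number and its conjugate can be treated as independent variables, so identities about
forms become polynomial identities. -/
theorem ofReal_form (H : OCircle) (z₁ z₂ : ℂ) : ((H.form z₁ z₂ : ℝ) : ℂ) =
    H.b * (z₁ * star z₁) - (star H.w * z₁ * star z₂ + H.w * star z₁ * z₂)
      + H.k * (z₂ * star z₂) := by
  apply Complex.ext
  · simp [form, Complex.normSq_apply]; ring
  · simp [form]; ring

theorem ofReal_inn (H K : OCircle) : ((inn H K : ℝ) : ℂ) =
    (H.w * star K.w + star H.w * K.w - (H.b * K.k + K.b * H.k)) / 2 := by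
  apply Complex.ext
  · simp [inn]; ring
  · simp; ring

/-- Substitution into the form is what dictates the entries of `pull`. The group law and the action
on points both follow from it. -/
theorem form_pull (h : SL(2, ℂ)) (H : OCircle) (z₁ z₂ : ℂ) :
    (pull h H).form z₁ z₂ = H.form (h 0 0 * z₁ + h 0 1 * z₂) (h 1 0 * z₁ + h 1 1 * z₂) := by
  apply Complex.ofReal_injective
  rw [ofReal_form, ofReal_form]
  simp only [pull]
  rw [ofReal_form, ofReal_form]
  simp only [star_add, star_sub, star_mul', Complex.star_def,
    Complex.conj_ofReal, Complex.conj_conj]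
  ring

/-- The quadratic form of `inn` is minus the determinant of the Hermitian matrix, and a congruence
by `h` multiplies this by |det h|² = 1. -/
theorem inn_pull (h : SL(2, ℂ)) (H K : OCircle) : inn (pull h H) (pull h K) = inn H K := by
  apply Complex.ofReal_injective
  have hd : h 0 0 * h 1 1 - h 0 1 * h 1 0 = 1 := by
    have := h.det_coe
    rwa [Matrix.det_fin_two] at this
  have hd' : star (h 0 0) * star (h 1 1) - star (h 0 1) * star (h 1 0) = 1 := by
    rw [← star_mul', ← star_mul', ← star_sub, hd, star_one]
  rw [ofReal_inn, ofReal_inn]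
  simp only [pull]
  rw [ofReal_form, ofReal_form, ofReal_form, ofReal_form]
  simp only [star_add, star_sub, star_mul', Complex.star_def,
    Complex.conj_ofReal, Complex.conj_conj]
    at hd' ⊢
  generalize h 0 0 = a at *
  generalize h 0 1 = b at *
  generalize h 1 0 = c at *
  generalize h 1 1 = d at *
  generalize (starRingEnd ℂ) a = a' at *
  generalize (starRingEnd ℂ) b = b' at *
  generalize (starRingEnd ℂ) c = c' at *
  generalize (starRingEnd ℂ) d = d' at *
  generalize (starRingEnd ℂ) H.w = w' at *
  generalize (starRingEnd ℂ) K.w = v' at *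
  -- Inserting both determinants as factors makes the two sides equal as polynomials.
  have : (H.w * v' + w' * K.w - (H.b * K.k + K.b * H.k)) / 2 =
    (H.w * v' + w' * K.w - (H.b * K.k + K.b * H.k)) / 2 * (a * d - b * c) *
        (a' * d' - b' * c') := by
    rw [hd, hd']; ring
  rw [this]
  ring

/-- The values at (1,0), (0,1), (1,1) and (i,1) determine `b`, `k` and the two parts of `w`. -/
theorem ext_form {H K : OCircle} (h : ∀ z₁ z₂, H.form z₁ z₂ = K.form z₁ z₂) : H = K := by
  have h1 := h 1 0
  have h2 := h 0 1
  have h3 := h 1 1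
  have h4 := h Complex.I 1
  simp [form] at h1 h2 h3 h4
  ext
  · apply Complex.ext <;> linarith
  all_goals linarith

theorem pull_mul (g h : SL(2, ℂ)) (H : OCircle) : pull (g * h) H = pull h (pull g H) := by
  apply ext_form
  intro z₁ z₂
  simp only [form_pull, Matrix.SpecialLinearGroup.coe_mul, Matrix.mul_apply, Fin.sum_univ_two]
  congr 1 <;> ring

@[simp] theorem pull_one (H : OCircle) : pull 1 H = H := by
  apply ext_form
  intro z₁ z₂
  simp [form_pull]

theorem pull_inv_pull (h : SL(2, ℂ)) (H : OCircle) : pull h (pull h⁻¹ H) = H := by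
  rw [← pull_mul, inv_mul_cancel, pull_one]

theorem pull_pull_inv (h : SL(2, ℂ)) (H : OCircle) : pull h⁻¹ (pull h H) = H := by
  rw [← pull_mul, mul_inv_cancel, pull_one]

theorem inn_pull_left (h : SL(2, ℂ)) (H K : OCircle) : inn (pull h H) K = inn H (pull h⁻¹ K) := by
  rw [← inn_pull h H, pull_inv_pull]

/-! ### Frames: three mutually tangent disks and the circle orthogonal to them -/

/-- The lower half plane. -/
def refA : OCircle := ⟨-Complex.I, 0, 0⟩
/-- The half plane above height one. -/
def refB : OCircle := ⟨Complex.I, 0, 2⟩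
/-- The disk between the two half planes. -/
def refC : OCircle := ⟨Complex.I, 2, 0⟩
/-- The circle orthogonal to the three reference disks. -/
def refN : OCircle := ⟨1, 0, 0⟩

/-- Three mutually tangent disks with their orthogonal circle, correctly oriented. -/
def Frame (a b c n : OCircle) : Prop :=
  ∃ h : SL(2, ℂ), a = pull h refA ∧ b = pull h refB ∧ c = pull h refC ∧ n = pull h refN

theorem Frame.pull {a b c n : OCircle} (h : Frame a b c n) (g : SL(2, ℂ)) :
    Frame (pull g a) (pull g b) (pull g c) (pull g n) := by
  obtain ⟨k, rfl, rfl, rfl, rfl⟩ := h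
  exact ⟨k * g, by simp [pull_mul]⟩

/-- The orthogonal circle with the other orientation. -/
def neg (n : OCircle) : OCircle := ⟨-n.w, -n.b, -n.k⟩

theorem inn_neg_left (n H : OCircle) : inn (neg n) H = - inn n H := by
  simp [inn, neg]; ring

theorem pull_neg (h : SL(2, ℂ)) (n : OCircle) : pull h (neg n) = neg (pull h n) := by
  ext <;> simp [OCircle.pull, neg, form] <;> ring

theorem Frame.rot {a b c n : OCircle} (h : Frame a b c n) : Frame b c a n := by
  have key : Frame refB refC refA refN := by
    -- The matrix acts as z ↦ 1/(z - i), which permutes the points of tangency cyclically: i ↦ ∞ ↦ 0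
    -- ↦ i.
    refine ⟨⟨!![0, -Complex.I; -Complex.I, -1], by simp [Matrix.det_fin_two]⟩, ?_, ?_, ?_, ?_⟩ <;>
    · ext <;> simp [OCircle.pull, form, refA, refB, refC, refN, Complex.normSq_apply] <;> ring
  obtain ⟨k, rfl, rfl, rfl, rfl⟩ := h
  exact key.pull k

theorem Frame.flip {a b c n : OCircle} (h : Frame a b c n) : Frame b a c (neg n) := by
  have key : Frame refB refA refC (neg refN) := by
    -- The half-turn z ↦ i - z swaps the half planes, fixes the disk and reverses the orthogonal
    -- line.
    refine ⟨⟨!![-Complex.I, -1; 0, Complex.I], by simp [Matrix.det_fin_two]⟩, ?_, ?_, ?_, ?_⟩ <;>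
    · ext <;> simp [OCircle.pull, form, refA, refB, refC, refN, neg, Complex.normSq_apply] <;> ring
  obtain ⟨k, rfl, rfl, rfl, rfl⟩ := h
  rw [← pull_neg]
  exact key.pull k

/-- The Gram matrix of `a`, `b`, `c` has 1 on and -1 off the diagonal; its inverse has 0 on and -1/2
off the diagonal. The unit vector `n` is orthogonal to all three. The missing diagonal is what
allows the sign arguments below. -/
theorem Frame.inn_eq {a b c n : OCircle} (h : Frame a b c n) (f z : OCircle) :
    inn f z = -((inn f b + inn f c) * inn a z + (inn f a + inn f c) * inn b z
      + (inn f a + inn f b) * inn c z) / 2 + inn f n * inn n z := by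
  obtain ⟨k, rfl, rfl, rfl, rfl⟩ := h
  rw [← pull_inv_pull k f, ← pull_inv_pull k z]
  generalize OCircle.pull k⁻¹ f = f
  generalize OCircle.pull k⁻¹ z = z
  simp only [inn_pull]
  simp [inn, refA, refB, refC, refN]
  ring

theorem Frame.inn_ab {a b c n : OCircle} (h : Frame a b c n) : inn a b = -1 := by
  obtain ⟨k, rfl, rfl, rfl, rfl⟩ := h
  rw [inn_pull]; norm_num [inn, refA, refB]

theorem Frame.inn_aa {a b c n : OCircle} (h : Frame a b c n) : inn a a = 1 := by
  obtain ⟨k, rfl, rfl, rfl, rfl⟩ := h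
  rw [inn_pull]; norm_num [inn, refA]

theorem Frame.inn_na {a b c n : OCircle} (h : Frame a b c n) : inn n a = 0 := by
  obtain ⟨k, rfl, rfl, rfl, rfl⟩ := h
  rw [inn_pull]; norm_num [inn, refA, refN]

/-- A disk on the inner side of a frame is far from a disk on the outer side. -/
theorem Frame.inn_le_neg_three {a b c n f z : OCircle} (h : Frame a b c n)
    (ha : inn f a ≤ -1) (hb : inn f b ≤ -1) (hc : inn f c ≤ -1) (hn : 0 ≤ inn f n)
    (ha' : inn z a ≤ -1) (hb' : inn z b ≤ -1) (hc' : inn z c ≤ -1) (hn' : inn z n ≤ 0) :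
    inn f z ≤ -3 := by
  rw [h.inn_eq f z, inn_comm a z, inn_comm b z, inn_comm c z, inn_comm n z]
  -- Each of the six mixed products is at least 1, and the term of the normal is nonpositive.
  nlinarith [mul_nonneg (sub_nonneg.2 ha) (sub_nonneg.2 hb'),
    mul_nonneg (sub_nonneg.2 ha) (sub_nonneg.2 hc'), mul_nonneg (sub_nonneg.2 hb)
        (sub_nonneg.2 ha'),
    mul_nonneg (sub_nonneg.2 hb) (sub_nonneg.2 hc'), mul_nonneg (sub_nonneg.2 hc)
        (sub_nonneg.2 ha'),
    mul_nonneg (sub_nonneg.2 hc) (sub_nonneg.2 hb'), mul_nonneg hn (sub_nonneg.2 hn')]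

/-- All terms of `Frame.inn_eq` have a sign. No normalization enters, so `f` may be the normal of a
gap as well as a disk. -/
theorem Frame.inn_nonpos {a b c n f z : OCircle} (h : Frame a b c n)
    (ha : inn f a ≤ 0) (hb : inn f b ≤ 0) (hc : inn f c ≤ 0)
    (ha' : inn z a ≤ 0) (hb' : inn z b ≤ 0) (hc' : inn z c ≤ 0)
    (hn : inn f n * inn z n ≤ 0) : inn f z ≤ 0 := by
  rw [h.inn_eq f z, inn_comm a z, inn_comm b z, inn_comm c z, inn_comm n z]
  nlinarith [mul_nonneg_of_nonpos_of_nonpos ha hb', mul_nonneg_of_nonpos_of_nonpos ha hc',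
    mul_nonneg_of_nonpos_of_nonpos hb ha', mul_nonneg_of_nonpos_of_nonpos hb hc',
    mul_nonneg_of_nonpos_of_nonpos hc ha', mul_nonneg_of_nonpos_of_nonpos hc hb']

/-- Two frames, each with the other one on its outer side. -/
theorem Frame.inn_normal_nonpos {a b c n a' b' c' n' : OCircle} (h : Frame a b c n)
    (h' : Frame a' b' c' n') (ha : inn n' a ≤ 0) (hb : inn n' b ≤ 0) (hc : inn n' c ≤ 0)
    (hn : inn n a' ≤ 0)
    (ha' : inn a' a ≤ -1) (hb' : inn a' b ≤ -1) (hc' : inn a' c ≤ -1) : inn n' n ≤ 0 := by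
  have h1 := h.inn_eq a' a'
  have h2 := h.inn_eq n' a'
  rw [h'.inn_aa, inn_comm a a', inn_comm b a', inn_comm c a', inn_comm n a'] at h1
  rw [h'.inn_na, inn_comm a a', inn_comm b a', inn_comm c a'] at h2
  rw [inn_comm] at hn
  rw [inn_comm n a'] at h2
  -- If this vanished, expanding `inn a' a' = 1` would leave only the mixed products, whose total is
  -- negative.
  have h3 : inn a' n < 0 := by
    rcases hn.lt_or_eq with h4 | h4
    · exact h4
    · rw [h4] at h1
      nlinarith
  -- This comes from expanding `inn n' a' = 0`: the term of the normal has to balance the mixed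
  -- products.
  have h4 : 0 ≤ inn n' n * inn a' n := by
    nlinarith [mul_nonneg_of_nonpos_of_nonpos ha (by linarith : inn a' b ≤ 0),
      mul_nonneg_of_nonpos_of_nonpos ha (by linarith : inn a' c ≤ 0),
      mul_nonneg_of_nonpos_of_nonpos hb (by linarith : inn a' a ≤ 0),
      mul_nonneg_of_nonpos_of_nonpos hb (by linarith : inn a' c ≤ 0),
      mul_nonneg_of_nonpos_of_nonpos hc (by linarith : inn a' a ≤ 0),
      mul_nonneg_of_nonpos_of_nonpos hc (by linarith : inn a' b ≤ 0)]
  by_contra h5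
  push Not at h5
  nlinarith [mul_pos h5 (neg_pos.2 h3)]

end OCircle

/-! ### Explicit frames formed by disks centred on the unit circle -/

namespace OCircle

/-- The disk of radius `ρ` centred at `u`, for a point `u` of the unit circle. -/
noncomputable def unitDisk (ρ : ℝ) (u : ℂ) : OCircle := ⟨u / ρ, 1 / ρ, (1 - ρ ^ 2) / ρ⟩

/-- The complement of the disk of radius `1 + ρ` centred at the origin. -/
noncomputable def outerDisk (ρ : ℝ) : OCircle := ⟨0, -1 / (1 + ρ), 1 + ρ⟩

/-- The circle orthogonal to the outer disk and to two neighbouring disks of a ring. -/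
noncomputable def orthCircle (ρ C : ℝ) (u : ℂ) : OCircle :=
  ⟨-u / ρ, -C / (ρ * (1 + ρ)), -(C * (1 + ρ)) / ρ⟩

theorem frame_outer_base {ρ C : ℝ} (hρ : 0 < ρ) (h : C ^ 2 + ρ ^ 2 = 1) :
    Frame (unitDisk ρ ⟨C, -ρ⟩) (unitDisk ρ ⟨C, ρ⟩) (outerDisk ρ) (orthCircle ρ C 1) := by
  obtain ⟨t, ht⟩ : ∃ t : ℝ, t * t = 1 / ρ :=
    ⟨Real.sqrt (1 / ρ), Real.mul_self_sqrt (by positivity)⟩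
  have ht' : t * t * ρ = 1 := by rw [ht]; field_simp
  have h1 : 0 < 1 + ρ := by positivity
  have h2 : ∀ z : ℝ, z / ρ = z * (t * t) := fun z => by rw [ht]; ring
  have h3 : ρ⁻¹ = t * t := by rw [ht]; ring
  -- This Möbius map sends the contact point `C` of the two ring disks to ∞ and their contact points
  -- with the outer disk to 0 and i. The factor `t` makes the determinant 1.
  refine ⟨⟨!![t * ⟨C / (2 * (1 + ρ)), 1 / 2⟩, t * ⟨-(1 + ρ) / 2, - C / 2⟩; t, -t * C], ?_⟩,
    ?_, ?_, ?_, ?_⟩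
  · rw [Matrix.det_fin_two]
    apply Complex.ext
    · simp
      field_simp
      linear_combination (1 + ρ) * 2 * ht' - t * t * h
    · simp
      field_simp
      ring
  all_goals
    ext
    · apply Complex.ext
      all_goals
        simp [unitDisk, outerDisk, orthCircle, OCircle.pull, form, refA, refB, refC, refN]
        field_simp
        try grind
    all_goals
      simp [unitDisk, outerDisk, orthCircle, OCircle.pull, form, refA, refB, refC, refN,
        Complex.normSq_apply]
      field_simp
      try grind

/-- The orthogonal circle has centre 0 and radius 1/2: it passes through the three contact points of
a ring of three and bounds a disk containing the gap inside it. -/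
theorem frame_three_base {ρ : ℝ} (hρ : 0 < ρ) (h : 4 * ρ ^ 2 = 3) :
    Frame (unitDisk ρ ⟨1 / 2, -ρ⟩) (unitDisk ρ ⟨1 / 2, ρ⟩) (unitDisk ρ (-1))
      ⟨0, 2, -1 / 2⟩ := by
  obtain ⟨t, ht⟩ : ∃ t : ℝ, t * t = 1 / ρ :=
    ⟨Real.sqrt (1 / ρ), Real.mul_self_sqrt (by positivity)⟩
  have ht' : t * t * ρ = 1 := by rw [ht]; field_simp
  refine ⟨⟨!![t * ⟨-ρ, 1 / 2⟩, t * ⟨-ρ / 2, -1 / 4⟩; t, t * (-1 / 2 : ℝ)], ?_⟩,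
    ?_, ?_, ?_, ?_⟩
  · rw [Matrix.det_fin_two]
    apply Complex.ext
    · simp
      grind
    · simp
      grind
  all_goals
    ext
    · apply Complex.ext
      all_goals
        simp [unitDisk, OCircle.pull, form, refA, refB, refC, refN]
        field_simp
        try grind
    all_goals
      simp [unitDisk, OCircle.pull, form, refA, refB, refC, refN, Complex.normSq_apply]
      field_simp
      try grind

/-- Rotation by the angle `α`. -/
noncomputable def rotation (α : ℝ) : SL(2, ℂ) :=
  ⟨!![Complex.exp (-(α / 2 : ℝ) * Complex.I), 0; 0, Complex.exp ((α / 2 : ℝ) * Complex.I)], by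
    rw [Matrix.det_fin_two]
    simp [← Complex.exp_add]⟩

/-- The matrix of `rotation` turns points by -α, so pulling back turns circles by α. -/
theorem pull_rotation (α : ℝ) (H : OCircle) :
    pull (rotation α) H = ⟨H.w * Complex.exp (α * Complex.I), H.b, H.k⟩ := by
  have h1 : ∀ x : ℝ, star (Complex.exp (-(x : ℂ) * Complex.I)) = Complex.exp (x * Complex.I) := by
    intro x
    rw [Complex.star_def, ← Complex.exp_conj]
    simp
  have h2 : ∀ x : ℝ, Complex.normSq (Complex.exp (-(x : ℂ) * Complex.I)) = 1 := by
    intro x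
    rw [Complex.normSq_eq_norm_sq, ← Complex.ofReal_neg, Complex.norm_exp_ofReal_mul_I]; norm_num
  have h3 : ∀ x : ℝ, Complex.normSq (Complex.exp ((x : ℂ) * Complex.I)) = 1 := by
    intro x
    rw [Complex.normSq_eq_norm_sq, Complex.norm_exp_ofReal_mul_I]; norm_num
  ext1
  · simp only [pull, rotation]
    simp only [Matrix.of_apply, Matrix.cons_val', Matrix.cons_val_zero, Matrix.cons_val_one,
      Matrix.cons_val_fin_one, h1]
    rw [mul_assoc, ← Complex.exp_add]
    simp
    ring_nf
    simp
  · simp only [pull, rotation, form]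
    have h4 := h2 (α / 2)
    rw [neg_mul] at h4
    simp [-Complex.ofReal_div, h4]
  · simp only [pull, rotation, form]
    simp [-Complex.ofReal_div, h3]

theorem inn_unitDisk {ρ : ℝ} (hρ : 0 < ρ) (α β : ℝ) :
    inn (unitDisk ρ (Complex.exp (α * Complex.I))) (unitDisk ρ (Complex.exp (β * Complex.I)))
      = (Real.cos (α - β) - (1 - ρ ^ 2)) / ρ ^ 2 := by
  simp only [inn, unitDisk, Complex.div_ofReal_re, Complex.div_ofReal_im,
      Complex.exp_ofReal_mul_I_re,
    Complex.exp_ofReal_mul_I_im, Real.cos_sub]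
  field_simp
  ring

theorem inn_orthCircle_unitDisk {ρ C : ℝ} (hρ : 0 < ρ) (α β : ℝ) :
    inn (orthCircle ρ C (Complex.exp (α * Complex.I))) (unitDisk ρ (Complex.exp (β * Complex.I)))
      = (C - Real.cos (α - β)) / ρ ^ 2 := by
  have h1 : 0 < 1 + ρ := by positivity
  simp only [inn, unitDisk, orthCircle, Complex.div_ofReal_re, Complex.div_ofReal_im,
    Complex.exp_ofReal_mul_I_re, Complex.exp_ofReal_mul_I_im, Real.cos_sub, Complex.neg_re,
    Complex.neg_im]
  field_simp
  ring

theorem inn_orthCircle {ρ C : ℝ} (hρ : 0 < ρ) (α β : ℝ) :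
    inn (orthCircle ρ C (Complex.exp (α * Complex.I)))
        (orthCircle ρ C (Complex.exp (β * Complex.I)))
      = (Real.cos (α - β) - C ^ 2) / ρ ^ 2 := by
  have h1 : 0 < 1 + ρ := by positivity
  simp only [inn, orthCircle, Complex.div_ofReal_re, Complex.div_ofReal_im,
    Complex.exp_ofReal_mul_I_re, Complex.exp_ofReal_mul_I_im, Real.cos_sub, Complex.neg_re,
    Complex.neg_im]
  field_simp
  ring

theorem inn_outerDisk_unitDisk {ρ : ℝ} (hρ : 0 < ρ) (u : ℂ) :
    inn (outerDisk ρ) (unitDisk ρ u) = -1 := by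
  have h1 : 0 < 1 + ρ := by positivity
  simp only [inn, outerDisk, unitDisk, Complex.zero_re, Complex.zero_im]
  field_simp
  ring

theorem inn_outerDisk {ρ : ℝ} (hρ : 0 < ρ) : inn (outerDisk ρ) (outerDisk ρ) = 1 := by
  have h1 : 0 < 1 + ρ := by positivity
  simp only [inn, outerDisk, Complex.zero_re, Complex.zero_im]
  field_simp
  ring

theorem inn_orthCircle_outerDisk {ρ : ℝ} (C : ℝ) (hρ : 0 < ρ) (u : ℂ) :
    inn (orthCircle ρ C u) (outerDisk ρ) = 0 := by
  have h1 : 0 < 1 + ρ := by positivity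
  simp only [inn, outerDisk, orthCircle, Complex.zero_re, Complex.zero_im]
  field_simp
  ring

theorem pull_rotation_unitDisk (ρ α β : ℝ) :
    pull (rotation β) (unitDisk ρ (Complex.exp (α * Complex.I))) =
      unitDisk ρ (Complex.exp ((α + β : ℝ) * Complex.I)) := by
  rw [pull_rotation]
  simp only [unitDisk, div_mul_eq_mul_div, ← Complex.exp_add, Complex.ofReal_add, add_mul]

theorem frame_outer {ρ C : ℝ} (hρ : 0 < ρ) (h : C ^ 2 + ρ ^ 2 = 1) {γ : ℝ} (hc : Real.cos γ = C)
    (hs : Real.sin γ = ρ) (β : ℝ) :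
    Frame (unitDisk ρ (Complex.exp ((β - γ : ℝ) * Complex.I)))
      (unitDisk ρ (Complex.exp ((β + γ : ℝ) * Complex.I))) (outerDisk ρ)
      (orthCircle ρ C (Complex.exp (β * Complex.I))) := by
  have h1 : (⟨C, ρ⟩ : ℂ) = Complex.exp (γ * Complex.I) := by
    apply Complex.ext <;> simp [Complex.exp_ofReal_mul_I_re, Complex.exp_ofReal_mul_I_im, hc, hs]
  have h2 : (⟨C, -ρ⟩ : ℂ) = Complex.exp ((-γ : ℝ) * Complex.I) := by
    apply Complex.ext <;> simp only [Complex.exp_ofReal_mul_I_re, Complex.exp_ofReal_mul_I_im,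
      Real.cos_neg, Real.sin_neg, hc, hs]
  have := (frame_outer_base hρ h).pull (rotation β)
  rw [h1, h2] at this
  rw [pull_rotation_unitDisk, pull_rotation_unitDisk, neg_add_eq_sub, add_comm γ] at this
  simpa [pull_rotation, outerDisk, orthCircle, div_mul_eq_mul_div] using this

theorem frame_three {ρ : ℝ} (hρ : 0 < ρ) (h : 4 * ρ ^ 2 = 3) {γ : ℝ} (hc : Real.cos γ = 1 / 2)
    (hs : Real.sin γ = ρ) (hp : Complex.exp ((3 * γ : ℝ) * Complex.I) = -1) (β : ℝ) :
    Frame (unitDisk ρ (Complex.exp ((β - γ : ℝ) * Complex.I)))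
      (unitDisk ρ (Complex.exp ((β + γ : ℝ) * Complex.I)))
      (unitDisk ρ (Complex.exp ((β + 3 * γ : ℝ) * Complex.I))) ⟨0, 2, -1 / 2⟩ := by
  have h1 : (⟨1 / 2, ρ⟩ : ℂ) = Complex.exp (γ * Complex.I) := by
    apply Complex.ext <;> simp [Complex.exp_ofReal_mul_I_re, Complex.exp_ofReal_mul_I_im, hc, hs]
  have h2 : (⟨1 / 2, -ρ⟩ : ℂ) = Complex.exp ((-γ : ℝ) * Complex.I) := by
    apply Complex.ext <;> simp [Complex.exp_ofReal_mul_I_re, Complex.exp_ofReal_mul_I_im,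
      Real.cos_neg, Real.sin_neg, hc, hs, -Complex.ofReal_neg]
  have := (frame_three_base hρ h).pull (rotation β)
  rw [h1, h2, ← hp] at this
  rw [pull_rotation_unitDisk, pull_rotation_unitDisk, pull_rotation_unitDisk, neg_add_eq_sub,
    add_comm γ, add_comm (3 * γ)] at this
  simpa [pull_rotation] using this

/-- The cosine is even and symmetric about π, so strict monotonicity on [0, π] suffices. The case of
equality later identifies the tangent disks of a ring. -/
theorem cos_le_cos_of_abs {x α : ℝ} (h0 : 0 ≤ α) (h1 : α ≤ |x|) (h2 : |x| ≤ 2 * Real.pi - α) :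
    Real.cos x ≤ Real.cos α ∧
      (Real.cos x = Real.cos α → |x| = α ∨ |x| = 2 * Real.pi - α) := by
  rw [← Real.cos_abs x]
  generalize |x| = y at *
  rcases le_total y Real.pi with h3 | h3
  · refine ⟨Real.cos_le_cos_of_nonneg_of_le_pi h0 h3 h1, fun h => Or.inl ?_⟩
    exact Real.injOn_cos ⟨by linarith, h3⟩ ⟨h0, by linarith⟩ h
  · rw [← Real.cos_two_pi_sub y]
    refine ⟨Real.cos_le_cos_of_nonneg_of_le_pi h0 (by linarith) (by linarith), fun h => Or.inr ?_⟩
    have := Real.injOn_cos ⟨by linarith, by linarith⟩ ⟨h0, by linarith⟩ h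
    linarith

/-! ### The regular ring of `N` disks -/

section Ring

variable (N : ℕ)

/-- The common radius of the disks of the regular ring. -/
noncomputable def rad : ℝ := Real.sin (Real.pi / N)

/-- The angle of a disk of the regular ring. -/
noncomputable def ang (j : ZMod N) : ℝ := 2 * Real.pi * j.val / N

/-- The disks of the regular ring, with centres on the unit circle. -/
noncomputable def rd (j : ZMod N) : OCircle :=
  unitDisk (rad N) (Complex.exp (ang N j * Complex.I))

/-- The outer disk tangent to all disks of the regular ring. -/
noncomputable def od : OCircle := outerDisk (rad N)

/-- The circle orthogonal to the outer disk and two consecutive disks of the regular ring. -/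
noncomputable def oc (j : ZMod N) : OCircle :=
  orthCircle (rad N) (Real.cos (Real.pi / N))
    (Complex.exp ((ang N j + Real.pi / N : ℝ) * Complex.I))

variable {N}

theorem rad_pos (hN : 3 ≤ N) : 0 < rad N := by
  have h : (3 : ℝ) ≤ N := by exact_mod_cast hN
  apply Real.sin_pos_of_pos_of_lt_pi
  · positivity
  · exact div_lt_self Real.pi_pos (by linarith)

theorem cos_two_pi_div (N : ℕ) : Real.cos (2 * Real.pi / N) = 1 - 2 * rad N ^ 2 := by
  have h1 := Real.cos_two_mul (Real.pi / N)
  have h2 := Real.sin_sq_add_cos_sq (Real.pi / N)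
  rw [mul_div_assoc, h1, rad]
  linarith

/-- The angle is defined by the representative in [0, N) and jumps from the last disk to the first;
only its exponential is additive. -/
theorem exp_ang_add_one (hN : 3 ≤ N) (j : ZMod N) : Complex.exp (ang N (j + 1) * Complex.I) =
    Complex.exp ((ang N j + 2 * (Real.pi / N) : ℝ) * Complex.I) := by
  have : NeZero N := ⟨by omega⟩
  have h : ∀ j : ZMod N, Complex.exp (ang N j * Complex.I) = ZMod.toCircle j := by
    intro j
    rw [ZMod.toCircle_apply, ang]
    push_cast
    ring_nf
  have h1 : Complex.exp ((2 * (Real.pi / N) : ℝ) * Complex.I) = ZMod.toCircle (1 : ZMod N) := by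
    have := ZMod.toCircle_natCast (N := N) 1
    rw [Nat.cast_one] at this
    rw [this]
    push_cast
    ring_nf
  rw [Complex.ofReal_add, add_mul, Complex.exp_add, h, h, h1, AddChar.map_add_eq_mul]
  simp

/-- Two angles differ by a multiple m + 1 of 2π/N with 1 ≤ m + 1 ≤ N - 1. The extreme multiples
belong to neighbours, the larger one to the pair of last and first disk. -/
theorem inn_rd_aux (hN : 3 ≤ N) {i j : ZMod N} (h : i ≠ j) :
    2 * Real.pi / N ≤ |ang N i - ang N j| ∧ |ang N i - ang N j| ≤ 2 * Real.pi - 2 * Real.pi / N ∧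
    (|ang N i - ang N j| = 2 * Real.pi / N ∨ |ang N i - ang N j| = 2 * Real.pi - 2 * Real.pi / N →
      j = i + 1 ∨ i = j + 1) := by
  have : NeZero N := ⟨by omega⟩
  wlog hlt : j.val < i.val generalizing i j
  · have hne : i.val ≠ j.val := fun h' => h (ZMod.val_injective N h')
    obtain ⟨h1, h2, h3⟩ := this h.symm (by omega)
    rw [abs_sub_comm] at h1 h2 h3
    exact ⟨h1, h2, fun h4 => (h3 h4).symm⟩
  have hN0 : (0 : ℝ) < N := by exact_mod_cast (by omega : 0 < N)
  obtain ⟨m, hm⟩ := Nat.exists_eq_add_of_lt hlt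
  have hi := ZMod.val_lt i
  have e1 : ang N i - ang N j = 2 * Real.pi / N * (m + 1) := by
    rw [ang, ang, hm]; push_cast; ring
  have hpos : 0 < 2 * Real.pi / N := by positivity
  have e2 : 2 * Real.pi = 2 * Real.pi / N * N := by field_simp
  have e3 : |ang N i - ang N j| = 2 * Real.pi / N * (m + 1) := by
    rw [e1, abs_of_nonneg (by positivity)]
  have hmN : ((m : ℝ) + 2) ≤ N := by exact_mod_cast (by omega : m + 2 ≤ N)
  rw [e3]
  refine ⟨by nlinarith, by nlinarith, ?_⟩
  rintro (h4 | h4)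
  · right
    have h5 : 2 * Real.pi / N * m = 0 := by linarith
    have h6 : m = 0 := by
      rcases mul_eq_zero.1 h5 with h | h
      · exact absurd h hpos.ne'
      · exact_mod_cast h
    rw [← ZMod.natCast_zmod_val i, ← ZMod.natCast_zmod_val j, hm, h6]
    push_cast; ring
  · left
    have h5 : 2 * Real.pi / N * (m + 2 - N) = 0 := by linarith
    have h6 : m + 2 = N := by
      rcases mul_eq_zero.1 h5 with h | h
      · exact absurd h hpos.ne'
      · exact_mod_cast (by linarith : (m : ℝ) + 2 = N)
    have h7 : j.val = 0 := by omega
    have h8 : i.val + 1 = N := by omega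
    have h9 : j = 0 := by rwa [ZMod.val_eq_zero] at h7
    rw [← ZMod.natCast_zmod_val i, h9]
    have := congrArg (Nat.cast : ℕ → ZMod N) h8
    push_cast at this ⊢
    rw [this, ZMod.natCast_self]

theorem inn_rd_self (hN : 3 ≤ N) (j : ZMod N) : inn (rd N j) (rd N j) = 1 := by
  have := rad_pos hN
  rw [rd, inn_unitDisk this, sub_self, Real.cos_zero]
  field_simp
  ring

theorem inn_rd_le (hN : 3 ≤ N) {i j : ZMod N} (h : i ≠ j) : inn (rd N i) (rd N j) ≤ -1 ∧
    (inn (rd N i) (rd N j) = -1 → j = i + 1 ∨ i = j + 1) := by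
  have hr := rad_pos hN
  obtain ⟨h1, h2, h3⟩ := inn_rd_aux hN h
  have h4 := cos_le_cos_of_abs (by positivity) h1 h2
  rw [cos_two_pi_div N] at h4
  rw [rd, rd, inn_unitDisk hr, div_le_iff₀ (by positivity), div_eq_iff (by positivity)]
  exact ⟨by linarith [h4.1], fun h5 => h3 (h4.2 (by linarith))⟩

theorem inn_od_rd (hN : 3 ≤ N) (j : ZMod N) : inn (od N) (rd N j) = -1 :=
  inn_outerDisk_unitDisk (rad_pos hN) _

theorem inn_od_self (hN : 3 ≤ N) : inn (od N) (od N) = 1 := inn_outerDisk (rad_pos hN)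

theorem inn_oc_od (hN : 3 ≤ N) (j : ZMod N) : inn (oc N j) (od N) = 0 :=
  inn_orthCircle_outerDisk _ (rad_pos hN) _

/-- The direction of the orthogonal circle lies halfway between two neighbouring disks, hence at an
odd multiple of π/N from each disk of the ring. -/
theorem inn_oc_rd (hN : 3 ≤ N) (i j : ZMod N) : 0 ≤ inn (oc N i) (rd N j) := by
  have : NeZero N := ⟨by omega⟩
  rw [oc, rd, inn_orthCircle_unitDisk (rad_pos hN)]
  apply div_nonneg _ (by positivity)
  rw [sub_nonneg]
  have hN0 : (0 : ℝ) < N := by exact_mod_cast (by omega : 0 < N)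
  have hpos : 0 < Real.pi / N := by positivity
  have e2 : Real.pi = Real.pi / N * N := by field_simp
  have e1 : ang N i + Real.pi / N - ang N j = Real.pi / N * (2 * ((i.val : ℝ) - j.val) + 1) := by
    rw [ang, ang]; ring
  rw [e1]
  have hi : (i.val : ℝ) + 1 ≤ N := by exact_mod_cast ZMod.val_lt i
  have hj : (j.val : ℝ) + 1 ≤ N := by exact_mod_cast ZMod.val_lt j
  have hi0 : (0 : ℝ) ≤ i.val := by positivity
  have hj0 : (0 : ℝ) ≤ j.val := by positivity
  refine (cos_le_cos_of_abs hpos.le ?_ ?_).1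
  · rw [abs_mul, abs_of_pos hpos]
    apply le_mul_of_one_le_right hpos.le
    rcases le_or_gt j.val i.val with h | h
    · have : (j.val : ℝ) ≤ i.val := by exact_mod_cast h
      exact le_abs.2 (Or.inl (by linarith))
    · have : (i.val : ℝ) + 1 ≤ j.val := by exact_mod_cast h
      exact le_abs.2 (Or.inr (by linarith))
  · rw [abs_mul, abs_of_pos hpos]
    have : |2 * ((i.val : ℝ) - j.val) + 1| ≤ 2 * N - 1 := abs_le.2 ⟨by linarith, by linarith⟩
    nlinarith

/-- With ρ the radius and C = cos(π/N), one has cos(2π/N) = C² - ρ² ≤ C². -/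
theorem inn_oc_oc (hN : 3 ≤ N) {i j : ZMod N} (h : i ≠ j) : inn (oc N i) (oc N j) ≤ 0 := by
  have hr := rad_pos hN
  obtain ⟨h1, h2, h3⟩ := inn_rd_aux hN h
  have h4 := (cos_le_cos_of_abs (by positivity) h1 h2).1
  rw [cos_two_pi_div N] at h4
  have h5 := Real.sin_sq_add_cos_sq (Real.pi / N)
  rw [oc, oc, inn_orthCircle hr, div_le_iff₀ (by positivity)]
  rw [rad] at *
  rw [add_sub_add_right_eq_sub]
  nlinarith

theorem frame_rd (hN : 3 ≤ N) (j : ZMod N) : Frame (rd N j) (rd N (j + 1)) (od N) (oc N j) := by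
  have hr := rad_pos hN
  have := frame_outer hr (C := Real.cos (Real.pi / N)) (by rw [rad]; exact Real.cos_sq_add_sin_sq _)
    rfl rfl (ang N j + Real.pi / N)
  rw [rd, rd, od, oc, exp_ang_add_one hN]
  rwa [add_sub_cancel_right, add_assoc, ← two_mul] at this

theorem frame_rd_three (j : ZMod 3) :
    Frame (rd 3 j) (rd 3 (j + 1)) (rd 3 (j + 1 + 1)) ⟨0, 2, -1 / 2⟩ := by
  have hr := rad_pos (le_refl 3)
  have h3 : rad 3 = √3 / 2 := by rw [rad, Nat.cast_ofNat, Real.sin_pi_div_three]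
  have h4 : 4 * rad 3 ^ 2 = 3 := by
    rw [h3, div_pow, Real.sq_sqrt (by norm_num)]; norm_num
  have := frame_three hr h4 (γ := Real.pi / (3 : ℕ)) (by rw [Nat.cast_ofNat, Real.cos_pi_div_three])
    rfl (by
      rw [show 3 * (Real.pi / (3 : ℕ)) = Real.pi by push_cast; ring, Complex.exp_pi_mul_I])
    (ang 3 j + Real.pi / (3 : ℕ))
  have h5 : Complex.exp (ang 3 (j + 1 + 1) * Complex.I) =
      Complex.exp ((ang 3 j + 4 * (Real.pi / (3 : ℕ)) : ℝ) * Complex.I) := by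
    have e := exp_ang_add_one (le_refl 3) (j + 1)
    rw [Complex.ofReal_add, add_mul, Complex.exp_add, exp_ang_add_one (le_refl 3) j,
      ← Complex.exp_add] at e
    rw [e]
    congr 1; push_cast; ring
  rw [rd, rd, rd, exp_ang_add_one (le_refl 3), h5]
  rwa [add_sub_cancel_right, add_assoc, ← two_mul, add_assoc, ← one_add_mul,
    show (1 + 3 : ℝ) = 4 by norm_num] at this

/-- Together with `inn_three_oc`, this makes `Insertion.normal_nonpos` applicable to the inner
circle of a ring of three. -/
theorem inn_three_od : inn ⟨0, 2, -1 / 2⟩ (od 3) ≤ 0 := by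
  have hr := rad_pos (le_refl 3)
  have h : 0 ≤ 1 / (1 + rad 3) := by positivity
  simp only [inn, od, outerDisk, Complex.zero_re, Complex.zero_im]
  rw [neg_div]
  linarith

theorem inn_three_oc (j : ZMod 3) : 0 ≤ inn ⟨0, 2, -1 / 2⟩ (oc 3 j) := by
  have hr := rad_pos (le_refl 3)
  have h1 : 0 < 1 + rad 3 := by positivity
  have hc : Real.cos (Real.pi / (3 : ℕ)) = 1 / 2 := by rw [Nat.cast_ofNat, Real.cos_pi_div_three]
  simp only [inn, oc, orthCircle, Complex.zero_re, Complex.zero_im, hc]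
  have : 1 / (rad 3 * (1 + rad 3)) ≤ (1 + rad 3) / rad 3 := by
    rw [div_le_div_iff₀ (by positivity) (by positivity)]
    nlinarith [mul_pos hr hr, mul_pos (mul_pos hr hr) hr]
  have e1 : -(1 / 2 * (1 + rad 3)) / rad 3 = -((1 + rad 3) / rad 3) / 2 := by ring
  have e2 : -(1 / 2) / (rad 3 * (1 + rad 3)) = -(1 / (rad 3 * (1 + rad 3))) / 2 := by ring
  rw [e1, e2]
  have h2 : 0 < (1 + rad 3) / rad 3 := by positivity
  linarith

end Ring

end OCircle

namespace OCircle

/-! ### The disk bounded by an oriented circle -/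

/-- The disk of the Riemann sphere bounded by an oriented circle. -/
def sdisk (H : OCircle) : Set (OnePoint ℂ) :=
  {p | p.elim (H.b ≤ 0) (fun z => H.form z 1 ≤ 0)}

/-- The point of the Riemann sphere with given homogeneous coordinates. -/
noncomputable def point (z₁ z₂ : ℂ) : OnePoint ℂ :=
  if z₂ = 0 then OnePoint.infty else ((z₁ / z₂ : ℂ) : OnePoint ℂ)

theorem form_mul (H : OCircle) (t z₁ z₂ : ℂ) :
    H.form (t * z₁) (t * z₂) = Complex.normSq t * H.form z₁ z₂ := by
  simp [form, Complex.normSq_apply]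
  ring

/-- Rescaling homogeneous coordinates by t multiplies the form by |t|², so its sign depends on the
point only. -/
theorem point_mem_sdisk (H : OCircle) {z₁ z₂ : ℂ} (h : z₁ ≠ 0 ∨ z₂ ≠ 0) :
    point z₁ z₂ ∈ H.sdisk ↔ H.form z₁ z₂ ≤ 0 := by
  unfold point sdisk
  by_cases h2 : z₂ = 0
  · have h1 : z₁ ≠ 0 := by tauto
    have h3 : 0 < Complex.normSq z₁ := Complex.normSq_pos.2 h1
    simp only [h2, if_true, Set.mem_ofPred_eq, OnePoint.elim_infty]
    simp [form, mul_nonpos_iff, h3.le, h3.not_ge]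
  · have h3 : 0 < Complex.normSq z₂ := Complex.normSq_pos.2 h2
    simp only [h2, if_false, Set.mem_ofPred_eq, OnePoint.elim_some]
    have : H.form z₁ z₂ = Complex.normSq z₂ * H.form (z₁ / z₂) 1 := by
      rw [← form_mul, mul_div_cancel₀ _ h2, mul_one]
    rw [this]
    simp [mul_nonpos_iff, h3.le, h3.not_ge]

theorem exists_point (p : OnePoint ℂ) : ∃ z₁ z₂ : ℂ, (z₁ ≠ 0 ∨ z₂ ≠ 0) ∧ p = point z₁ z₂ := by
  induction p using OnePoint.rec with
  | infty => exact ⟨1, 0, by simp, by simp [point]⟩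
  | coe z => exact ⟨z, 1, by simp, by simp [point]⟩

theorem smul_point (h : SL(2, ℂ)) {z₁ z₂ : ℂ} (hz : z₁ ≠ 0 ∨ z₂ ≠ 0) :
    (h : GL (Fin 2) ℂ) • point z₁ z₂ = point (h 0 0 * z₁ + h 0 1 * z₂)
        (h 1 0 * z₁ + h 1 1 * z₂) := by
  have hc : ∀ i j, (h : GL (Fin 2) ℂ) i j = h i j := fun i j => rfl
  unfold point
  by_cases h2 : z₂ = 0
  · have h1 : z₁ ≠ 0 := by tauto
    simp only [h2, if_true, OnePoint.smul_infty_eq_ite, hc, mul_zero, add_zero]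
    simp only [mul_eq_zero, h1, or_false]
    congr 2
    rw [mul_div_mul_right _ _ h1]
  · simp only [h2, if_false, OnePoint.smul_some_eq_ite, hc]
    have e : ∀ a b : ℂ, a * (z₁ / z₂) + b = (a * z₁ + b * z₂) / z₂ := by
      intro a b; field_simp
    simp only [e, div_eq_zero_iff, h2, or_false, div_div_div_cancel_right₀ h2]

theorem smul_point_ne (h : SL(2, ℂ)) {z₁ z₂ : ℂ} (hz : z₁ ≠ 0 ∨ z₂ ≠ 0) :
    h 0 0 * z₁ + h 0 1 * z₂ ≠ 0 ∨ h 1 0 * z₁ + h 1 1 * z₂ ≠ 0 := by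
  by_contra! hcon
  have hd : h 0 0 * h 1 1 - h 0 1 * h 1 0 = 1 := by
    have := h.det_coe
    rwa [Matrix.det_fin_two] at this
  have e1 : z₁ = 0 := by linear_combination (-z₁) * hd + h 1 1 * hcon.1 - h 0 1 * hcon.2
  have e2 : z₂ = 0 := by linear_combination (-z₂) * hd + h 0 0 * hcon.2 - h 1 0 * hcon.1
  tauto

theorem smul_mem_sdisk (h : SL(2, ℂ)) (H : OCircle) (p : OnePoint ℂ) :
    (h : GL (Fin 2) ℂ) • p ∈ H.sdisk ↔ p ∈ (pull h H).sdisk := by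
  obtain ⟨z₁, z₂, hz, rfl⟩ := exists_point p
  rw [smul_point h hz, point_mem_sdisk _ hz, point_mem_sdisk _ (smul_point_ne h hz), form_pull]

theorem image_sdisk_pull (h : SL(2, ℂ)) (H : OCircle) :
    (fun z : OnePoint ℂ => (h : GL (Fin 2) ℂ) • z) '' (pull h H).sdisk = H.sdisk := by
  ext p
  constructor
  · rintro ⟨q, hq, rfl⟩
    exact (smul_mem_sdisk h H q).2 hq
  · intro hp
    exact ⟨(h : GL (Fin 2) ℂ)⁻¹ • p, by rw [← smul_mem_sdisk, smul_inv_smul]; exact hp,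
      smul_inv_smul _ _⟩

/-- Completing the square: for a unit vector, b times the form at z is |bz - w|² - 1. -/
theorem sdisk_eq_sphereDisk {H : OCircle} (h1 : inn H H = 1) (hb : 0 < H.b) :
    H.sdisk = sphereDisk (H.w / H.b) (1 / H.b) := by
  have hk : H.k * H.b = Complex.normSq H.w - 1 := by
    rw [inn] at h1
    rw [Complex.normSq_apply]
    linarith
  ext p
  induction p using OnePoint.rec with
  | infty =>
    simp [sdisk, sphereDisk, hb]
  | coe z =>
    simp only [sdisk, sphereDisk, Set.mem_ofPred_eq, OnePoint.elim_some, Set.mem_image,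
      OnePoint.coe_eq_coe, exists_eq_right, Metric.mem_closedBall]
    rw [← sq_le_sq₀ dist_nonneg (by positivity), Complex.dist_eq, ← Complex.normSq_eq_norm_sq]
    have e : H.b ^ 2 * (Complex.normSq (z - H.w / H.b) - (1 / H.b) ^ 2) = H.b * H.form z 1 := by
      have e2 : H.b * H.form z 1 = H.b * H.b * Complex.normSq z
          - 2 * H.b * (star H.w * z * star 1).re + H.k * H.b := by
        simp [form]; ring
      rw [e2, hk]
      simp only [Complex.normSq_apply, Complex.sub_re, Complex.sub_im, Complex.div_ofReal_re,
        Complex.div_ofReal_im, star_one, mul_one, Complex.star_def, Complex.mul_re, Complex.conj_re,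
        Complex.conj_im]
      field_simp
      ring
    constructor
    · intro h2
      have : H.b * H.form z 1 ≤ 0 := mul_nonpos_of_nonneg_of_nonpos hb.le h2
      rw [← e] at this
      nlinarith [pow_pos hb 2]
    · intro h2
      have : H.b * H.form z 1 ≤ 0 := by
        rw [← e]
        exact mul_nonpos_of_nonneg_of_nonpos (by positivity) (by linarith)
      nlinarith

/-- This is the dictionary between `inn` and Euclidean geometry: the value -1 gives the sum of the
radii as distance, and smaller values a larger distance. -/
theorem dist_sq_centre {H K : OCircle} (hH : inn H H = 1) (hK : inn K K = 1) (bH : 0 < H.b)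
    (bK : 0 < K.b) : dist (H.w / H.b) (K.w / K.b) ^ 2 =
      (1 / H.b + 1 / K.b) ^ 2 - 2 * (1 / H.b) * (1 / K.b) * (inn H K + 1) := by
  rw [Complex.dist_eq, ← Complex.normSq_eq_norm_sq]
  simp only [inn] at hH hK ⊢
  simp only [Complex.normSq_apply, Complex.sub_re, Complex.sub_im, Complex.div_ofReal_re,
    Complex.div_ofReal_im]
  field_simp
  linear_combination (K.b ^ 2) * hH + (H.b ^ 2) * hK

theorem dist_centre_eq {H K : OCircle} (hH : inn H H = 1) (hK : inn K K = 1) (bH : 0 < H.b)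
    (bK : 0 < K.b) : dist (H.w / H.b) (K.w / K.b) = 1 / H.b + 1 / K.b ↔ inn H K = -1 := by
  have h := dist_sq_centre hH hK bH bK
  have h1 : 0 < 2 * (1 / H.b) * (1 / K.b) := by positivity
  constructor
  · intro h2
    rw [h2] at h
    nlinarith
  · intro h2
    rw [h2] at h
    rw [← sq_eq_sq₀ dist_nonneg (by positivity)]
    linarith

theorem disjoint_ball {H K : OCircle} (hH : inn H H = 1) (hK : inn K K = 1) (bH : 0 < H.b)
    (bK : 0 < K.b) (h : inn H K ≤ -1) :
    Disjoint (Metric.ball (H.w / H.b) (1 / H.b)) (Metric.ball (K.w / K.b) (1 / K.b)) := by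
  apply Metric.ball_disjoint_ball
  rw [← sq_le_sq₀ (by positivity) dist_nonneg, dist_sq_centre hH hK bH bK]
  have h1 : 0 < 2 * (1 / H.b) * (1 / K.b) := by positivity
  nlinarith

theorem isTangencyPacking {W : Type u} (G : SimpleGraph W) (v : W → OCircle)
    (h1 : ∀ x, inn (v x) (v x) = 1) (hb : ∀ x, 0 < (v x).b)
    (h2 : ∀ x y, x ≠ y → inn (v x) (v y) ≤ -1)
    (h3 : ∀ x y, inn (v x) (v y) = -1 ↔ G.Adj x y) :
    IsTangencyPacking G (fun x => (v x).w / (v x).b) (fun x => 1 / (v x).b) where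
  radius_pos x := one_div_pos.2 (hb x)
  interior_disjoint x y hxy := disjoint_ball (h1 x) (h1 y) (hb x) (hb y) (h2 x y hxy)
  tangent_iff x y := by rw [dist_centre_eq (h1 x) (h1 y) (hb x) (hb y), h3]

/-- A frame can be moved so that all disks on its outer side become bounded. -/
theorem Frame.exists_bounded {a b c n : OCircle} (h : Frame a b c n) :
    ∃ g : SL(2, ℂ), ∀ z, (inn z a ≤ -1 ∨ z = a) → (inn z b ≤ -1 ∨ z = b) →
      (inn z c ≤ -1 ∨ z = c) → inn n z ≤ 0 → 0 < (OCircle.pull g z).b := by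
  obtain ⟨k, rfl, rfl, rfl, rfl⟩ := h
  -- After the flip, the outer side of the frame is the bounded gap between the three disks of the
  -- ring.
  have hF := (frame_rd_three 0).flip
  obtain ⟨l, ha, hb, hc, hn⟩ := hF
  refine ⟨k⁻¹ * l, fun z hza hzb hzc hzn => ?_⟩
  have hr := rad_pos (le_refl 3)
  have hF := (frame_rd_three 0).flip
  have key : ∀ H : OCircle, inn (OCircle.pull (k⁻¹ * l) z) (OCircle.pull l H) =
      inn z (OCircle.pull k H) := by
    intro H
    rw [pull_mul, inn_pull, inn_pull_left]
    simp
  set Z := OCircle.pull (k⁻¹ * l) z with hZ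
  have hZe : ∀ H : OCircle, z = OCircle.pull k H → Z = OCircle.pull l H := by
    rintro H rfl
    rw [hZ, pull_mul, pull_pull_inv]
  rw [← key, ← ha] at hza
  rw [← key, ← hb] at hzb
  rw [← key, ← hc] at hzc
  rw [inn_comm, ← key, ← hn] at hzn
  -- The vector ⟨0, 0, 1⟩ stands for the point at infinity; its product with `Z` is -b/2, so the
  -- expansion in the frame gives the sign of `b`.
  have e := hF.inn_eq ⟨0, 0, 1⟩ Z
  have i1 : ∀ j : ZMod 3, inn ⟨0, 0, 1⟩ (rd 3 j) = -(1 / (2 * rad 3)) := by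
    intro j
    simp [inn, rd, unitDisk]
    ring
  have i2 : inn ⟨0, 0, 1⟩ (neg ⟨0, 2, -1 / 2⟩) = 1 := by
    norm_num [inn, neg]
  have i3 : inn ⟨0, 0, 1⟩ Z = - Z.b / 2 := by
    simp [inn]
    ring
  rw [i1, i1, i1, i2, i3, inn_comm _ Z, inn_comm _ Z, inn_comm _ Z, inn_comm _ Z] at e
  have hq : 0 < 1 / (2 * rad 3) := by positivity
  have n12 := hF.inn_ab
  have n23 := hF.rot.inn_ab
  have n31 := hF.rot.rot.inn_ab
  -- Either all three products are at most -1, or `Z` is one of the three disks and they add up to 1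
  -- - 1 - 1.
  have hsum : inn Z (rd 3 (0 + 1)) + inn Z (rd 3 0) + inn Z (rd 3 (0 + 1 + 1)) < 0 := by
    have e1 := hF.inn_aa
    have e2 := hF.rot.inn_aa
    have e3 := hF.rot.rot.inn_aa
    rcases hza with h1 | h1
    · rcases hzb with h2 | h2
      · rcases hzc with h3 | h3
        · linarith
        · rw [hZe _ h3, ← hc, n31, inn_comm, n23, e3]; norm_num
      · rw [hZe _ h2, ← hb, n23, inn_comm, n12, e2]; norm_num
    · rw [hZe _ h1, ← ha, n12, inn_comm (rd 3 (0 + 1)) (rd 3 (0 + 1 + 1)), n31, e1]; norm_num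
  nlinarith [mul_pos_of_neg_of_neg hsum (neg_neg_of_pos hq)]

end OCircle

/-! ### Euler's formula and cohomology modulo two -/

namespace CombMap

variable {D : Type u}

theorem facePerm_apply (M : CombMap D) (d : D) :
    M.facePerm d = M.vertexPerm (M.edgePerm d) := rfl

/-- The first cohomology of the surface vanishes modulo two: every colouring of the corners that is
balanced around all edges is a sum of a colouring of the faces and a colouring of the vertices. -/
def Jordan (M : CombMap D) : Prop :=
  ∀ k : D → ZMod 2,
    (∀ d, k d + k (M.vertexPerm d) + (k (M.edgePerm d) + k (M.vertexPerm (M.edgePerm d))) = 0) →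
    ∃ h g : D → ZMod 2, (∀ d, h (M.facePerm d) = h d) ∧ (∀ d, g (M.vertexPerm d) = g d) ∧
      ∀ d, k d = h d + g d

/-- The functions that are invariant under a permutation. -/
def invariants (π : Equiv.Perm D) : Submodule (ZMod 2) (D → ZMod 2) where
  carrier := {f | ∀ d, f (π d) = f d}
  add_mem' hf hg d := by simp [hf d, hg d]
  zero_mem' d := rfl
  smul_mem' c f hf d := by simp [hf d]

theorem mem_invariants {π : Equiv.Perm D} {f : D → ZMod 2} :
    f ∈ invariants π ↔ ∀ d, f (π d) = f d := Iff.rfl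

/-- With propositions as values this is also induction along a cycle, which is its most frequent
use. -/
theorem invariants_sameCycle {π : Equiv.Perm D} {α : Type*} {f : D → α} (hf : ∀ d, f (π d) = f d)
    {d e : D} (h : π.SameCycle d e) : f d = f e := by
  obtain ⟨i, rfl⟩ := h
  induction i with
  | zero => rfl
  | succ n ih => rw [add_comm, zpow_add, zpow_one, Equiv.Perm.mul_apply, hf, ih]
  | pred n ih =>
    rw [ih, ← hf ((π ^ (-(n : ℤ) - 1)) d), ← Equiv.Perm.mul_apply, ← zpow_one_add]
    congr 3; ring

theorem finrank_invariants [Finite D] (π : Equiv.Perm D) :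
    Module.finrank (ZMod 2) (invariants π) =
      Nat.card (Quotient (Equiv.Perm.SameCycle.setoid π)) := by
  classical
  have := Fintype.ofFinite D
  have e : (Quotient (Equiv.Perm.SameCycle.setoid π) → ZMod 2) ≃ₗ[ZMod 2] invariants π :=
    { toFun := fun f => ⟨fun d => f (Quotient.mk _ d), fun d => by
        exact congrArg f (Quotient.sound (s := Equiv.Perm.SameCycle.setoid π)
          (Equiv.Perm.sameCycle_apply_left.2 (Equiv.Perm.SameCycle.refl π d)))⟩
      map_add' := fun _ _ => rfl
      map_smul' := fun _ _ => rfl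
      invFun := fun f q => q.lift f.1 fun _ _ h => invariants_sameCycle f.2 h
      left_inv := fun f => by
        ext q
        induction q using Quotient.ind
        rfl
      right_inv := fun f => rfl }
  have := Fintype.ofFinite (Quotient (Equiv.Perm.SameCycle.setoid π))
  rw [← e.finrank_eq, Module.finrank_fintype_fun_eq_card, Nat.card_eq_fintype_card]

/-- Adding to a function its translate by a permutation. -/
def addTranslate (π : Equiv.Perm D) : (D → ZMod 2) →ₗ[ZMod 2] (D → ZMod 2) :=
  LinearMap.id + LinearMap.funLeft (ZMod 2) (ZMod 2) π

theorem addTranslate_apply (π : Equiv.Perm D) (f : D → ZMod 2) (d : D) :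
    addTranslate π f d = f d + f (π d) := rfl

theorem ker_addTranslate (π : Equiv.Perm D) : LinearMap.ker (addTranslate π) = invariants π := by
  ext f
  simp only [LinearMap.mem_ker, mem_invariants, funext_iff, addTranslate_apply, Pi.zero_apply,
    CharTwo.add_eq_zero]
  exact forall_congr' fun d => eq_comm

variable (M : CombMap D)

theorem edgePerm_inv : M.edgePerm⁻¹ = M.edgePerm := by
  ext d
  rw [Equiv.Perm.inv_eq_iff_eq, M.edgePerm_edgePerm]

/-- The transpose of `addTranslate π` is `addTranslate π⁻¹`. So the two composites are transposes of
square matrices and have the same rank. -/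
theorem finrank_ker_comp [Finite D] (π τ : Equiv.Perm D) :
    Module.finrank (ZMod 2) (LinearMap.ker (addTranslate π ∘ₗ addTranslate τ)) =
      Module.finrank (ZMod 2) (LinearMap.ker (addTranslate τ⁻¹ ∘ₗ addTranslate π⁻¹)) := by
  classical
  have := Fintype.ofFinite D
  have h : LinearMap.toMatrix' (addTranslate τ⁻¹ ∘ₗ addTranslate π⁻¹) =
      (LinearMap.toMatrix' (addTranslate π ∘ₗ addTranslate τ)).transpose := by
    ext d e
    simp only [Matrix.transpose_apply, LinearMap.toMatrix'_apply, LinearMap.comp_apply,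
      addTranslate_apply, Pi.single_apply, Equiv.Perm.inv_eq_iff_eq, eq_comm (a := d)]
    ring
  have h1 := Matrix.rank_transpose (LinearMap.toMatrix' (addTranslate π ∘ₗ addTranslate τ))
  rw [← h, Matrix.rank, Matrix.rank, ← Matrix.toLin'_apply', ← Matrix.toLin'_apply',
    Matrix.toLin'_toMatrix', Matrix.toLin'_toMatrix'] at h1
  have h2 := LinearMap.finrank_range_add_finrank_ker (addTranslate π ∘ₗ addTranslate τ)
  have h3 := LinearMap.finrank_range_add_finrank_ker (addTranslate τ⁻¹ ∘ₗ addTranslate π⁻¹)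
  omega

variable {M}

theorem eq_of_connected (hc : ∀ d e : D, ∃ g ∈ Subgroup.closure {M.vertexPerm, M.edgePerm}, g d = e)
    {α : Type*} {f : D → α} (h1 : ∀ d, f (M.vertexPerm d) = f d) (h2 : ∀ d, f (M.edgePerm d) = f d)
    (d e : D) : f d = f e := by
  obtain ⟨g, hg, rfl⟩ := hc d e
  have : ∀ d, f (g d) = f d := by
    induction hg using Subgroup.closure_induction with
    | mem x hx =>
      rcases hx with rfl | hx
      · exact h1
      · rw [Set.mem_singleton_iff.1 hx]; exact h2
    | one => intro d; rfl
    | mul x y _ _ hx hy => intro d; rw [Equiv.Perm.mul_apply, hx, hy]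
    | inv x _ hx => intro d; rw [← hx (x⁻¹ d)]; exact congrArg f (x.apply_symm_apply d)
  exact (this d).symm

theorem finrank_le_one (S : Submodule (ZMod 2) (D → ZMod 2)) [Nonempty D]
    (h : ∀ f ∈ S, ∀ d e, f d = f e) : Module.finrank (ZMod 2) S ≤ 1 := by
  have : S ≤ Submodule.span (ZMod 2) {fun _ => 1} := by
    intro f hf
    obtain ⟨d⟩ := ‹Nonempty D›
    rw [Submodule.mem_span_singleton]
    exact ⟨f d, by ext e; simp [h f hf d e]⟩
  have h2 := finrank_span_le_card (R := ZMod 2) ({fun _ => 1} : Set (D → ZMod 2))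
  simp only [Set.toFinset_singleton, Finset.card_singleton] at h2
  have h3 : FiniteDimensional (ZMod 2) (Submodule.span (ZMod 2) {(fun _ => 1 : D → ZMod 2)}) :=
    FiniteDimensional.span_singleton _ _
  exact (Submodule.finrank_mono this).trans h2

/-- The proof counts dimensions. The balanced colourings are the kernel of `N` and contain the sum
of the face colourings and the vertex colourings. That sum has dimension at least F + V - 1 = E + 1
by Euler's formula, and the kernel has dimension at most E + 1. -/
theorem IsPlanar.jordan [Finite D] (hM : M.IsPlanar) : M.Jordan := by
  classical
  intro k hk
  rcases isEmpty_or_nonempty D with hD | hD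
  · exact ⟨k, k, fun d => hD.elim d, fun d => hD.elim d, fun d => hD.elim d⟩
  set N := addTranslate M.edgePerm ∘ₗ addTranslate M.vertexPerm with hN
  set A := invariants M.facePerm
  set B := invariants M.vertexPerm
  have hle : A ⊔ B ≤ LinearMap.ker N := by
    refine sup_le ?_ ?_
    · intro f hf
      rw [LinearMap.mem_ker]
      ext d
      have h1 := hf d
      have h2 := hf (M.edgePerm d)
      rw [facePerm_apply] at h1 h2
      rw [M.edgePerm_edgePerm] at h2
      simp only [hN, LinearMap.comp_apply, addTranslate_apply, h1, h2, Pi.zero_apply]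
      have := CharTwo.add_self_eq_zero (f d + f (M.edgePerm d))
      linear_combination this
    · intro f hf
      rw [LinearMap.mem_ker]
      ext d
      have h1 := hf d
      have h2 := hf (M.edgePerm d)
      simp only [hN, LinearMap.comp_apply, addTranslate_apply, h1, h2, Pi.zero_apply,
        CharTwo.add_self_eq_zero]
  have hinf : Module.finrank (ZMod 2) (A ⊓ B : Submodule (ZMod 2) (D → ZMod 2)) ≤ 1 := by
    apply finrank_le_one
    rintro f ⟨h1, h2⟩
    apply eq_of_connected hM.connected h2
    intro d
    have := h1 d
    rw [facePerm_apply, h2] at this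
    exact this
  -- For `f` in the kernel of the transpose, `addTranslate M.edgePerm f` is invariant under both
  -- permutations, hence constant. The functions it sends to zero are the functions on edges.
  have hker : Module.finrank (ZMod 2) (LinearMap.ker N) ≤ Nat.card M.Edge + 1 := by
    rw [hN, finrank_ker_comp, edgePerm_inv]
    set L := addTranslate M.vertexPerm⁻¹ ∘ₗ addTranslate M.edgePerm with hL
    have h1 := LinearMap.finrank_range_add_finrank_ker
      ((addTranslate M.edgePerm).domRestrict (LinearMap.ker L))
    have h2 : Module.finrank (ZMod 2)
        (LinearMap.range ((addTranslate M.edgePerm).domRestrict (LinearMap.ker L))) ≤ 1 := by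
      apply finrank_le_one
      rintro _ ⟨⟨f, hf⟩, rfl⟩
      rw [LinearMap.mem_ker, hL, LinearMap.comp_apply, ← LinearMap.mem_ker, ker_addTranslate] at hf
      rw [LinearMap.domRestrict_apply]
      apply eq_of_connected hM.connected
      · intro d
        have := hf (M.vertexPerm d)
        rw [show M.vertexPerm⁻¹ (M.vertexPerm d) = d from M.vertexPerm.symm_apply_apply d] at this
        exact this.symm
      · intro d
        rw [addTranslate_apply, addTranslate_apply, M.edgePerm_edgePerm, add_comm]
    have h3 : Module.finrank (ZMod 2)
        (LinearMap.ker ((addTranslate M.edgePerm).domRestrict (LinearMap.ker L))) ≤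
          Nat.card M.Edge := by
      rw [Edge, ← finrank_invariants, ← ker_addTranslate]
      refine LinearMap.finrank_le_finrank_of_injective
        (f := ((LinearMap.ker L).subtype.comp (Submodule.subtype _)).codRestrict _ ?_) ?_
      · rintro ⟨f, hf⟩
        exact hf
      · intro f g hfg
        apply Subtype.ext
        apply Subtype.ext
        exact (Subtype.ext_iff.1 hfg :)
    omega
  have hsum := Submodule.finrank_sup_add_finrank_inf_eq A B
  have hA : Module.finrank (ZMod 2) A = Nat.card M.Face := finrank_invariants _
  have hB : Module.finrank (ZMod 2) B = Nat.card M.Vertex := finrank_invariants _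
  have heuler := hM.euler
  have heq := Submodule.eq_of_le_of_finrank_le hle (by omega)
  have hkm : k ∈ LinearMap.ker N := by
    rw [LinearMap.mem_ker]
    ext d
    exact hk d
  rw [← heq, Submodule.mem_sup] at hkm
  obtain ⟨h, hh, g, hg, rfl⟩ := hkm
  exact ⟨h, g, hh, hg, fun d => rfl⟩

/-- An arc of corners between two corners of a cycle. -/
theorem exists_arc {π : Equiv.Perm D} [DecidableEq D] {x y : D} (h : π.SameCycle x y) :
    ∃ k : D → ZMod 2, (∀ d, k d + k (π d) = (if d = x then 1 else 0) + (if d = y then 1 else 0)) ∧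
      ∀ d, ¬ π.SameCycle x d → k d = 0 := by
  -- The end of an arc can be moved one step in either direction, so induction over integer powers
  -- reaches the whole cycle.
  have key : ∀ z, π.SameCycle x z → ((∃ k : D → ZMod 2, (∀ d, k d + k (π d) =
      (if d = x then 1 else 0) + (if d = z then 1 else 0)) ∧ ∀ d, ¬ π.SameCycle x d → k d = 0) ↔
      (∃ k : D → ZMod 2, (∀ d, k d + k (π d) =
        (if d = x then 1 else 0) + (if d = π z then 1 else 0)) ∧
        ∀ d, ¬ π.SameCycle x d → k d = 0)) := by
    intro z hz
    have hz' : π.SameCycle x (π z) := Equiv.Perm.sameCycle_apply_right.2 hz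
    have main : ∀ (a b : D) (k : D → ZMod 2), (a = z ∧ b = π z) ∨ (a = π z ∧ b = z) →
        (∀ d, k d + k (π d) = (if d = x then 1 else 0) + (if d = a then 1 else 0)) →
        (∀ d, ¬ π.SameCycle x d → k d = 0) →
        ∃ k : D → ZMod 2, (∀ d, k d + k (π d) =
          (if d = x then 1 else 0) + (if d = b then 1 else 0)) ∧
          ∀ d, ¬ π.SameCycle x d → k d = 0 := by
      intro a b k hab h1 h2
      -- The indicator of `π z` changes value across `z` and across `π z`, so adding it moves the
      -- end of the arc from one to the other.
      refine ⟨fun d => k d + if d = π z then 1 else 0, fun d => ?_, fun d hd => ?_⟩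
      · have := h1 d
        have e : (if π d = π z then (1 : ZMod 2) else 0) = if d = z then 1 else 0 := by
          simp only [π.injective.eq_iff]
        simp only [e]
        have c1 := CharTwo.add_self_eq_zero (if d = z then (1 : ZMod 2) else 0)
        have c2 := CharTwo.add_self_eq_zero (if d = π z then (1 : ZMod 2) else 0)
        rcases hab with ⟨rfl, rfl⟩ | ⟨rfl, rfl⟩
        · linear_combination this + c1
        · linear_combination this + c2
      · simp only [h2 d hd, zero_add]
        rw [if_neg]
        rintro rfl
        exact hd hz'
    constructor
    · rintro ⟨k, h1, h2⟩
      exact main _ _ k (Or.inl ⟨rfl, rfl⟩) h1 h2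
    · rintro ⟨k, h1, h2⟩
      exact main _ _ k (Or.inr ⟨rfl, rfl⟩) h1 h2
  obtain ⟨i, rfl⟩ := h
  induction i with
  | zero =>
    refine ⟨0, fun d => ?_, fun d _ => rfl⟩
    simp [CharTwo.add_self_eq_zero]
  | succ n ih =>
    rw [add_comm, zpow_add, zpow_one, Equiv.Perm.mul_apply]
    exact (key _ ⟨n, rfl⟩).1 ih
  | pred n ih =>
    apply (key _ ⟨_, rfl⟩).2
    rwa [← Equiv.Perm.mul_apply, ← zpow_one_add, add_sub_cancel]

end CombMap

/-! ### Connectivity of D3-reducible graphs -/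

/-- The graph stays connected when the vertices of `S` are removed. -/
def SimpleGraph.ConnectedOff {V : Type u} (G : SimpleGraph V) (S : Set V) : Prop :=
  ∀ c : V → Prop, (∀ u ∉ S, ∀ v ∉ S, G.Adj u v → (c u ↔ c v)) → ∀ u ∉ S, ∀ v ∉ S, (c u ↔ c v)

/-- The graph stays connected when any two vertices are removed. -/
def SimpleGraph.ThreeConnected {V : Type u} (G : SimpleGraph V) : Prop :=
  ∀ a b, G.ConnectedOff {a, b}

section Degree

variable {V : Type u} {G : SimpleGraph V}

theorem exists_third_neighbor {v a b : V} (h : (G.neighborSet v).ncard = 3) :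
    ∃ x, G.Adj v x ∧ x ≠ a ∧ x ≠ b := by
  by_contra! hcon
  have hsub : G.neighborSet v ⊆ {a, b} := by
    intro x hx
    by_cases hxa : x = a
    · exact Or.inl hxa
    · exact Or.inr (hcon x hx hxa)
  have := Set.ncard_le_ncard hsub (Set.toFinite _)
  have := Set.ncard_insert_le a {b}
  rw [Set.ncard_singleton] at this
  omega

/-- Removing the new vertex, listed twice, from the reduced graph leaves `G` without the triangle.
-/
theorem connectedOff_d3a {p q r : V}
    (h : (d3aReduce G p q r).ThreeConnected) : G.ConnectedOff {p, q, r} := by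
  intro c hc u hu v hv
  simp only [Set.mem_insert_iff, Set.mem_singleton_iff, not_or] at hu hv
  have := h none none (fun x => match x with | none => True | some x => c x) (by
    rintro (_ | x) hx (_ | y) hy hxy
    · simp at hx
    · simp at hx
    · simp at hy
    · have h1 := x.2
      have h2 := y.2
      exact hc x (by simpa using h1) y (by simpa using h2) hxy)
    (some ⟨u, hu⟩) (by simp) (some ⟨v, hv⟩) (by simp)
  exact this

/-- Removing `p` also destroys the added edge, so without `p` and `s` the reduced graph is `G`
without `p`, `q`, `s`. -/
theorem connectedOff_d3b {p q r : V} (hpr : p ≠ r) (h : (d3bReduce G p q r hpr).ThreeConnected)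
    {s : V} (hpq : p ≠ q) (hsq : s ≠ q) : G.ConnectedOff {p, q, s} := by
  intro c hc u hu v hv
  simp only [Set.mem_insert_iff, Set.mem_singleton_iff, not_or] at hu hv
  have := h ⟨p, hpq⟩ ⟨s, hsq⟩ (fun x => c x) (by
    rintro ⟨x, hxq⟩ hx ⟨y, hyq⟩ hy hxy
    simp only [Set.mem_insert_iff, Subtype.mk.injEq, Set.mem_singleton_iff, not_or] at hx hy
    apply hc x (by simp; tauto) y (by simp; tauto)
    rcases hxy with hxy | hxy | hxy
    · exact hxy
    · exact absurd hxy.1 hx.1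
    · exact absurd hxy.2 hy.1)
    ⟨u, hu.2.1⟩ (by simp; tauto) ⟨v, hv.2.1⟩ (by simp; tauto)
  exact this

theorem IsD3aConfig.rotate {p q r : V} (h : IsD3aConfig G p q r) : IsD3aConfig G q r p where
  deg_p := h.deg_q
  deg_q := h.deg_r
  deg_r := h.deg_p
  adj_pq := h.adj_qr
  adj_qr := h.adj_pr.symm
  adj_pr := h.adj_pq.symm
  distinct_pq := h.distinct_qr
  distinct_qr x hx := fun hx' => h.distinct_pr x hx hx'.symm
  distinct_pr x hx := fun hx' => h.distinct_pq x hx hx'.symm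

theorem IsD3aConfig.swap {p q r : V} (h : IsD3aConfig G p q r) : IsD3aConfig G p r q where
  deg_p := h.deg_p
  deg_q := h.deg_r
  deg_r := h.deg_q
  adj_pq := h.adj_pr
  adj_qr := h.adj_qr.symm
  adj_pr := h.adj_pq
  distinct_pq := h.distinct_pr
  distinct_qr x hx := fun hx' => h.distinct_qr x hx hx'.symm
  distinct_pr := h.distinct_pq

/-- Removing one triangle vertex `p` and an arbitrary vertex `b`. -/
theorem connectedOff_d3a_aux {p q r b : V} (hconf : IsD3aConfig G p q r)
    (h : ∀ b, G.ConnectedOff ({p, q, r} ∪ {b})) : G.ConnectedOff {p, b} := by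
  intro c hc
  -- The outside neighbours of `q` and `r` are distinct, so `b` can block at most one of the two
  -- ways out of the triangle.
  obtain ⟨q', hq'1, hq'2, hq'3⟩ := exists_third_neighbor (a := p) (b := r) hconf.deg_q
  obtain ⟨r', hr'1, hr'2, hr'3⟩ := exists_third_neighbor (a := p) (b := q) hconf.deg_r
  have hqr' : q' ≠ r' := by
    rintro rfl
    exact hconf.distinct_qr q' hq'2 ⟨hq'1, hr'1⟩
  have nqq' := hq'1.ne
  have nrr' := hr'1.ne
  have npq := hconf.adj_pq.ne
  have npr := hconf.adj_pr.ne
  have nqr := hconf.adj_qr.ne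
  simp only [Set.mem_insert_iff, Set.mem_singleton_iff, not_or] at hc ⊢
  have h1 := h b c (fun x hx y hy hxy => by
    simp only [Set.union_singleton, Set.mem_insert_iff, Set.mem_singleton_iff, not_or] at hx hy
    exact hc x ⟨hx.2.1, hx.1⟩ y ⟨hy.2.1, hy.1⟩ hxy)
  simp only [Set.union_singleton, Set.mem_insert_iff, Set.mem_singleton_iff, not_or] at h1
  have hcqr : q ≠ b → r ≠ b → (c q ↔ c r) := fun h2 h3 =>
    hc q ⟨npq.symm, h2⟩ r ⟨npr.symm, h3⟩ hconf.adj_qr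
  have hcq : q ≠ b → q' ≠ b → (c q ↔ c q') := fun h2 h3 => hc q ⟨npq.symm, h2⟩ q' ⟨hq'2, h3⟩ hq'1
  have hcr : r ≠ b → r' ≠ b → (c r ↔ c r') := fun h2 h3 => hc r ⟨npr.symm, h2⟩ r' ⟨hr'2, h3⟩ hr'1
  have hq'r' : q' ≠ b → r' ≠ b → (c q' ↔ c r') := fun h2 h3 =>
    h1 q' ⟨h2, hq'2, nqq'.symm, hq'3⟩ r' ⟨h3, hr'2, hr'3, nrr'.symm⟩
  have hout : ∀ x, x ≠ b → x ≠ p → x ≠ q → x ≠ r → (q ≠ b → (c x ↔ c q)) ∧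
      (r ≠ b → (c x ↔ c r)) := by
    intro x hxb hxp hxq hxr
    have e1 : q' ≠ b → (c x ↔ c q') := fun h2 => h1 x ⟨hxb, hxp, hxq, hxr⟩ q'
        ⟨h2, hq'2, nqq'.symm, hq'3⟩
    have e2 : r' ≠ b → (c x ↔ c r') := fun h2 => h1 x ⟨hxb, hxp, hxq, hxr⟩ r'
        ⟨h2, hr'2, hr'3, nrr'.symm⟩
    by_cases hb1 : q' = b
    · have hb2 : r' ≠ b := fun h => hqr' (hb1.trans h.symm)
      have hb3 : q ≠ b := fun h => nqq' (h.trans hb1.symm)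
      have hb4 : r ≠ b := fun h => hq'3 (hb1.trans h.symm)
      have h5 := (e2 hb2).trans (hcr hb4 hb2).symm
      exact ⟨fun _ => h5.trans (hcqr hb3 hb4).symm, fun _ => h5⟩
    · have := e1 hb1
      refine ⟨fun h2 => this.trans (hcq h2 hb1).symm, fun h3 => ?_⟩
      by_cases hb2 : r' = b
      · have hb3 : q ≠ b := fun h => hr'3 (hb2.trans h.symm)
        exact (this.trans (hcq hb3 hb1).symm).trans (hcqr hb3 h3)
      · exact (e2 hb2).trans (hcr h3 hb2).symm
  intro u hu v hv
  have key : ∀ x, x ≠ p → x ≠ b → x = q ∨ x = r ∨ (x ≠ q ∧ x ≠ r) := by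
    intro x _ _
    by_cases h3 : x = q
    · exact Or.inl h3
    by_cases h4 : x = r
    · exact Or.inr (Or.inl h4)
    exact Or.inr (Or.inr ⟨h3, h4⟩)
  rcases key u hu.1 hu.2 with rfl | rfl | ⟨hu1, hu2⟩ <;>
    rcases key v hv.1 hv.2 with rfl | rfl | ⟨hv1, hv2⟩
  · rfl
  · exact hcqr hu.2 hv.2
  · exact ((hout v hv.2 hv.1 hv1 hv2).1 hu.2).symm
  · exact (hcqr hv.2 hu.2).symm
  · rfl
  · exact ((hout v hv.2 hv.1 hv1 hv2).2 hu.2).symm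
  · exact (hout u hu.2 hu.1 hu1 hu2).1 hv.2
  · exact (hout u hu.2 hu.1 hu1 hu2).2 hv.2
  · exact h1 u ⟨hu.2, hu.1, hu1, hu2⟩ v ⟨hv.2, hv.1, hv1, hv2⟩

/-- If neither removed vertex belongs to the triangle, the triangle has one colour and acts as the
new vertex. Otherwise `connectedOff_d3a_aux` applies after a rotation of the triangle. -/
theorem threeConnected_of_d3a {p q r : V} (hconf : IsD3aConfig G p q r)
    (h : (d3aReduce G p q r).ThreeConnected) : G.ThreeConnected := by
  have h0 : ∀ b, G.ConnectedOff ({p, q, r} ∪ {b}) := by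
    intro b
    by_cases hb : b = p ∨ b = q ∨ b = r
    · have : ({p, q, r} ∪ {b} : Set V) = {p, q, r} := by
        ext x; simp; rintro rfl; exact hb
      rw [this]
      exact connectedOff_d3a h
    · push Not at hb
      intro c hc u hu v hv
      simp only [Set.union_singleton, Set.mem_insert_iff, Set.mem_singleton_iff, not_or] at hu hv
      exact h none (some ⟨b, hb⟩) (fun x => match x with | none => True | some x => c x) (by
        rintro (_ | x) hx (_ | y) hy hxy
        · simp at hx
        · simp at hx
        · simp at hy
        · have := x.2
          have := y.2
          refine hc x ?_ y ?_ hxy <;> simp <;> simp [Subtype.ext_iff] at hx hy <;> tauto)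
        (some ⟨u, hu.2⟩) (by simp [Subtype.ext_iff]; tauto)
        (some ⟨v, hv.2⟩) (by simp [Subtype.ext_iff]; tauto)
  have hp : ∀ b, G.ConnectedOff {p, b} := fun b => connectedOff_d3a_aux hconf h0
  have hq : ∀ b, G.ConnectedOff {q, b} := fun b => connectedOff_d3a_aux hconf.rotate (fun b => by
    have : ({q, r, p} : Set V) = {p, q, r} := by ext x; simp; tauto
    rw [this]; exact h0 b)
  have hr : ∀ b, G.ConnectedOff {r, b} := fun b =>
    connectedOff_d3a_aux hconf.rotate.rotate (fun b => by
      have : ({r, p, q} : Set V) = {p, q, r} := by ext x; simp; tauto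
      rw [this]; exact h0 b)
  intro a b
  by_cases ha : a = p ∨ a = q ∨ a = r
  · rcases ha with rfl | rfl | rfl
    exacts [hp b, hq b, hr b]
  by_cases hb : b = p ∨ b = q ∨ b = r
  · rw [Set.pair_comm]
    rcases hb with rfl | rfl | rfl
    exacts [hp a, hq a, hr a]
  push Not at ha hb
  intro c hc
  simp only [Set.mem_insert_iff, Set.mem_singleton_iff, not_or] at hc ⊢
  have hpn : p ≠ a ∧ p ≠ b := ⟨ha.1.symm, hb.1.symm⟩
  have hqn : q ≠ a ∧ q ≠ b := ⟨ha.2.1.symm, hb.2.1.symm⟩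
  have hrn : r ≠ a ∧ r ≠ b := ⟨ha.2.2.symm, hb.2.2.symm⟩
  have e1 : c q ↔ c p := hc q hqn p hpn hconf.adj_pq.symm
  have e2 : c r ↔ c p := hc r hrn p hpn hconf.adj_pr.symm
  have h1 := h (some ⟨a, ha⟩) (some ⟨b, hb⟩)
    (fun x => match x with | none => c p | some x => c x) (by
      rintro (_ | ⟨x, hx0⟩) hx (_ | ⟨y, hy0⟩) hy hxy
      · rfl
      · simp only [Set.mem_insert_iff, Option.some.injEq, Subtype.mk.injEq,
          Set.mem_singleton_iff, not_or] at hy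
        rcases hxy with hxy | hxy | hxy
        · exact hc p hpn y hy hxy
        · exact e1.symm.trans (hc q hqn y hy hxy)
        · exact e2.symm.trans (hc r hrn y hy hxy)
      · simp only [Set.mem_insert_iff, Option.some.injEq, Subtype.mk.injEq,
          Set.mem_singleton_iff, not_or] at hx
        rcases hxy with hxy | hxy | hxy
        · exact (hc p hpn x hx hxy).symm
        · exact (e1.symm.trans (hc q hqn x hx hxy)).symm
        · exact (e2.symm.trans (hc r hrn x hx hxy)).symm
      · simp only [Set.mem_insert_iff, Option.some.injEq, Subtype.mk.injEq,
          Set.mem_singleton_iff, not_or] at hx hy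
        exact hc x hx y hy hxy)
  have h2 : ∀ x, x ≠ a ∧ x ≠ b → (c x ↔ c p) := by
    intro x hx
    by_cases hx0 : x = p ∨ x = q ∨ x = r
    · rcases hx0 with rfl | rfl | rfl
      exacts [Iff.rfl, e1, e2]
    · push Not at hx0
      exact h1 (some ⟨x, hx0⟩) (by simp; tauto) none (by simp)
  intro u hu v hv
  exact (h2 u hu).trans (h2 v hv).symm

theorem IsD3bConfig.swap {p q r s : V} (h : IsD3bConfig G p q r s) : IsD3bConfig G r q p s where
  deg_p := h.deg_r
  deg_q := h.deg_q
  deg_r := h.deg_p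
  adj_pq := h.adj_qr.symm
  adj_qr := h.adj_pq.symm
  ne_pr := h.ne_pr.symm
  not_adj_pr := fun h' => h.not_adj_pr h'.symm
  adj_sp := h.adj_sr
  adj_sq := h.adj_sq
  adj_sr := h.adj_sp

theorem d3bReduce_comm {p q r : V} (hpr : p ≠ r) :
    d3bReduce G p q r hpr = d3bReduce G r q p hpr.symm := by
  ext u v
  simp only [d3bReduce]
  tauto

/-- A colouring must be shown to respect the added edge `pr`. If `q` stays, the path `pqr` does
this; if `q` is removed and `s` stays, the path `psr` does, unless `p` or `r` is removed and nothing
is to be shown. -/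
theorem threeConnected_of_d3b {p q r s : V} (hconf : IsD3bConfig G p q r s)
    (h : (d3bReduce G p q r hconf.ne_pr).ThreeConnected) : G.ThreeConnected := by
  have npq := hconf.adj_pq.ne
  have nqr := hconf.adj_qr.ne
  have npr := hconf.ne_pr
  have nsp := hconf.adj_sp.ne
  have nsq := hconf.adj_sq.ne
  have nsr := hconf.adj_sr.ne
  have hadj : ∀ {c : V → Prop} {a b : V}, (∀ u ∉ ({a, b} : Set V), ∀ v ∉ ({a, b} : Set V),
      G.Adj u v → (c u ↔ c v)) → ∀ {x y}, G.Adj x y → x ≠ a → x ≠ b → y ≠ a → y ≠ b →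
      (c x ↔ c y) := by
    intro c a b hc x y hxy h1 h2 h3 h4
    exact hc x (by simp [h1, h2]) y (by simp [h3, h4]) hxy
  have hq : ∀ b, G.ConnectedOff {q, b} := by
    intro b c hc
    have hc' := @hadj c q b hc
    by_cases hpr' : (p = b ∨ r = b ∨ s ≠ b)
    · have hb : ∃ b' : {v : V // v ≠ q}, ∀ x : {v : V // v ≠ q}, x = b' ↔ (x : V) = b ∨
          (b = q ∧ (x : V) = p) := by
        by_cases hbq : b = q
        · exact ⟨⟨p, npq⟩, fun x => by
            rw [Subtype.ext_iff]; subst hbq; simp [x.2]⟩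
        · exact ⟨⟨b, hbq⟩, fun x => by rw [Subtype.ext_iff]; simp [hbq]⟩
      by_cases hbq : b = q
      · subst hbq
        have hps : c p ↔ c s := hc' hconf.adj_sp.symm npq npq nsq nsq
        have hrs : c r ↔ c s := hc' hconf.adj_sr.symm nqr.symm nqr.symm nsq nsq
        have h1 := h ⟨p, npq⟩ ⟨p, npq⟩ (fun x => c x) (by
          rintro ⟨x, hxq⟩ hx ⟨y, hyq⟩ hy hxy
          simp only [Set.mem_insert_iff, Subtype.mk.injEq, Set.mem_singleton_iff, or_self]
            at hx hy
          rcases hxy with hxy | hxy | hxy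
          · exact hc' hxy hxq hxq hyq hyq
          · exact absurd hxy.1 hx
          · exact absurd hxy.2 hy)
        have h2 : ∀ x, x ≠ b → (c x ↔ c s) := by
          intro x hx
          by_cases hxp : x = p
          · rw [hxp]; exact hps
          · exact h1 ⟨x, hx⟩ (by simp [hxp]) ⟨s, nsq⟩ (by simp [nsp])
        intro u hu v hv
        simp only [Set.mem_insert_iff, Set.mem_singleton_iff, or_self] at hu hv
        exact (h2 u hu).trans (h2 v hv).symm
      · have h1 := h ⟨b, hbq⟩ ⟨b, hbq⟩ (fun x => c x) (by
          rintro ⟨x, hxq⟩ hx ⟨y, hyq⟩ hy hxy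
          simp only [Set.mem_insert_iff, Subtype.mk.injEq, Set.mem_singleton_iff, or_self]
            at hx hy
          have hpr2 : p ≠ b → r ≠ b → (c p ↔ c r) := fun h3 h4 => by
            have h5 : s ≠ b := by tauto
            exact (hc' hconf.adj_sp.symm npq h3 nsq h5).trans
              (hc' hconf.adj_sr nsq h5 nqr.symm h4)
          rcases hxy with hxy | ⟨hx1, hy1⟩ | ⟨hx1, hy1⟩
          · exact hc' hxy hxq hx hyq hy
          · simp only at hx1 hy1
            subst hx1; subst hy1; exact hpr2 hx hy
          · simp only at hx1 hy1
            subst hx1; subst hy1; exact (hpr2 hy hx).symm)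
        intro u hu v hv
        simp only [Set.mem_insert_iff, Set.mem_singleton_iff, not_or] at hu hv
        exact h1 ⟨u, hu.1⟩ (by simp [hu.2]) ⟨v, hv.1⟩ (by simp [hv.2])
    -- With `q` and `s` both removed no path replaces `pr`. So `p` is removed too and then attached
    -- again through its third neighbour.
    · have hsb : s = b := by tauto
      subst hsb
      have hoff := connectedOff_d3b npr h npq nsq
      have h1 := hoff c (by
        intro x hx y hy hxy
        simp only [Set.mem_insert_iff, Set.mem_singleton_iff, not_or] at hx hy
        exact hc' hxy hx.2.1 hx.2.2 hy.2.1 hy.2.2)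
      obtain ⟨p', hp1, hp2, hp3⟩ := exists_third_neighbor (a := q) (b := s) hconf.deg_p
      have hpp := hp1.ne
      have h2 : ∀ x, x ≠ q → x ≠ s → (c x ↔ c p') := by
        intro x hxq hxs
        by_cases hxp : x = p
        · rw [hxp]; exact hc' hp1 npq nsp.symm hp2 hp3
        · exact h1 x (by simp; tauto) p' (by simp; tauto)
      intro u hu v hv
      simp only [Set.mem_insert_iff, Set.mem_singleton_iff, not_or] at hu hv
      exact (h2 u hu.1 hu.2).trans (h2 v hv.1 hv.2).symm
  intro a b
  by_cases ha : a = q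
  · rw [ha]; exact hq b
  by_cases hb : b = q
  · rw [hb, Set.pair_comm]; exact hq a
  intro c hc
  have hc' := @hadj c a b hc
  have h1 := h ⟨a, ha⟩ ⟨b, hb⟩ (fun x => c x) (by
    rintro ⟨x, hxq⟩ hx ⟨y, hyq⟩ hy hxy
    simp only [Set.mem_insert_iff, Subtype.mk.injEq, Set.mem_singleton_iff, not_or] at hx hy
    have hpr2 : p ≠ a → p ≠ b → r ≠ a → r ≠ b → (c p ↔ c r) := fun h1 h2 h3 h4 =>
      (hc' hconf.adj_pq h1 h2 (Ne.symm ha) (Ne.symm hb)).trans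
        (hc' hconf.adj_qr (Ne.symm ha) (Ne.symm hb) h3 h4)
    rcases hxy with hxy | ⟨hx1, hy1⟩ | ⟨hx1, hy1⟩
    · exact hc' hxy hx.1 hx.2 hy.1 hy.2
    · simp only at hx1 hy1
      subst hx1; subst hy1; exact hpr2 hx.1 hx.2 hy.1 hy.2
    · simp only at hx1 hy1
      subst hx1; subst hy1; exact (hpr2 hy.1 hy.2 hx.1 hx.2).symm)
  have hqx : ∃ x, x ≠ q ∧ x ≠ a ∧ x ≠ b ∧ G.Adj q x := by
    obtain ⟨x, hx1, hx2, hx3⟩ := exists_third_neighbor (a := a) (b := b) hconf.deg_q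
    exact ⟨x, hx1.ne.symm, hx2, hx3, hx1⟩
  obtain ⟨x, hxq, hxa, hxb, hqx⟩ := hqx
  have h2 : ∀ y, y ≠ a → y ≠ b → (c y ↔ c x) := by
    intro y hya hyb
    by_cases hyq : y = q
    · rw [hyq]; exact hc' hqx (Ne.symm ha) (Ne.symm hb) hxa hxb
    · exact h1 ⟨y, hyq⟩ (by simp; tauto) ⟨x, hxq⟩ (by simp; tauto)
  intro u hu v hv
  simp only [Set.mem_insert_iff, Set.mem_singleton_iff, not_or] at hu hv
  exact (h2 u hu.1 hu.2).trans (h2 v hv.1 hv.2).symm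

end Degree

theorem D3Reducible.threeConnected {V : Type u} {G : SimpleGraph V} (h : D3Reducible G) :
    G.ThreeConnected := by
  induction h with
  | base G hG =>
    obtain ⟨e⟩ := hG
    intro a b c hc u hu v hv
    by_cases huv : u = v
    · rw [huv]
    · apply hc u hu v hv
      rw [← e.map_adj_iff]
      simpa using huv
  | d3a G p q r hconf _ ih => exact threeConnected_of_d3a hconf ih
  | d3b G p q r s hconf _ ih => exact threeConnected_of_d3b hconf ih

theorem D3Reducible.finite {V : Type u} {G : SimpleGraph V} (h : D3Reducible G) : Finite V := by
  induction h with
  | base G hG =>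
    obtain ⟨e⟩ := hG
    exact Finite.of_equiv _ e.symm.toEquiv
  | @d3a V G p q r _ _ ih =>
    have h1 : Finite {v : V // v ≠ p ∧ v ≠ q ∧ v ≠ r} :=
      Finite.of_injective (fun x => (some x : Option _)) (Option.some_injective _)
    have h2 : ({v : V | v ≠ p ∧ v ≠ q ∧ v ≠ r}).Finite := h1
    have h3 : (Set.univ : Set V) ⊆ {v : V | v ≠ p ∧ v ≠ q ∧ v ≠ r} ∪ {p, q, r} := by
      intro x _
      simp only [Set.mem_union, Set.mem_insert_iff, Set.mem_singleton_iff]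
      by_cases h : x ≠ p ∧ x ≠ q ∧ x ≠ r
      · exact Or.inl h
      · right; tauto
    exact Set.finite_univ_iff.1 ((h2.union (Set.toFinite _)).subset h3)
  | @d3b V G p q r s _ _ ih =>
    have h2 : ({v : V | v ≠ q}).Finite := ih
    have h3 : (Set.univ : Set V) ⊆ {v : V | v ≠ q} ∪ {q} := by
      intro x _
      by_cases h : x = q
      · exact Or.inr h
      · exact Or.inl h
    exact Set.finite_univ_iff.1 ((h2.union (Set.toFinite _)).subset h3)

/-! ### Embedded graphs -/

/-- The map `M`, whose darts `d` leave from the vertices `o d`, is an embedding of `G`. -/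
structure Emb {V D : Type u} (G : SimpleGraph V) (M : CombMap D) (o : D → V) : Prop where
  same : ∀ d e, M.vertexPerm.SameCycle d e ↔ o d = o e
  adj : ∀ d, G.Adj (o d) (o (M.edgePerm d))
  ex : ∀ u v, G.Adj u v → ∃ d, o d = u ∧ o (M.edgePerm d) = v
  uniq : ∀ d e, o d = o e → o (M.edgePerm d) = o (M.edgePerm e) → d = e

/-- The passage to an abstract type of darts is needed because a reduction keeps a subtype of the
old darts, not the darts of the new graph. -/
theorem CombMap.IsEmbeddingOf.emb {V : Type u} {G : SimpleGraph V} {M : CombMap G.Dart}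
    (h : M.IsEmbeddingOf) : Emb G M (fun d => d.fst) where
  same := h.sameCycle_iff
  adj d := by rw [h.edgePerm_eq]; exact d.adj
  ex u v huv := ⟨⟨(u, v), huv⟩, rfl, by rw [h.edgePerm_eq]; rfl⟩
  uniq d e h1 h2 := by
    simp only [h.edgePerm_eq] at h2
    exact SimpleGraph.Dart.ext _ _ (Prod.ext h1 h2)

section Perm

variable {α β : Type*}

theorem sameCycle_apply_self (f : Equiv.Perm α) (d : α) : f.SameCycle d (f d) :=
  Equiv.Perm.sameCycle_apply_right.2 (Equiv.Perm.SameCycle.refl f d)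

theorem sameCycle_of_three {f : Equiv.Perm α} {d e : α} (h3 : f (f (f d)) = d)
    (h : f.SameCycle d e) : e = d ∨ e = f d ∨ e = f (f d) := by
  have := CombMap.invariants_sameCycle (π := f) (f := fun e => e = d ∨ e = f d ∨ e = f (f d))
    (fun x => by
      apply propext
      constructor
      · rintro (hx | hx | hx)
        · right; right; apply f.injective; rw [hx, h3]
        · left; exact f.injective hx
        · right; left; exact f.injective hx
      · rintro (rfl | rfl | rfl)
        exacts [Or.inr (Or.inl rfl), Or.inr (Or.inr rfl), Or.inl h3]) h
  exact this ▸ Or.inl rfl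

/-- The map `ρ` need not commute with the permutations. In the reductions it sends each deleted dart
to a surviving one of the same vertex or face. -/
theorem sameCycle_transfer {f : Equiv.Perm α} {g : Equiv.Perm β} (ρ : α → β)
    (h : ∀ a, g.SameCycle (ρ a) (ρ (f a))) {a b : α} (hab : f.SameCycle a b) :
    g.SameCycle (ρ a) (ρ b) := by
  have := CombMap.invariants_sameCycle (π := f) (f := fun x => g.SameCycle (ρ a) (ρ x))
    (fun x => propext ⟨fun hx => hx.trans (h x).symm, fun hx => hx.trans (h x)⟩) hab
  exact this ▸ Equiv.Perm.SameCycle.refl g _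

end Perm

namespace Emb

variable {V D : Type u} {G : SimpleGraph V} {M : CombMap D} {o : D → V}

theorem o_vertexPerm (E : Emb G M o) (d : D) : o (M.vertexPerm d) = o d :=
  ((E.same _ _).1 (sameCycle_apply_self _ d)).symm

theorem ne (E : Emb G M o) (d : D) : o d ≠ o (M.edgePerm d) := (E.adj d).ne

theorem ncard_fiber (E : Emb G M o) (d : D) :
    {e | o e = o d}.ncard = (G.neighborSet (o d)).ncard := by
  have : G.neighborSet (o d) = (fun e => o (M.edgePerm e)) '' {e | o e = o d} := by
    ext v
    constructor
    · intro hv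
      obtain ⟨e, h1, h2⟩ := E.ex _ _ hv
      exact ⟨e, h1, h2⟩
    · rintro ⟨e, h1, h2⟩
      simp only [Set.mem_ofPred_eq] at h1
      rw [SimpleGraph.mem_neighborSet, ← h1, ← h2]
      exact E.adj e
  rw [this, Set.InjOn.ncard_image]
  intro x hx y hy hxy
  exact E.uniq x y (hx.trans hy.symm) hxy

theorem three (E : Emb G M o) {d : D} (h : (G.neighborSet (o d)).ncard = 3) :
    M.vertexPerm (M.vertexPerm (M.vertexPerm d)) = d ∧ M.vertexPerm d ≠ d ∧
      M.vertexPerm (M.vertexPerm d) ≠ d := by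
  rw [← E.ncard_fiber] at h
  have hfin : {e | o e = o d}.Finite := Set.finite_of_ncard_ne_zero (by omega)
  -- An invariant set containing `d` contains all darts at its origin, so a shorter cycle would
  -- leave fewer than three neighbours.
  have key : ∀ s : Set D, d ∈ s → (∀ x, M.vertexPerm x ∈ s ↔ x ∈ s) → {e | o e = o d} ⊆ s := by
    intro s hd hs e he
    have := CombMap.invariants_sameCycle (π := M.vertexPerm) (f := fun x => x ∈ s)
      (fun x => propext (hs x)) ((E.same d e).2 he.symm)
    exact this ▸ hd
  have h1 : M.vertexPerm d ≠ d := by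
    intro h1
    have h2 := Set.ncard_le_ncard (key {d} rfl fun x =>
      ⟨fun hx => M.vertexPerm.injective (hx.trans h1.symm), fun hx => by rw [hx, h1]; rfl⟩)
    rw [h, Set.ncard_singleton] at h2
    omega
  have h2 : M.vertexPerm (M.vertexPerm d) ≠ d := by
    intro h1
    have h2 := Set.ncard_le_ncard (key {d, M.vertexPerm d} (Or.inl rfl) fun x => by
      constructor
      · rintro (hx | hx)
        · right; apply M.vertexPerm.injective; rw [hx, h1]
        · left; exact M.vertexPerm.injective hx
      · rintro (rfl | rfl)
        exacts [Or.inr rfl, Or.inl h1])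
    have h3 := Set.ncard_insert_le d {M.vertexPerm d}
    rw [Set.ncard_singleton] at h3
    omega
  refine ⟨?_, h1, h2⟩
  by_contra h3
  have hinj := M.vertexPerm.injective
  have hsub : {d, M.vertexPerm d, M.vertexPerm (M.vertexPerm d),
      M.vertexPerm (M.vertexPerm (M.vertexPerm d))} ⊆ {e | o e = o d} := by
    rintro x (rfl | rfl | rfl | rfl) <;> simp [E.o_vertexPerm]
  have h4 := Set.ncard_le_ncard hsub hfin
  rw [Set.ncard_insert_of_notMem, Set.ncard_insert_of_notMem, Set.ncard_pair] at h4
  · omega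
  · exact fun hx => h1 (hinj (hinj hx.symm))
  · rintro (hx | hx)
    · exact h1 (hinj hx.symm)
    · exact h2 (hinj hx.symm)
  · rintro (hx | hx | hx)
    exacts [h1 hx.symm, h2 hx.symm, h3 hx.symm]

end Emb

/-! ### Separation by closed curves in three-connected embedded graphs -/

namespace CombMap

variable {V D : Type u} {G : SimpleGraph V} {M : CombMap D} {o : D → V}

/-- Closed curves through vertices and faces separate. -/
theorem Jordan.exists_colouring (J : M.Jordan) {k l Y Z : D → ZMod 2}
    (hk : ∀ d, k d + k (M.vertexPerm d) = Y d) (hl : ∀ d, l d + l (M.facePerm d) = Z d)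
    (hYZ : ∀ d, Y d + Y (M.edgePerm d) + (Z d + Z (M.edgePerm d)) = 0) :
    ∃ m : D → ZMod 2, (∀ d, m d + m (M.vertexPerm d) = Y d) ∧
      (∀ d, m d + m (M.edgePerm d) = Y d + Z (M.edgePerm d)) := by
  have hφ : ∀ d, M.facePerm (M.edgePerm d) = M.vertexPerm d := by
    intro d; rw [facePerm_apply, M.edgePerm_edgePerm]
  -- Splitting k + l = h + g gives m = k + g = l + h, which jumps like `k` around vertices and like
  -- `l` around faces.
  obtain ⟨h, g, hh, hg, hkl⟩ := J (fun d => k d + l d) (by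
    intro d
    have e1 := hk d
    have e2 := hk (M.edgePerm d)
    have e3 := hl d
    have e4 := hl (M.edgePerm d)
    rw [hφ] at e4
    rw [facePerm_apply] at e3
    linear_combination e1 + e2 + e3 + e4 + hYZ d)
  have h2 : (2 : ZMod 2) = 0 := rfl
  refine ⟨fun d => k d + g d, fun d => ?_, fun d => ?_⟩
  · linear_combination hk d + hg d + g d * h2
  · have e4 := hl (M.edgePerm d)
    have e5 := hh (M.edgePerm d)
    have e7 := hkl (M.edgePerm d)
    have e8 := hkl (M.vertexPerm d)
    have e9 := hg d
    rw [hφ] at e4 e5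
    linear_combination hk d + e4 - e8 - e5 - e9 + e7 + (g (M.edgePerm d) - l (M.edgePerm d)) * h2

end CombMap

namespace Emb

variable {V D : Type u} {G : SimpleGraph V} {M : CombMap D} {o : D → V}

/-- A curve meeting the graph only in `S` leaves all the rest of the graph on one side, because that
rest is connected. -/
theorem colour_const (E : Emb G M o) {S : Set V} (hS : G.ConnectedOff S) {m Y W : D → ZMod 2}
    (h1 : ∀ d, m d + m (M.vertexPerm d) = Y d) (h2 : ∀ d, m d + m (M.edgePerm d) = W d)
    (hY : ∀ d, o d ∉ S → Y d = 0)
    (hW : ∀ d, o d ∉ S → o (M.edgePerm d) ∉ S → W d = 0) :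
    ∃ α, ∀ d, o d ∉ S → m d = α := by
  classical
  have hσ : ∀ d e, o d ∉ S → o d = o e → m d = m e := by
    intro d e hd hde
    have := CombMap.invariants_sameCycle (π := M.vertexPerm)
      (f := fun x => if o x = o d then m x else 0) (fun x => by
        simp only [E.o_vertexPerm]
        split_ifs with hx
        · have := h1 x
          rw [hY x (hx ▸ hd), CharTwo.add_eq_zero] at this
          exact this.symm
        · rfl) ((E.same d e).2 hde)
    simpa [hde] using this
  by_cases hex : ∃ d, o d ∉ S
  · obtain ⟨d₀, hd₀⟩ := hex
    refine ⟨m d₀, fun d hd => ?_⟩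
    have := hS (fun v => ∃ e, o e = v ∧ m e = m d₀) (by
      intro u hu v hv huv
      obtain ⟨e, rfl, rfl⟩ := E.ex u v huv
      have he := h2 e
      rw [hW e hu hv, CharTwo.add_eq_zero] at he
      constructor
      · rintro ⟨f, hf1, hf2⟩
        exact ⟨_, rfl, by rw [← he, ← hf2]; exact hσ _ _ hu hf1.symm⟩
      · rintro ⟨f, hf1, hf2⟩
        exact ⟨_, rfl, by rw [he, ← hf2]; exact hσ _ _ hv hf1.symm⟩) _ hd₀ _ hd
    obtain ⟨e, he1, he2⟩ := this.1 ⟨d₀, rfl, rfl⟩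
    rw [← he2]
    exact hσ _ _ hd he1.symm
  · exact ⟨0, fun d hd => (hex ⟨d, hd⟩).elim⟩

/-- Two common corners of a vertex and a face would give a closed curve meeting the graph in this
vertex only, with edges on both sides; the vertex would separate the graph. -/
theorem eq_of_sameCycle (E : Emb G M o) (J : M.Jordan) (hG : G.ThreeConnected) {d e : D}
    (h1 : o d = o e) (h2 : M.facePerm.SameCycle d e) : d = e := by
  classical
  obtain ⟨k, hk, -⟩ := CombMap.exists_arc ((E.same d e).2 h1)
  obtain ⟨l, hl, -⟩ := CombMap.exists_arc h2
  obtain ⟨m, hm1, hm2⟩ := J.exists_colouring hk hl (fun x => CharTwo.add_self_eq_zero _)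
  have hZ : ∀ x, o x ≠ o d → ((if x = d then 1 else 0) + (if x = e then 1 else 0) : ZMod 2)
      = 0 := by
    intro x hx
    rw [if_neg, if_neg, add_zero]
    · rintro rfl; exact hx h1.symm
    · rintro rfl; exact hx rfl
  have mem : ∀ x, x ∉ ({o d, o d} : Set V) ↔ x ≠ o d := by simp
  obtain ⟨α, hα⟩ := E.colour_const (hG (o d) (o d)) hm1 hm2
    (fun x hx => hZ x ((mem _).1 hx))
    (fun x hx hx' => by rw [hZ x ((mem _).1 hx), hZ _ ((mem _).1 hx'), add_zero])
  by_contra hde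
  have h2 : (2 : ZMod 2) = 0 := rfl
  -- Every edge at the vertex leads to colour `α`, which forces the colour of all corners at the
  -- vertex and contradicts the jump at `d`.
  have hall : ∀ x, o x = o d → m (M.vertexPerm x) = α := by
    intro x hx
    have hne : o (M.edgePerm x) ≠ o d := hx ▸ (E.ne x).symm
    have e1 := hm1 x
    have e3 := hm2 x
    rw [hα _ ((mem _).2 hne), hZ _ hne] at e3
    linear_combination e1 - e3
  have e1 := hall d rfl
  have e2 := hall (M.vertexPerm.symm d) (by rw [← E.o_vertexPerm, Equiv.apply_symm_apply])
  have e3 := hm1 d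
  rw [Equiv.apply_symm_apply] at e2
  rw [e1, e2, if_pos rfl, if_neg hde, CharTwo.add_self_eq_zero] at e3
  simp at e3

/-- A vertex sharing two faces with the origin of a dart between them is the end of this dart. -/
theorem target_eq (E : Emb G M o) (J : M.Jordan) (hG : G.ThreeConnected) {τ c₁ c₂ : D}
    (p1 : M.vertexPerm τ ≠ τ) (p2 : M.vertexPerm (M.vertexPerm τ) ≠ τ) (hc : o c₁ = o c₂)
        (hne : o c₁ ≠ o τ)
    (h1 : M.facePerm.SameCycle τ c₁) (h2 : M.facePerm.SameCycle (M.vertexPerm τ) c₂) :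
    o (M.edgePerm τ) = o c₁ := by
  classical
  obtain ⟨k, hk, -⟩ := CombMap.exists_arc (sameCycle_apply_self M.vertexPerm τ)
  obtain ⟨k', hk', -⟩ := CombMap.exists_arc ((E.same _ _).2 hc)
  obtain ⟨l, hl, -⟩ := CombMap.exists_arc h1
  obtain ⟨l', hl', -⟩ := CombMap.exists_arc h2
  -- `Z` marks the four corners where a closed curve through the vertices `o τ`, `o c₁` and the two
  -- faces passes between a vertex and a face.
  obtain ⟨Z, hZdef⟩ : ∃ Z : D → ZMod 2, ∀ x, Z x = (if x = τ then 1 else 0) +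
      (if x = M.vertexPerm τ then 1 else 0) + (if x = c₁ then 1 else 0) +
      (if x = c₂ then 1 else 0) := ⟨_, fun _ => rfl⟩
  obtain ⟨m, hm1, hm2⟩ := J.exists_colouring (k := fun d => k d + k' d)
    (l := fun d => l d + l' d) (Y := Z) (Z := Z)
    (fun d => by rw [hZdef]; linear_combination hk d + hk' d)
    (fun d => by rw [hZdef]; linear_combination hl d + hl' d)
    (fun x => CharTwo.add_self_eq_zero _)
  have hZ : ∀ x, o x ≠ o τ → o x ≠ o c₁ → Z x = 0 := by
    intro x hx hx'
    rw [hZdef, if_neg, if_neg, if_neg, if_neg]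
    · simp
    · rintro rfl; exact hx' hc.symm
    · rintro rfl; exact hx' rfl
    · rintro rfl; exact hx (E.o_vertexPerm _)
    · rintro rfl; exact hx rfl
  have hZ' : ∀ x, o x = o τ → Z x = (if x = τ then 1 else 0) +
      (if x = M.vertexPerm τ then 1 else 0) := by
    intro x hx
    rw [hZdef, if_neg (c := x = c₁), if_neg (c := x = c₂)]
    · simp
    · rintro rfl; exact hne (hc.trans hx)
    · rintro rfl; exact hne hx
  have mem : ∀ x, x ∉ ({o τ, o c₁} : Set V) ↔ x ≠ o τ ∧ x ≠ o c₁ := by simp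
  obtain ⟨α, hα⟩ := E.colour_const (hG (o τ) (o c₁)) hm1 hm2
    (fun x hx => hZ x ((mem _).1 hx).1 ((mem _).1 hx).2)
    (fun x hx hx' => by
      rw [hZ x ((mem _).1 hx).1 ((mem _).1 hx).2, hZ _ ((mem _).1 hx').1 ((mem _).1 hx').2,
        add_zero])
  have ho1 := E.o_vertexPerm τ
  have ho2 := E.o_vertexPerm (M.vertexPerm τ)
  have hout : ∀ x, o x = o τ → o (M.edgePerm x) ≠ o c₁ → m x = α + Z x := by
    intro x hx hx'
    have hx2 : o (M.edgePerm x) ≠ o τ := hx ▸ (E.ne x).symm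
    have e := hm2 x
    rw [hα _ ((mem _).2 ⟨hx2, hx'⟩), hZ _ hx2 hx', add_zero] at e
    rw [← e, add_comm (m x), ← add_assoc, CharTwo.add_self_eq_zero, zero_add]
  have q1 : M.vertexPerm (M.vertexPerm τ) ≠ M.vertexPerm τ := fun h => p1 (M.vertexPerm.injective h)
  have z0 : Z τ = 1 := by rw [hZ' _ rfl, if_pos rfl, if_neg p1.symm, add_zero]
  have z1 : Z (M.vertexPerm τ) = 1 := by rw [hZ' _ ho1, if_pos rfl, if_neg p1, zero_add]
  have z2 : Z (M.vertexPerm (M.vertexPerm τ)) = 0 := by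
    rw [hZ' _ (ho2.trans ho1), if_neg p2, if_neg q1, add_zero]
  by_contra hcon
  have e0 := hout τ rfl hcon
  have f0 := hm1 τ
  have f1 := hm1 (M.vertexPerm τ)
  rw [z0] at e0 f0
  rw [z1] at f1
  have h2 : (2 : ZMod 2) = 0 := rfl
  -- If `τ` ended elsewhere, the colours would make the next two darts both end at `o c₁`, although
  -- there are no double edges.
  have g1 : M.vertexPerm τ = M.vertexPerm (M.vertexPerm τ) := by
    apply E.uniq _ _ ho2.symm
    trans o c₁
    · by_contra h
      have := hout _ ho1 h
      rw [z1] at this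
      have : (1 : ZMod 2) = 0 := by linear_combination e0 + this - f0 + (α + 1) * h2
      exact absurd this one_ne_zero
    · symm
      by_contra h
      have := hout _ (ho2.trans ho1) h
      rw [z2] at this
      have : (1 : ZMod 2) = 0 := by
        linear_combination f0 - f1 - e0 + this
      exact absurd this one_ne_zero
  exact q1 g1.symm

/-- The triangle is a closed curve, and the connected rest of the graph lies on one side of it. The
other side contains only corners of the triangle itself and is therefore a face. The two
alternatives are the two sides. -/
theorem triangle_face (E : Emb G M o) (J : M.Jordan) {ab bc ca : D} (h1 : o (M.edgePerm ab) = o bc)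
    (h2 : o (M.edgePerm bc) = o ca) (h3 : o (M.edgePerm ca) = o ab)
    (hG : G.ConnectedOff {o ab, o bc, o ca}) :
    (M.facePerm ab = bc ∧ M.facePerm bc = ca ∧ M.facePerm ca = ab) ∨
      (M.facePerm (M.edgePerm ab) = M.edgePerm ca ∧ M.facePerm (M.edgePerm ca) = M.edgePerm bc ∧
        M.facePerm (M.edgePerm bc) = M.edgePerm ab) := by
  classical
  have nab : o ab ≠ o bc := h1 ▸ E.ne ab
  have nbc : o bc ≠ o ca := h2 ▸ E.ne bc
  have nca : o ca ≠ o ab := h3 ▸ E.ne ca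
  obtain ⟨k₁, hk₁, -⟩ := CombMap.exists_arc ((E.same _ _).2 h1)
  obtain ⟨k₂, hk₂, -⟩ := CombMap.exists_arc ((E.same _ _).2 h2)
  obtain ⟨k₃, hk₃, -⟩ := CombMap.exists_arc ((E.same _ _).2 h3)
  obtain ⟨Z, hZdef⟩ : ∃ Z : D → ZMod 2, ∀ x, Z x =
      ((if x = M.edgePerm ab then 1 else 0) + (if x = bc then 1 else 0)) +
      ((if x = M.edgePerm bc then 1 else 0) + (if x = ca then 1 else 0)) +
      ((if x = M.edgePerm ca then 1 else 0) + (if x = ab then 1 else 0)) := ⟨_, fun _ => rfl⟩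
  have hε : ∀ x y, M.edgePerm x = M.edgePerm y ↔ x = y := fun x y => M.edgePerm.injective.eq_iff
  have hε' : ∀ x y, M.edgePerm x = y ↔ x = M.edgePerm y := fun x y => by
    rw [← hε, M.edgePerm_edgePerm]
  -- The curve runs along edges and has no arc inside a face; hence `l` and its boundary are zero.
  obtain ⟨m, hm1, hm2⟩ := J.exists_colouring (k := fun d => k₁ d + k₂ d + k₃ d)
    (l := fun d => 0) (Y := Z) (Z := fun _ => 0)
    (fun d => by rw [hZdef]; linear_combination hk₁ d + hk₂ d + hk₃ d)
    (fun d => by simp)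
    (fun x => by
      have : Z x = Z (M.edgePerm x) := by
        rw [hZdef, hZdef]
        simp only [hε', M.edgePerm_edgePerm]
        ring
      rw [this, CharTwo.add_self_eq_zero, add_zero, zero_add])
  have mem : ∀ x, x ∉ ({o ab, o bc, o ca} : Set V) ↔ x ≠ o ab ∧ x ≠ o bc ∧ x ≠ o ca := by simp
  have hZ : ∀ x, x ≠ M.edgePerm ab → x ≠ bc → x ≠ M.edgePerm bc → x ≠ ca → x ≠ M.edgePerm ca →
      x ≠ ab → Z x = 0 := by
    intro x h1 h2 h3 h4 h5 h6
    rw [hZdef, if_neg h1, if_neg h2, if_neg h3, if_neg h4, if_neg h5, if_neg h6]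
    simp
  have hZ' : ∀ x, o x ∉ ({o ab, o bc, o ca} : Set V) → Z x = 0 := by
    intro x hx
    rw [mem] at hx
    apply hZ <;> rintro rfl
    exacts [hx.2.1 h1, hx.2.1 rfl, hx.2.2 h2, hx.2.2 rfl, hx.1 h3, hx.1 rfl]
  simp only [add_zero] at hm2
  obtain ⟨α, hα⟩ := E.colour_const hG hm1 hm2 hZ' (fun x hx _ => hZ' x hx)
  have hφ : ∀ x, m (M.facePerm x) = m x := by
    intro x
    have e1 := hm1 (M.edgePerm x)
    have e2 := hm2 (M.edgePerm x)
    rw [M.edgePerm_edgePerm] at e2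
    rw [CombMap.facePerm_apply]
    linear_combination e1 - e2
  -- A dart of the other colour has both ends on the triangle, so it is one of the six darts of the
  -- triangle.
  have six : ∀ x, m x ≠ α → x = M.edgePerm ab ∨ x = bc ∨ x = M.edgePerm bc ∨ x = ca ∨
      x = M.edgePerm ca ∨ x = ab := by
    intro x hx
    by_contra! hcon
    have hz := hZ x hcon.1 hcon.2.1 hcon.2.2.1 hcon.2.2.2.1 hcon.2.2.2.2.1 hcon.2.2.2.2.2
    have e := hm2 x
    rw [hz, CharTwo.add_eq_zero] at e
    have key : ∀ y, m y ≠ α → o y = o ab ∨ o y = o bc ∨ o y = o ca := by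
      intro y hy
      by_contra! h
      exact hy (hα y ((mem _).2 h))
    obtain ⟨c1, c2, c3, c4, c5, c6⟩ := hcon
    have hne := E.ne x
    rcases key x hx with h | h | h <;> rcases key (M.edgePerm x) (e ▸ hx) with h' | h' | h' <;>
      first
      | exact hne (h.trans h'.symm)
      | exact c6 (E.uniq _ _ h (h'.trans h1.symm))
      | exact c2 (E.uniq _ _ h (h'.trans h2.symm))
      | exact c4 (E.uniq _ _ h (h'.trans h3.symm))
      | exact c1 (E.uniq _ _ (h.trans h1.symm) (by rw [h', M.edgePerm_edgePerm]))
      | exact c3 (E.uniq _ _ (h.trans h2.symm) (by rw [h', M.edgePerm_edgePerm]))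
      | exact c5 (E.uniq _ _ (h.trans h3.symm) (by rw [h', M.edgePerm_edgePerm]))
  -- Face tracing preserves the colour, and at the next vertex only two darts are candidates.
  -- Turning back to `M.edgePerm x` would mean that this dart is alone at its vertex.
  have step : ∀ x y, m x ≠ α → o (M.edgePerm x) = o y → y ≠ M.edgePerm x →
      (∀ w, m w ≠ α → o w = o y → w = y ∨ w = M.edgePerm x) → M.facePerm x = y := by
    intro x y hx hxy hne hw
    rcases hw (M.facePerm x) (by rwa [hφ]) (by rw [CombMap.facePerm_apply, E.o_vertexPerm, hxy])
      with h | h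
    · exact h
    · rcases sameCycle_of_three (f := M.vertexPerm) (d := M.edgePerm x) (e := y)
        (by rw [CombMap.facePerm_apply] at h; rw [h, h, h]) ((E.same _ _).2 hxy) with h' | h' | h'
      · exact (hne h').elim
      · rw [h']; rfl
      · rw [CombMap.facePerm_apply] at h
        rw [h, h] at h'
        exact (hne h').elim
  have hA : ∀ w, m w ≠ α → o w = o ab → w = ab ∨ w = M.edgePerm ca := by
    intro w hw hw'
    rcases six w hw with rfl | rfl | rfl | rfl | rfl | rfl
    exacts [(nab (hw'.symm.trans h1)).elim, (nab hw'.symm).elim, (nca (h2.symm.trans hw')).elim,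
      (nca hw').elim, Or.inr rfl, Or.inl rfl]
  have hB : ∀ w, m w ≠ α → o w = o bc → w = bc ∨ w = M.edgePerm ab := by
    intro w hw hw'
    rcases six w hw with rfl | rfl | rfl | rfl | rfl | rfl
    exacts [Or.inr rfl, Or.inl rfl, (nbc (hw'.symm.trans h2)).elim, (nbc hw'.symm).elim,
      (nab (h3.symm.trans hw')).elim, (nab hw').elim]
  have hC : ∀ w, m w ≠ α → o w = o ca → w = ca ∨ w = M.edgePerm bc := by
    intro w hw hw'
    rcases six w hw with rfl | rfl | rfl | rfl | rfl | rfl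
    exacts [(nbc (h1.symm.trans hw')).elim, (nbc hw').elim, Or.inr rfl, Or.inl rfl,
      (nca (hw'.symm.trans h3)).elim, (nca hw'.symm).elim]
  have nA : ab ≠ M.edgePerm ca := fun h => nbc (by
    rw [← h1, h, M.edgePerm_edgePerm])
  have nB : bc ≠ M.edgePerm ab := fun h => nca (by
    rw [← h2, h, M.edgePerm_edgePerm])
  have nC : ca ≠ M.edgePerm bc := fun h => nab (by
    rw [← h3, h, M.edgePerm_edgePerm])
  have hsum : m ab + m (M.edgePerm ab) = 1 := by
    have e1 : ab ≠ M.edgePerm ab := (M.edgePerm_ne ab).symm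
    have e2 : ab ≠ bc := fun h => nab (congrArg o h)
    have e3 : ab ≠ M.edgePerm bc := fun h => nca (by rw [h, h2])
    have e4 : ab ≠ ca := fun h => nca (congrArg o h).symm
    rw [hm2, hZdef, if_neg e1, if_neg e2, if_neg e3, if_neg e4, if_neg nA, if_pos rfl]
    simp
  by_cases h : m ab = α
  · right
    have h' : m (M.edgePerm ab) ≠ α := by
      intro h'
      rw [h, h', CharTwo.add_self_eq_zero] at hsum
      simp at hsum
    have s1 : M.facePerm (M.edgePerm ab) = M.edgePerm ca := by
      apply step _ _ h'
      · rw [M.edgePerm_edgePerm, h3]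
      · rw [M.edgePerm_edgePerm]; exact nA.symm
      · rw [M.edgePerm_edgePerm, h3]; exact fun w hw hw' => (hA w hw hw').symm
    have s2 : M.facePerm (M.edgePerm ca) = M.edgePerm bc := by
      apply step _ _ (by rwa [← s1, hφ])
      · rw [M.edgePerm_edgePerm, h2]
      · rw [M.edgePerm_edgePerm]; exact nC.symm
      · rw [M.edgePerm_edgePerm, h2]; exact fun w hw hw' => (hC w hw hw').symm
    have s3 : M.facePerm (M.edgePerm bc) = M.edgePerm ab := by
      apply step _ _ (by rwa [← s2, hφ, ← s1, hφ])
      · rw [M.edgePerm_edgePerm, h1]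
      · rw [M.edgePerm_edgePerm]; exact nB.symm
      · rw [M.edgePerm_edgePerm, h1]; exact fun w hw hw' => (hB w hw hw').symm
    exact ⟨s1, s2, s3⟩
  · left
    have s1 := step ab bc h h1 nB hB
    have s2 := step bc ca (by rwa [← s1, hφ]) h2 nC hC
    have s3 := step ca ab (by rwa [← s2, hφ, ← s1, hφ]) h3 nA hA
    exact ⟨s1, s2, s3⟩

end Emb

/-! ### Shrinking a triangular face to a vertex -/

namespace CombMap

variable {D : Type u}

/-- The darts `a`, `b`, `c` bound a triangular face, whose vertices have degree three. -/
structure TriFace (M : CombMap D) (a b c : D) : Prop where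
  ab : M.vertexPerm (M.edgePerm a) = b
  bc : M.vertexPerm (M.edgePerm b) = c
  ca : M.vertexPerm (M.edgePerm c) = a
  a3 : M.vertexPerm (M.vertexPerm a) = M.edgePerm c
  b3 : M.vertexPerm (M.vertexPerm b) = M.edgePerm a
  c3 : M.vertexPerm (M.vertexPerm c) = M.edgePerm b
  nodup : [a, b, c, M.edgePerm a, M.edgePerm b, M.edgePerm c, M.vertexPerm a, M.vertexPerm b,
    M.vertexPerm c].Nodup
  leg_a : M.edgePerm (M.vertexPerm a) ∉ [M.vertexPerm a, M.vertexPerm b, M.vertexPerm c]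
  leg_b : M.edgePerm (M.vertexPerm b) ∉ [M.vertexPerm a, M.vertexPerm b, M.vertexPerm c]
  leg_c : M.edgePerm (M.vertexPerm c) ∉ [M.vertexPerm a, M.vertexPerm b, M.vertexPerm c]

/-- The darts that survive when the triangle with edges `a`, `b`, `c` shrinks to a vertex. -/
def OffTriangle (M : CombMap D) (a b c x : D) : Prop :=
  x ∉ [a, b, c, M.edgePerm a, M.edgePerm b, M.edgePerm c]

/-- The rotation after shrinking the triangle. -/
noncomputable def shrinkNext (M : CombMap D) (a b c x : D) : D :=
  open Classical in
  if x = M.vertexPerm a then M.vertexPerm c else if x = M.vertexPerm b then M.vertexPerm a else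
    if x = M.vertexPerm c then M.vertexPerm b else M.vertexPerm x

variable {M : CombMap D} {a b c : D}

theorem TriFace.rotate (h : M.TriFace a b c) : M.TriFace b c a where
  ab := h.bc
  bc := h.ca
  ca := h.ab
  a3 := h.b3
  b3 := h.c3
  c3 := h.a3
  nodup := by have := h.nodup; simp at this ⊢; grind
  leg_a := by have := h.leg_b; simp at this ⊢; grind
  leg_b := by have := h.leg_c; simp at this ⊢; grind
  leg_c := by have := h.leg_a; simp at this ⊢; grind

theorem TriFace.offTriangle_shrinkNext (h : M.TriFace a b c) {x : D} (hx : M.OffTriangle a b c x) :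
    M.OffTriangle a b c (M.shrinkNext a b c x) := by
  obtain ⟨h1, h2, h3, h4, h5, h6, h7, -, -, -⟩ := h
  have hinj : ∀ x y, M.vertexPerm x = M.vertexPerm y → x = y :=
    fun x y => M.vertexPerm.injective.eq_iff.1
  unfold OffTriangle shrinkNext at *
  simp only [List.nodup_cons, List.mem_cons, List.not_mem_nil, or_false, not_or] at *
  grind

theorem TriFace.shrinkNext_inj (h : M.TriFace a b c) {x y : D} (hx : M.OffTriangle a b c x)
    (hy : M.OffTriangle a b c y) (hxy : M.shrinkNext a b c x = M.shrinkNext a b c y) : x = y := by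
  obtain ⟨h1, h2, h3, h4, h5, h6, h7, -, -, -⟩ := h
  have hinj : ∀ x y, M.vertexPerm x = M.vertexPerm y → x = y :=
    fun x y => M.vertexPerm.injective.eq_iff.1
  unfold OffTriangle shrinkNext at *
  simp only [List.nodup_cons, List.mem_cons, List.not_mem_nil, or_false, not_or] at *
  grind

theorem TriFace.offTriangle_edgePerm {x : D} (hx : M.OffTriangle a b c x) :
    M.OffTriangle a b c (M.edgePerm x) := by
  have := M.edgePerm_edgePerm
  unfold OffTriangle at *
  simp only [List.mem_cons, List.not_mem_nil, or_false, not_or] at *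
  grind

/-- Shrink a triangular face to a vertex. -/
noncomputable def shrink [Finite D] (h : M.TriFace a b c) :
    CombMap {x // M.OffTriangle a b c x} where
  vertexPerm := Equiv.ofBijective
    (fun x => ⟨M.shrinkNext a b c x, h.offTriangle_shrinkNext x.2⟩)
    (Finite.injective_iff_bijective.1 fun x y hxy =>
      Subtype.ext (h.shrinkNext_inj x.2 y.2 (congrArg Subtype.val hxy)))
  edgePerm := Function.Involutive.toPerm
    (fun x => ⟨M.edgePerm x, TriFace.offTriangle_edgePerm x.2⟩)
    (fun x => Subtype.ext (M.edgePerm_edgePerm x))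
  edgePerm_edgePerm x := Subtype.ext (M.edgePerm_edgePerm x)
  edgePerm_ne x hx := M.edgePerm_ne x (congrArg Subtype.val hx)

theorem shrink_vertexPerm [Finite D] (h : M.TriFace a b c) (x) :
    ((shrink h).vertexPerm x : D) = M.shrinkNext a b c x := rfl

theorem shrink_edgePerm [Finite D] (h : M.TriFace a b c) (x) :
    ((shrink h).edgePerm x : D) = M.edgePerm x := rfl

theorem shrink_facePerm [Finite D] (h : M.TriFace a b c) (x) :
    ((shrink h).facePerm x : D) = M.shrinkNext a b c (M.edgePerm x) := rfl

theorem shrinkNext_a : M.shrinkNext a b c (M.vertexPerm a) = M.vertexPerm c := by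
  simp [shrinkNext]

theorem TriFace.shrinkNext_b (h : M.TriFace a b c) :
    M.shrinkNext a b c (M.vertexPerm b) = M.vertexPerm a := by
  have := h.nodup
  simp [shrinkNext] at this ⊢
  grind

theorem TriFace.shrinkNext_c (h : M.TriFace a b c) :
    M.shrinkNext a b c (M.vertexPerm c) = M.vertexPerm b := by
  have := h.nodup
  have hinj : ∀ x y, M.vertexPerm x = M.vertexPerm y → x = y :=
    fun x y => M.vertexPerm.injective.eq_iff.1
  simp [shrinkNext] at this ⊢
  grind

theorem shrinkNext_of_ne {x : D} (h1 : x ≠ M.vertexPerm a) (h2 : x ≠ M.vertexPerm b)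
    (h3 : x ≠ M.vertexPerm c) : M.shrinkNext a b c x = M.vertexPerm x := by
  simp [shrinkNext, h1, h2, h3]

/-- A function that agrees on corners identified by the shrinking. -/
theorem TriFace.comp_shrinkNext (h : M.TriFace a b c) {β : Type*} {k : D → β}
    (ha : k (M.edgePerm a) = k (M.vertexPerm a)) (hb : k (M.edgePerm b) = k (M.vertexPerm b))
    (hc : k (M.edgePerm c) = k (M.vertexPerm c)) (x : D) :
    k (M.shrinkNext a b c x) = k (M.vertexPerm x) := by
  by_cases h1 : x = M.vertexPerm a
  · rw [h1, shrinkNext_a, h.a3, hc]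
  by_cases h2 : x = M.vertexPerm b
  · rw [h2, h.shrinkNext_b, h.b3, ha]
  by_cases h3 : x = M.vertexPerm c
  · rw [h3, h.shrinkNext_c, h.c3, hb]
  rw [shrinkNext_of_ne h1 h2 h3]

/-- The colouring is extended by zero inside the triangle. The corner at `M.edgePerm a` copies the
one at `M.vertexPerm a`, with which it merges, and likewise for `b`, `c`. The splitting of the
extension descends: the zeros force its vertex part to agree at the three triangle vertices. -/
theorem Jordan.shrink [Finite D] (J : M.Jordan) (h : M.TriFace a b c) : (shrink h).Jordan := by
  classical
  intro k hk
  let kx : D → ZMod 2 := fun x => if hx : M.OffTriangle a b c x then k ⟨x, hx⟩ else 0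
  let K : D → ZMod 2 := fun x => if x = M.edgePerm a then kx (M.vertexPerm a) else
    if x = M.edgePerm b then kx (M.vertexPerm b) else
    if x = M.edgePerm c then kx (M.vertexPerm c) else kx x
  have hnd := h.nodup
  simp only [List.nodup_cons, List.mem_cons, List.not_mem_nil, or_false, not_or] at hnd
  obtain ⟨⟨ab, ac, aa', ab', ac', aa'', ab'', ac''⟩, ⟨bc, ba', bb', bc', ba'', bb'', bc''⟩,
    ⟨ca', cb', cc', ca'', cb'', cc''⟩, ⟨a'b', a'c', a'a'', a'b'', a'c''⟩,
    ⟨b'c', b'a'', b'b'', b'c''⟩, ⟨c'a'', c'b'', c'c''⟩, ⟨a''b'', a''c''⟩, b''c'', -⟩ := hnd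
  have Koff : ∀ x, (hx : M.OffTriangle a b c x) → K x = k ⟨x, hx⟩ := by
    intro x hx
    have hx' := hx
    simp only [OffTriangle, List.mem_cons, List.not_mem_nil, or_false, not_or] at hx'
    simp [K, kx, hx, hx']
  have Ka : K a = 0 := by simp [K, kx, OffTriangle, aa', ab', ac']
  have Kb : K b = 0 := by simp [K, kx, OffTriangle, ba', bb', bc']
  have Kc : K c = 0 := by simp [K, kx, OffTriangle, ca', cb', cc']
  have Ka' : K (M.edgePerm a) = K (M.vertexPerm a) := by
    simp [K, Ne.symm a'a'', Ne.symm b'a'', Ne.symm c'a'']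
  have Kb' : K (M.edgePerm b) = K (M.vertexPerm b) := by
    simp [K, Ne.symm a'b'', Ne.symm b'b'', Ne.symm c'b'', Ne.symm a'b']
  have Kc' : K (M.edgePerm c) = K (M.vertexPerm c) := by
    simp [K, Ne.symm a'c'', Ne.symm b'c'', Ne.symm c'c'', Ne.symm a'c', Ne.symm b'c']
  have Knext := h.comp_shrinkNext Ka' Kb' Kc'
  have e2 := M.edgePerm_edgePerm
  obtain ⟨f, g, hf, hg, hfg⟩ := J K (by
    intro d
    by_cases hd : M.OffTriangle a b c d
    · have := hk ⟨d, hd⟩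
      rw [← Knext, ← Knext, Koff _ hd, Koff _ (TriFace.offTriangle_edgePerm hd),
        Koff _ (h.offTriangle_shrinkNext hd),
        Koff _ (h.offTriangle_shrinkNext (TriFace.offTriangle_edgePerm hd))]
      exact this
    · simp only [OffTriangle, List.mem_cons, List.not_mem_nil, or_false, not_not] at hd
      have h2 : ∀ x : ZMod 2, x + x = 0 := CharTwo.add_self_eq_zero
      rcases hd with rfl | rfl | rfl | rfl | rfl | rfl <;>
        simp only [e2, h.ab, h.bc, h.ca, Ka, Kb, Kc, Ka', Kb', Kc', zero_add, add_zero, h2])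
  have hφ : ∀ x, M.facePerm (M.edgePerm x) = M.vertexPerm x := fun x => by
    rw [facePerm_apply, e2]
  have gab : g b = g a := by
    have h1 := hfg a
    have h2 := hfg b
    have h3 := hf a
    rw [facePerm_apply, h.ab] at h3
    rw [Ka] at h1
    rw [Kb] at h2
    linear_combination h1 - h2 - h3
  have gbc : g c = g b := by
    have h1 := hfg b
    have h2 := hfg c
    have h3 := hf b
    rw [facePerm_apply, h.bc] at h3
    rw [Kb] at h1
    rw [Kc] at h2
    linear_combination h1 - h2 - h3
  have gs : ∀ x, g (M.shrinkNext a b c x) = g (M.vertexPerm x) := by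
    apply h.comp_shrinkNext
    · have := hg (M.edgePerm a)
      rw [h.ab] at this
      rw [hg, ← this, gab]
    · have := hg (M.edgePerm b)
      rw [h.bc] at this
      rw [hg, ← this, gbc]
    · have := hg (M.edgePerm c)
      rw [h.ca] at this
      rw [hg, ← this, gab.symm, gbc]
  have fs : ∀ x, f (M.shrinkNext a b c x) = f (M.vertexPerm x) := by
    apply h.comp_shrinkNext
    · rw [← hf, facePerm_apply, e2]
    · rw [← hf, facePerm_apply, e2]
    · rw [← hf, facePerm_apply, e2]
  refine ⟨fun x => f x, fun x => g x, fun x => ?_, fun x => ?_, fun x => ?_⟩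
  · exact (fs _).trans (hf x)
  · exact (gs _).trans (hg x)
  · rw [← hfg, Koff _ x.2]

theorem offTriangle_rotate {x : D} : M.OffTriangle a b c x ↔ M.OffTriangle b c a x := by
  simp only [OffTriangle, List.mem_cons, List.not_mem_nil, or_false, not_or]
  tauto

theorem TriFace.off_a (h : M.TriFace a b c) : M.OffTriangle a b c (M.vertexPerm a) := by
  have hnd := h.nodup
  simp only [OffTriangle, List.nodup_cons, List.mem_cons, List.not_mem_nil, or_false,
    not_or] at hnd ⊢
  grind

theorem TriFace.off_b (h : M.TriFace a b c) : M.OffTriangle a b c (M.vertexPerm b) :=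
  offTriangle_rotate.2 h.rotate.off_a

theorem TriFace.off_c (h : M.TriFace a b c) : M.OffTriangle a b c (M.vertexPerm c) :=
  offTriangle_rotate.2 h.rotate.off_b

theorem not_offTriangle_self : ¬ M.OffTriangle a b c a ∧ ¬ M.OffTriangle a b c b ∧
    ¬ M.OffTriangle a b c c ∧ ¬ M.OffTriangle a b c (M.edgePerm a) ∧
    ¬ M.OffTriangle a b c (M.edgePerm b) ∧ ¬ M.OffTriangle a b c (M.edgePerm c) := by
  simp [OffTriangle]

theorem not_offTriangle {x : D} : ¬ M.OffTriangle a b c x ↔ x = a ∨ x = b ∨ x = c ∨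
    x = M.edgePerm a ∨ x = M.edgePerm b ∨ x = M.edgePerm c := by
  simp only [OffTriangle, List.mem_cons, List.not_mem_nil, or_false, not_not]

theorem TriFace.sameCycle_ba [Finite D] (h : M.TriFace a b c) :
    (shrink h).vertexPerm.SameCycle ⟨_, h.off_b⟩ ⟨_, h.off_a⟩ := by
  have := sameCycle_apply_self (shrink h).vertexPerm ⟨_, h.off_b⟩
  rwa [show (shrink h).vertexPerm ⟨_, h.off_b⟩ =
      ⟨_, h.off_a⟩ from Subtype.ext h.shrinkNext_b] at this

theorem TriFace.sameCycle_ca [Finite D] (h : M.TriFace a b c) :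
    (shrink h).vertexPerm.SameCycle ⟨_, h.off_c⟩ ⟨_, h.off_a⟩ := by
  have := sameCycle_apply_self (shrink h).vertexPerm ⟨_, h.off_a⟩
  rw [show (shrink h).vertexPerm ⟨_, h.off_a⟩ = ⟨_, h.off_c⟩ from Subtype.ext shrinkNext_a] at this
  exact this.symm

/-- Deleted darts all start at the triangle, so they may be sent to any dart of the new vertex. -/
theorem TriFace.shrink_sameCycle [Finite D] (h : M.TriFace a b c)
    {x y : {x // M.OffTriangle a b c x}} (hxy : M.vertexPerm.SameCycle x y) :
    (shrink h).vertexPerm.SameCycle x y := by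
  classical
  let ρ : D → {x // M.OffTriangle a b c x} :=
    fun x => if hx : M.OffTriangle a b c x then ⟨x, hx⟩ else ⟨_, h.off_a⟩
  have hρ : ∀ x, (hx : M.OffTriangle a b c x) → ρ x = ⟨x, hx⟩ := fun x hx => dif_pos hx
  obtain ⟨n1, n2, n3, n4, n5, n6⟩ := not_offTriangle_self (M := M) (a := a) (b := b) (c := c)
  have hρ' : ∀ x, ¬ M.OffTriangle a b c x → ρ x = ⟨_, h.off_a⟩ := fun x hx => dif_neg hx
  have := sameCycle_transfer (f := M.vertexPerm) (g := (shrink h).vertexPerm) ρ (by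
    intro x
    by_cases hx : M.OffTriangle a b c x
    · by_cases h1 : x = M.vertexPerm a
      · rw [h1, h.a3, hρ _ h.off_a, hρ' _ n6]
      by_cases h2 : x = M.vertexPerm b
      · rw [h2, h.b3, hρ _ h.off_b, hρ' _ n4]
        exact h.sameCycle_ba
      by_cases h3 : x = M.vertexPerm c
      · rw [h3, h.c3, hρ _ h.off_c, hρ' _ n5]
        exact h.sameCycle_ca
      have h4 : ρ (M.vertexPerm x) = (shrink h).vertexPerm ⟨x, hx⟩ := by
        have h5 := shrinkNext_of_ne h1 h2 h3
        have h6 : M.OffTriangle a b c (M.vertexPerm x) := h5 ▸ h.offTriangle_shrinkNext hx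
        rw [hρ _ h6]
        exact Subtype.ext h5.symm
      rw [h4, hρ _ hx]
      exact sameCycle_apply_self _ _
    · rw [hρ' _ hx]
      rcases not_offTriangle.1 hx with rfl | rfl | rfl | rfl | rfl | rfl
      · rw [hρ _ h.off_a]
      · rw [hρ _ h.off_b]; exact h.sameCycle_ba.symm
      · rw [hρ _ h.off_c]; exact h.sameCycle_ca.symm
      · rw [h.ab, hρ' _ n2]
      · rw [h.bc, hρ' _ n3]
      · rw [h.ca, hρ' _ n1]) hxy
  rwa [hρ _ x.2, hρ _ y.2] at this

theorem TriFace.shrink_sameCycle_facePerm [Finite D] (h : M.TriFace a b c)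
    {x y : {x // M.OffTriangle a b c x}} (hxy : M.facePerm.SameCycle x y) :
    (shrink h).facePerm.SameCycle x y := by
  classical
  let ρ : D → {x // M.OffTriangle a b c x} :=
    -- Each outer dart of the triangle goes to the leg on its face. The darts `a`, `b`, `c` of the
    -- vanishing face form a cycle of their own, and the default value is arbitrary for them.
    fun x => if hx : M.OffTriangle a b c x then ⟨x, hx⟩ else
      if x = M.edgePerm b then ⟨_, h.off_b⟩ else if x = M.edgePerm c then ⟨_, h.off_c⟩ else
        ⟨_, h.off_a⟩
  have hnd := h.nodup
  simp only [List.nodup_cons, List.mem_cons, List.not_mem_nil, or_false, not_or] at hnd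
  have hρ : ∀ x, (hx : M.OffTriangle a b c x) → ρ x = ⟨x, hx⟩ := fun x hx => dif_pos hx
  obtain ⟨n1, n2, n3, n4, n5, n6⟩ := not_offTriangle_self (M := M) (a := a) (b := b) (c := c)
  have ra : ρ a = ⟨_, h.off_a⟩ := by
    simp only [ρ, dif_neg n1]; rw [if_neg, if_neg] <;> grind
  have rb : ρ b = ⟨_, h.off_a⟩ := by
    simp only [ρ, dif_neg n2]; rw [if_neg, if_neg] <;> grind
  have rc : ρ c = ⟨_, h.off_a⟩ := by
    simp only [ρ, dif_neg n3]; rw [if_neg, if_neg] <;> grind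
  have ra' : ρ (M.edgePerm a) = ⟨_, h.off_a⟩ := by
    simp only [ρ, dif_neg n4]; rw [if_neg, if_neg] <;> grind
  have rb' : ρ (M.edgePerm b) = ⟨_, h.off_b⟩ := by
    simp only [ρ, dif_neg n5, if_true]
  have rc' : ρ (M.edgePerm c) = ⟨_, h.off_c⟩ := by
    simp only [ρ, dif_neg n6, if_true]; rw [if_neg]; grind
  have := sameCycle_transfer (f := M.facePerm) (g := (shrink h).facePerm) ρ (by
    intro x
    rw [facePerm_apply]
    by_cases hx : M.OffTriangle a b c x
    · have h4 : ρ (M.vertexPerm (M.edgePerm x)) = (shrink h).facePerm ⟨x, hx⟩ := by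
        apply Subtype.ext
        rw [shrink_facePerm]
        by_cases h1 : M.edgePerm x = M.vertexPerm a
        · rw [h1, h.a3, rc', shrinkNext_a]
        by_cases h2 : M.edgePerm x = M.vertexPerm b
        · rw [h2, h.b3, ra', h.shrinkNext_b]
        by_cases h3 : M.edgePerm x = M.vertexPerm c
        · rw [h3, h.c3, rb', h.shrinkNext_c]
        have h5 := shrinkNext_of_ne h1 h2 h3
        rw [hρ _ (h5 ▸ h.offTriangle_shrinkNext (TriFace.offTriangle_edgePerm hx))]
        exact h5.symm
      rw [h4, hρ _ hx]
      exact sameCycle_apply_self _ _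
    · rcases not_offTriangle.1 hx with rfl | rfl | rfl | rfl | rfl | rfl
      · rw [h.ab, ra, rb]
      · rw [h.bc, rb, rc]
      · rw [h.ca, rc, ra]
      · rw [ra', M.edgePerm_edgePerm, hρ _ h.off_a]
      · rw [rb', M.edgePerm_edgePerm, hρ _ h.off_b]
      · rw [rc', M.edgePerm_edgePerm, hρ _ h.off_c]) hxy
  rwa [hρ _ x.2, hρ _ y.2] at this

theorem pow_three_of_sameCycle {f : Equiv.Perm D} {x y : D} (h : f.SameCycle x y)
    (hx : f (f (f x)) = x) : f (f (f y)) = y := by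
  have := invariants_sameCycle (π := f) (f := fun x => f (f (f x)) = x)
    (fun x => by simp only [f.injective.eq_iff]) h
  exact this ▸ hx

end CombMap

/-! ### The D3a configuration in an embedded graph -/

namespace Emb

variable {V D : Type u} {G : SimpleGraph V} {M : CombMap D} {o : D → V} {a b c : D}

theorem finite [Finite V] (E : Emb G M o) : Finite D :=
  Finite.of_injective (fun d => (o d, o (M.edgePerm d)))
    fun x y h => E.uniq x y (congrArg Prod.fst h) (congrArg Prod.snd h)

theorem triFace (E : Emb G M o) (h : IsD3aConfig G (o a) (o b) (o c)) (hab : M.facePerm a = b)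
    (hbc : M.facePerm b = c) (hca : M.facePerm c = a) : M.TriFace a b c := by
  rw [CombMap.facePerm_apply] at hab hbc hca
  have oa : o (M.edgePerm a) = o b := by rw [← hab, E.o_vertexPerm]
  have ob : o (M.edgePerm b) = o c := by rw [← hbc, E.o_vertexPerm]
  have oc : o (M.edgePerm c) = o a := by rw [← hca, E.o_vertexPerm]
  obtain ⟨a1, a2, a3⟩ := E.three (d := M.edgePerm c) (by rw [oc]; exact h.deg_p)
  obtain ⟨b1, b2, b3⟩ := E.three (d := M.edgePerm a) (by rw [oa]; exact h.deg_q)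
  obtain ⟨c1, c2, c3⟩ := E.three (d := M.edgePerm b) (by rw [ob]; exact h.deg_r)
  rw [hca] at a1 a2 a3
  rw [hab] at b1 b2 b3
  rw [hbc] at c1 c2 c3
  have nab := h.adj_pq.ne
  have nbc := h.adj_qr.ne
  have nac := h.adj_pr.ne
  have osa := E.o_vertexPerm a
  have osb := E.o_vertexPerm b
  have osc := E.o_vertexPerm c
  have sa : M.vertexPerm a ≠ a := fun h => a3 (h.trans (by rw [h, h] at a1; exact a1))
  have sb : M.vertexPerm b ≠ b := fun h => b3 (h.trans (by rw [h, h] at b1; exact b1))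
  have sc : M.vertexPerm c ≠ c := fun h => c3 (h.trans (by rw [h, h] at c1; exact c1))
  refine ⟨hab, hbc, hca, a1, b1, c1, ?_, ?_, ?_, ?_⟩
  · simp only [List.nodup_cons, List.mem_cons, List.not_mem_nil, or_false, not_or]
    refine ⟨⟨?_, ?_, ?_, ?_, ?_, ?_, ?_, ?_⟩, ⟨?_, ?_, ?_, ?_, ?_, ?_, ?_⟩,
        ⟨?_, ?_, ?_, ?_, ?_, ?_⟩,
      ⟨?_, ?_, ?_, ?_, ?_⟩, ⟨?_, ?_, ?_, ?_⟩, ⟨?_, ?_, ?_⟩, ⟨?_, ?_⟩, ?_, ?_, ?_⟩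
    all_goals grind
  · have := E.uniq a (M.vertexPerm a) osa.symm
    have := E.uniq (M.edgePerm c) (M.vertexPerm a) (oc.trans osa.symm)
    have := M.edgePerm_ne (M.vertexPerm a)
    have := M.edgePerm_edgePerm c
    simp only [List.mem_cons, List.not_mem_nil, or_false, not_or]
    grind
  · have := E.uniq b (M.vertexPerm b) osb.symm
    have := E.uniq (M.edgePerm a) (M.vertexPerm b) (oa.trans osb.symm)
    have := M.edgePerm_ne (M.vertexPerm b)
    have := M.edgePerm_edgePerm a
    simp only [List.mem_cons, List.not_mem_nil, or_false, not_or]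
    grind
  · have := E.uniq c (M.vertexPerm c) osc.symm
    have := E.uniq (M.edgePerm b) (M.vertexPerm c) (ob.trans osc.symm)
    have := M.edgePerm_ne (M.vertexPerm c)
    have := M.edgePerm_edgePerm b
    simp only [List.mem_cons, List.not_mem_nil, or_false, not_or]
    grind

/-- If the triangle bounds a face on its other side, it is traversed backwards, with two of its
vertices exchanged. -/
theorem exists_triFace (E : Emb G M o) (J : M.Jordan) {p q r : V} (h : IsD3aConfig G p q r)
    (hG : G.ConnectedOff {p, q, r}) : ∃ a b c, M.TriFace a b c ∧ IsD3aConfig G (o a) (o b) (o c) ∧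
      ∀ x, (x ≠ p ∧ x ≠ q ∧ x ≠ r) ↔ (x ≠ o a ∧ x ≠ o b ∧ x ≠ o c) := by
  obtain ⟨a, rfl, ha⟩ := E.ex _ _ h.adj_pq
  obtain ⟨b, rfl, hb⟩ := E.ex _ _ h.adj_qr
  obtain ⟨c, rfl, hc⟩ := E.ex _ _ h.adj_pr.symm
  rcases E.triangle_face J ha hb hc hG with ⟨h1, h2, h3⟩ | ⟨h1, h2, h3⟩
  · exact ⟨a, b, c, E.triFace h h1 h2 h3, h, fun x => Iff.rfl⟩
  · have h' : IsD3aConfig G (o (M.edgePerm a)) (o (M.edgePerm c)) (o (M.edgePerm b)) := by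
      rw [ha, hb, hc]
      exact h.swap.rotate.rotate
    exact ⟨_, _, _, E.triFace h' h1 h2 h3, h', fun x => by rw [ha, hb, hc]; tauto⟩

section Shrink

variable {p q r : V}

theorem o_edge (E : Emb G M o) (h : M.TriFace a b c) : o (M.edgePerm a) = o b := by
  rw [← h.ab, E.o_vertexPerm]

/-- The darts leaving the triangle. -/
theorem eq_leg (E : Emb G M o) (h : M.TriFace a b c) {x : D} (hx : M.OffTriangle a b c x)
    (hox : o x = o a) : x = M.vertexPerm a := by
  simp only [CombMap.OffTriangle, List.mem_cons, List.not_mem_nil, or_false, not_or] at hx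
  rcases sameCycle_of_three (f := M.vertexPerm) (d := a) (by rw [h.a3, h.ca])
    ((E.same _ _).2 hox.symm) with h1 | h1 | h1
  · exact (hx.1 h1).elim
  · exact h1
  · exact (hx.2.2.2.2.2 (h1.trans h.a3)).elim

theorem leg_target (E : Emb G M o) (h : M.TriFace a b c) :
    o (M.edgePerm (M.vertexPerm a)) ≠ o a ∧ o (M.edgePerm (M.vertexPerm a)) ≠ o b ∧
      o (M.edgePerm (M.vertexPerm a)) ≠ o c := by
  have hnd := h.nodup
  simp only [List.nodup_cons, List.mem_cons, List.not_mem_nil, or_false, not_or] at hnd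
  have hs := E.o_vertexPerm a
  refine ⟨fun h' => E.ne (M.vertexPerm a) (hs.trans h'.symm), fun h' => ?_, fun h' => ?_⟩
  · have := E.uniq _ _ hs (h'.trans (E.o_edge h).symm)
    exact hnd.1.2.2.2.2.2.1 this.symm
  · have := E.uniq (M.vertexPerm a) (M.edgePerm c) (hs.trans (E.o_edge h.rotate.rotate).symm)
      (h'.trans (by rw [M.edgePerm_edgePerm]))
    exact hnd.2.2.2.2.2.1.1 this.symm

/-- A triangular face along the leg at `a` would also contain the edge `a`, and the end of the leg
would be a common outside neighbour. So no chain occurs on the faces around the triangle. -/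
theorem not_triangle_of_leg (E : Emb G M o) (h : M.TriFace a b c)
    (hc : IsD3aConfig G (o a) (o b) (o c)) {d : D}
    (hd : M.facePerm.SameCycle (M.vertexPerm a) d) : M.facePerm (M.facePerm (M.facePerm d))
        ≠ d := by
  intro h3
  have h4 := CombMap.pow_three_of_sameCycle hd.symm h3
  obtain ⟨y, hy⟩ : ∃ y, M.facePerm (M.vertexPerm a) = y := ⟨_, rfl⟩
  have oy : o y = o (M.edgePerm (M.vertexPerm a)) := by
    rw [← hy, CombMap.facePerm_apply, E.o_vertexPerm]
  have h5 : M.facePerm y = M.edgePerm a := by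
    apply M.facePerm.injective
    rw [← hy, h4, CombMap.facePerm_apply, M.edgePerm_edgePerm]
  have h6 : o (M.edgePerm y) = o b := by
    rw [← E.o_edge h, ← h5, CombMap.facePerm_apply, E.o_vertexPerm]
  apply hc.distinct_pq (o y)
  · rw [oy]; exact (E.leg_target h).2.2
  · constructor
    · have := E.adj (M.vertexPerm a)
      rwa [E.o_vertexPerm, ← oy] at this
    · have := E.adj y
      rw [h6] at this
      exact this.symm

open Classical in
/-- The origins of the darts after shrinking a triangle. -/
noncomputable def shrinkOrigin (M : CombMap D) (o : D → V) (a b c : D) (p q r : V)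
    (x : {x // M.OffTriangle a b c x}) : Option {v : V // v ≠ p ∧ v ≠ q ∧ v ≠ r} :=
  if h : o x ≠ p ∧ o x ≠ q ∧ o x ≠ r then some ⟨o x, h⟩ else none

theorem shrinkOrigin_some {x : {x // M.OffTriangle a b c x}} {v} :
    shrinkOrigin M o a b c p q r x = some v ↔ o x = v := by
  unfold shrinkOrigin
  split_ifs with h
  · rw [Option.some_inj, Subtype.ext_iff]
  · simp only [false_iff]
    intro h'
    exact h (h' ▸ v.2)

theorem shrinkOrigin_none {x : {x // M.OffTriangle a b c x}} :
    shrinkOrigin M o a b c p q r x = none ↔ ¬ (o x ≠ p ∧ o x ≠ q ∧ o x ≠ r) := by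
  unfold shrinkOrigin
  split_ifs with h
  · simp [h]
  · simp [h]

theorem shrink [Finite D] (E : Emb G M o) (h : M.TriFace a b c)
    (hc : IsD3aConfig G (o a) (o b) (o c))
    (hpqr : ∀ x, (x ≠ p ∧ x ≠ q ∧ x ≠ r) ↔ (x ≠ o a ∧ x ≠ o b ∧ x ≠ o c)) :
    Emb (d3aReduce G p q r) (CombMap.shrink h) (shrinkOrigin M o a b c p q r) := by
  have hadj : ∀ v, (G.Adj p v ∨ G.Adj q v ∨ G.Adj r v) ↔
      ∃ u, ¬ (u ≠ o a ∧ u ≠ o b ∧ u ≠ o c) ∧ G.Adj u v := by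
    intro v
    constructor
    · rintro (h | h | h)
      · exact ⟨p, by rw [← hpqr]; simp, h⟩
      · exact ⟨q, by rw [← hpqr]; simp, h⟩
      · exact ⟨r, by rw [← hpqr]; simp, h⟩
    · rintro ⟨u, hu, huv⟩
      rw [← hpqr] at hu
      by_cases h1 : u = p
      · exact Or.inl (h1 ▸ huv)
      by_cases h2 : u = q
      · exact Or.inr (Or.inl (h2 ▸ huv))
      by_cases h3 : u = r
      · exact Or.inr (Or.inr (h3 ▸ huv))
      exact (hu ⟨h1, h2, h3⟩).elim
  have hleg : ∀ x, M.OffTriangle a b c x → ¬ (o x ≠ o a ∧ o x ≠ o b ∧ o x ≠ o c) →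
      x = M.vertexPerm a ∨ x = M.vertexPerm b ∨ x = M.vertexPerm c := by
    intro x hx hox
    by_cases h1 : o x = o a
    · exact Or.inl (E.eq_leg h hx h1)
    by_cases h2 : o x = o b
    · exact Or.inr (Or.inl (E.eq_leg h.rotate (CombMap.offTriangle_rotate.1 hx) h2))
    by_cases h3 : o x = o c
    · exact Or.inr (Or.inr (E.eq_leg h.rotate.rotate
        (CombMap.offTriangle_rotate.1 (CombMap.offTriangle_rotate.1 hx)) h3))
    exact (hox ⟨h1, h2, h3⟩).elim
  have hout : ∀ x, M.OffTriangle a b c x → ¬ (o x ≠ o a ∧ o x ≠ o b ∧ o x ≠ o c) →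
      (o (M.edgePerm x) ≠ o a ∧ o (M.edgePerm x) ≠ o b ∧ o (M.edgePerm x) ≠ o c) := by
    intro x hx hox
    rcases hleg x hx hox with rfl | rfl | rfl
    · exact E.leg_target h
    · have := E.leg_target h.rotate
      exact ⟨this.2.2, this.1, this.2.1⟩
    · have := E.leg_target h.rotate.rotate
      exact ⟨this.2.1, this.2.2, this.1⟩
  have hin : ∀ x, ¬ M.OffTriangle a b c x → ¬ (o x ≠ o a ∧ o x ≠ o b ∧ o x ≠ o c) := by
    intro x hx
    simp only [CombMap.OffTriangle, List.mem_cons, List.not_mem_nil, or_false, not_not] at hx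
    have e1 := E.o_edge h
    have e2 := E.o_edge h.rotate
    have e3 := E.o_edge h.rotate.rotate
    rcases hx with rfl | rfl | rfl | rfl | rfl | rfl <;> simp_all
  have hin' : ∀ x, ¬ M.OffTriangle a b c x →
      ¬ (o (M.edgePerm x) ≠ o a ∧ o (M.edgePerm x) ≠ o b ∧ o (M.edgePerm x) ≠ o c) := by
    intro x hx
    apply hin
    intro h'
    apply hx
    have := CombMap.TriFace.offTriangle_edgePerm h'
    rwa [M.edgePerm_edgePerm] at this
  -- The outside neighbours being distinct, the new vertex has no double edges.
  have hdist : ∀ x y, M.OffTriangle a b c x → ¬ (o x ≠ o a ∧ o x ≠ o b ∧ o x ≠ o c) →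
      M.OffTriangle a b c y → ¬ (o y ≠ o a ∧ o y ≠ o b ∧ o y ≠ o c) →
      o (M.edgePerm x) = o (M.edgePerm y) → x = y := by
    intro x y hx hox hy hoy hxy
    have ha := E.adj (M.vertexPerm a)
    have hb := E.adj (M.vertexPerm b)
    have hc' := E.adj (M.vertexPerm c)
    rw [E.o_vertexPerm] at ha hb hc'
    have ta := E.leg_target h
    have tb := E.leg_target h.rotate
    have tc := E.leg_target h.rotate.rotate
    rcases hleg x hx hox with rfl | rfl | rfl <;> rcases hleg y hy hoy with rfl | rfl | rfl
    · rfl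
    · exact (hc.distinct_pq _ ta.2.2 ⟨ha, hxy ▸ hb⟩).elim
    · exact (hc.distinct_pr _ ta.2.1 ⟨ha, hxy ▸ hc'⟩).elim
    · exact (hc.distinct_pq _ tb.2.1 ⟨hxy ▸ ha, hb⟩).elim
    · rfl
    · exact (hc.distinct_qr _ tb.2.2 ⟨hb, hxy ▸ hc'⟩).elim
    · exact (hc.distinct_pr _ tc.2.2 ⟨hxy ▸ ha, hc'⟩).elim
    · exact (hc.distinct_qr _ tc.2.1 ⟨hxy ▸ hb, hc'⟩).elim
    · rfl
  have none_iff : ∀ x : {x // M.OffTriangle a b c x}, shrinkOrigin M o a b c p q r x = none ↔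
      ¬ (o x ≠ o a ∧ o x ≠ o b ∧ o x ≠ o c) := fun x => by rw [shrinkOrigin_none, hpqr]
  refine ⟨?_, ?_, ?_, ?_⟩
  · intro d e
    constructor
    · apply CombMap.invariants_sameCycle
      intro x
      have h1 : ∀ y, o (M.shrinkNext a b c y) = o (M.vertexPerm y) ∨
          (¬ (o (M.shrinkNext a b c y) ≠ o a ∧ o (M.shrinkNext a b c y) ≠ o b ∧
            o (M.shrinkNext a b c y) ≠ o c) ∧ ¬ (o y ≠ o a ∧ o y ≠ o b ∧ o y ≠ o c)) := by
        intro y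
        by_cases h1 : y = M.vertexPerm a
        · right; rw [h1, CombMap.shrinkNext_a]; simp [E.o_vertexPerm]
        by_cases h2 : y = M.vertexPerm b
        · right; rw [h2, h.shrinkNext_b]; simp [E.o_vertexPerm]
        by_cases h3 : y = M.vertexPerm c
        · right; rw [h3, h.shrinkNext_c]; simp [E.o_vertexPerm]
        rw [CombMap.shrinkNext_of_ne h1 h2 h3]
        exact Or.inl rfl
      rcases h1 x with h2 | ⟨h2, h3⟩
      · rw [E.o_vertexPerm] at h2
        rcases hx : shrinkOrigin M o a b c p q r x with _ | u
        · rw [none_iff] at hx ⊢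
          rwa [CombMap.shrink_vertexPerm, h2]
        · rw [shrinkOrigin_some] at hx ⊢
          rwa [CombMap.shrink_vertexPerm, h2]
      · rw [(none_iff x).2 h3]
        exact (none_iff _).2 h2
    · intro hde
      rcases hx : shrinkOrigin M o a b c p q r d with _ | u <;> rw [hx, eq_comm] at hde
      · rw [none_iff] at hx hde
        have key : ∀ x : {x // M.OffTriangle a b c x}, ¬ (o x ≠ o a ∧ o x ≠ o b ∧ o x ≠ o c) →
            (CombMap.shrink h).vertexPerm.SameCycle x ⟨_, h.off_a⟩ := by
          intro x hox
          have hx := x.2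
          rcases hleg x hx hox with h1 | h1 | h1
          · rw [show x = ⟨_, h.off_a⟩ from Subtype.ext h1]
          · exact (show x = ⟨_, h.off_b⟩ from Subtype.ext h1) ▸ h.sameCycle_ba
          · exact (show x = ⟨_, h.off_c⟩ from Subtype.ext h1) ▸
              h.sameCycle_ca
        exact (key d hx).trans (key e hde).symm
      · rw [shrinkOrigin_some] at hx hde
        exact h.shrink_sameCycle ((E.same _ _).2 (hx.trans hde.symm))
  · intro x
    rcases hx : shrinkOrigin M o a b c p q r x with _ | u <;>
      rcases hy : shrinkOrigin M o a b c p q r ((CombMap.shrink h).edgePerm x) with _ | v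
    · rw [none_iff] at hx hy
      exact hy (hout x x.2 hx)
    · rw [none_iff] at hx
      rw [shrinkOrigin_some] at hy
      exact (hadj _).2 ⟨_, hx, hy ▸ E.adj x⟩
    · rw [none_iff] at hy
      rw [shrinkOrigin_some] at hx
      exact (hadj _).2 ⟨_, hy, hx ▸ (E.adj x).symm⟩
    · rw [shrinkOrigin_some] at hx hy
      show G.Adj u v
      rw [← hx, ← hy]
      exact E.adj x
  · have hex : ∀ u v, (¬ (u ≠ o a ∧ u ≠ o b ∧ u ≠ o c)) → (v ≠ o a ∧ v ≠ o b ∧ v ≠ o c) →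
        G.Adj u v → ∃ d : {x // M.OffTriangle a b c x}, o d = u ∧ o (M.edgePerm d) = v := by
      intro u v hu hv huv
      obtain ⟨d, rfl, rfl⟩ := E.ex u v huv
      exact ⟨⟨d, by by_contra h'; exact hin' _ h' hv⟩, rfl, rfl⟩
    rintro (_ | u) (_ | v) huv
    · exact huv.elim
    · obtain ⟨u, hu, huv⟩ := (hadj _).1 huv
      obtain ⟨d, h1, h2⟩ := hex u v hu ((hpqr _).1 v.2) huv
      exact ⟨d, (none_iff _).2 (h1 ▸ hu), shrinkOrigin_some.2 h2⟩
    · obtain ⟨v, hv, huv⟩ := (hadj _).1 huv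
      obtain ⟨d, h1, h2⟩ := hex v u hv ((hpqr _).1 u.2) huv
      refine ⟨(CombMap.shrink h).edgePerm d, shrinkOrigin_some.2 h2, ?_⟩
      rw [(CombMap.shrink h).edgePerm_edgePerm]
      exact (none_iff _).2 (h1 ▸ hv)
    · obtain ⟨d, h1, h2⟩ := E.ex u v huv
      exact ⟨⟨d, by by_contra h'; exact hin _ h' (h1 ▸ (hpqr _).1 u.2)⟩, shrinkOrigin_some.2 h1,
        shrinkOrigin_some.2 h2⟩
  · intro d e h1 h2
    apply Subtype.ext
    rcases hx : shrinkOrigin M o a b c p q r d with _ | u <;>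
      rcases hy : shrinkOrigin M o a b c p q r ((CombMap.shrink h).edgePerm d) with _ | v <;>
      rw [hx, eq_comm] at h1 <;> rw [hy, eq_comm] at h2
    · rw [none_iff] at hx hy
      exact (hy (hout d d.2 hx)).elim
    · rw [none_iff] at hx h1
      rw [shrinkOrigin_some] at hy h2
      exact hdist _ _ d.2 hx e.2 h1 (hy.trans h2.symm)
    · rw [none_iff] at hy h2
      rw [shrinkOrigin_some] at hx h1
      apply M.edgePerm.injective
      apply hdist _ _ ((CombMap.shrink h).edgePerm d).2 hy ((CombMap.shrink h).edgePerm e).2 h2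
      rw [CombMap.shrink_edgePerm, CombMap.shrink_edgePerm, M.edgePerm_edgePerm,
        M.edgePerm_edgePerm, hx, h1]
    · rw [shrinkOrigin_some] at hx hy h1 h2
      exact E.uniq _ _ (hx.trans h1.symm) (hy.trans h2.symm)

end Shrink

end Emb

/-! ### Suppressing the middle of a fan -/

namespace CombMap

variable {D : Type u}

/-- Two triangular faces sharing an edge `w`: the path `p`, `q`, `r` and the apex `s` are joined by
the darts `e = ps`, `u = pq`, `w = qs`, `v = qr` and `f = sr`. -/
structure Fan (M : CombMap D) (e u w v f : D) : Prop where
  pe : M.vertexPerm e = u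
  pu : M.vertexPerm (M.vertexPerm u) = e
  qu : M.vertexPerm (M.edgePerm u) = w
  qw : M.vertexPerm w = v
  qv : M.vertexPerm v = M.edgePerm u
  sf : M.vertexPerm f = M.edgePerm w
  sw : M.vertexPerm (M.edgePerm w) = M.edgePerm e
  rv : M.vertexPerm (M.edgePerm v) = M.edgePerm f
  rf : M.vertexPerm (M.vertexPerm (M.edgePerm f)) = M.edgePerm v
  nodup : [e, u, w, v, f, M.edgePerm e, M.edgePerm u, M.edgePerm w, M.edgePerm v, M.edgePerm f,
    M.vertexPerm u, M.vertexPerm (M.edgePerm f)].Nodup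

/-- The darts that survive when the middle vertex of a fan is suppressed. -/
def OffMiddle (M : CombMap D) (u w v x : D) : Prop :=
  x ∉ [w, v, M.edgePerm u, M.edgePerm w]

open Classical in
/-- The rotation after suppressing the middle vertex of a fan. -/
noncomputable def suppressNext (M : CombMap D) (e f x : D) : D :=
  if x = f then M.edgePerm e else M.vertexPerm x

open Classical in
/-- The reversal of darts after suppressing the middle vertex of a fan. -/
noncomputable def suppressRev (M : CombMap D) (u v x : D) : D :=
  if x = u then M.edgePerm v else if x = M.edgePerm v then u else M.edgePerm x

variable {M : CombMap D} {e u w v f : D}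

theorem Fan.off_next (h : M.Fan e u w v f) {x : D} (hx : M.OffMiddle u w v x) :
    M.OffMiddle u w v (M.suppressNext e f x) := by
  obtain ⟨h1, h2, h3, h4, h5, h6, h7, h8, h9, h10⟩ := h
  have hinj : ∀ x y, M.vertexPerm x = M.vertexPerm y → x = y :=
    fun x y => M.vertexPerm.injective.eq_iff.1
  unfold OffMiddle suppressNext at *
  simp only [List.nodup_cons, List.mem_cons, List.not_mem_nil, or_false, not_or] at *
  grind

theorem Fan.next_inj (h : M.Fan e u w v f) {x y : D} (hx : M.OffMiddle u w v x)
    (hy : M.OffMiddle u w v y) (hxy : M.suppressNext e f x = M.suppressNext e f y) : x = y := by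
  obtain ⟨h1, h2, h3, h4, h5, h6, h7, h8, h9, h10⟩ := h
  have hinj : ∀ x y, M.vertexPerm x = M.vertexPerm y → x = y :=
    fun x y => M.vertexPerm.injective.eq_iff.1
  unfold OffMiddle suppressNext at *
  simp only [List.nodup_cons, List.mem_cons, List.not_mem_nil, or_false, not_or] at *
  grind

theorem Fan.off_rev (h : M.Fan e u w v f) {x : D} (hx : M.OffMiddle u w v x) :
    M.OffMiddle u w v (M.suppressRev u v x) := by
  obtain ⟨h1, h2, h3, h4, h5, h6, h7, h8, h9, h10⟩ := h
  have := M.edgePerm_edgePerm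
  unfold OffMiddle suppressRev at *
  simp only [List.nodup_cons, List.mem_cons, List.not_mem_nil, or_false, not_or] at *
  grind

theorem Fan.rev_rev (h : M.Fan e u w v f) {x : D} (hx : M.OffMiddle u w v x) :
    M.suppressRev u v (M.suppressRev u v x) = x := by
  obtain ⟨h1, h2, h3, h4, h5, h6, h7, h8, h9, h10⟩ := h
  have := M.edgePerm_edgePerm
  unfold OffMiddle suppressRev at *
  simp only [List.nodup_cons, List.mem_cons, List.not_mem_nil, or_false, not_or] at *
  grind

theorem Fan.rev_ne (h : M.Fan e u w v f) (x : D) : M.suppressRev u v x ≠ x := by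
  obtain ⟨h1, h2, h3, h4, h5, h6, h7, h8, h9, h10⟩ := h
  have := M.edgePerm_ne x
  unfold suppressRev at *
  simp only [List.nodup_cons, List.mem_cons, List.not_mem_nil, or_false, not_or] at *
  grind

/-- Suppress the middle vertex of a fan. -/
noncomputable def suppress [Finite D] (h : M.Fan e u w v f) :
    CombMap {x // M.OffMiddle u w v x} where
  vertexPerm := Equiv.ofBijective
    (fun x => ⟨M.suppressNext e f x, h.off_next x.2⟩)
    (Finite.injective_iff_bijective.1 fun x y hxy =>
      Subtype.ext (h.next_inj x.2 y.2 (congrArg Subtype.val hxy)))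
  edgePerm := Function.Involutive.toPerm
    (fun x => ⟨M.suppressRev u v x, h.off_rev x.2⟩)
    (fun x => Subtype.ext (h.rev_rev x.2))
  edgePerm_edgePerm x := Subtype.ext (h.rev_rev x.2)
  edgePerm_ne x hx := h.rev_ne x (congrArg Subtype.val hx)

theorem suppress_vertexPerm [Finite D] (h : M.Fan e u w v f) (x) :
    ((suppress h).vertexPerm x : D) = M.suppressNext e f x := rfl

theorem suppress_facePerm [Finite D] (h : M.Fan e u w v f) (x) :
    ((suppress h).facePerm x : D) = M.suppressNext e f (M.suppressRev u v x) := rfl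

theorem suppressNext_self : M.suppressNext e f f = M.edgePerm e := if_pos rfl

theorem suppressNext_of_ne {x : D} (h : x ≠ f) : M.suppressNext e f x = M.vertexPerm x := if_neg h

theorem suppressRev_left : M.suppressRev u v u = M.edgePerm v := if_pos rfl

theorem Fan.suppressRev_right (h : M.Fan e u w v f) : M.suppressRev u v (M.edgePerm v) = u := by
  have := h.rev_rev (x := u) (by
    have := h.nodup
    simp only [OffMiddle, List.nodup_cons, List.mem_cons, List.not_mem_nil, or_false,
      not_or] at this ⊢
    grind)
  rwa [suppressRev_left] at this

theorem suppressRev_of_ne {x : D} (h1 : x ≠ u) (h2 : x ≠ M.edgePerm v) :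
    M.suppressRev u v x = M.edgePerm x := by
  rw [suppressRev, if_neg h1, if_neg h2]

theorem Fan.face_u (h : M.Fan e u w v f) :
    M.suppressNext e f (M.suppressRev u v u) = M.edgePerm f := by
  have := h.nodup
  simp only [List.nodup_cons, List.mem_cons, List.not_mem_nil, or_false, not_or] at this
  rw [suppressRev_left, suppressNext_of_ne, h.rv]
  grind

theorem Fan.face_v (h : M.Fan e u w v f) :
    M.suppressNext e f (M.suppressRev u v (M.edgePerm v)) = M.vertexPerm u := by
  have := h.nodup
  simp only [List.nodup_cons, List.mem_cons, List.not_mem_nil, or_false, not_or] at this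
  rw [h.suppressRev_right, suppressNext_of_ne]
  grind

theorem Fan.face_f (h : M.Fan e u w v f) :
    M.suppressNext e f (M.suppressRev u v (M.edgePerm f)) = M.edgePerm e := by
  have := h.nodup
  simp only [List.nodup_cons, List.mem_cons, List.not_mem_nil, or_false, not_or] at this
  rw [suppressRev_of_ne, M.edgePerm_edgePerm, suppressNext_self] <;> grind

theorem suppress_face_of_ne {x : D} (h1 : x ≠ u) (h2 : x ≠ M.edgePerm v) (h3 : x ≠ M.edgePerm f) :
    M.suppressNext e f (M.suppressRev u v x) = M.facePerm x := by
  rw [suppressRev_of_ne h1 h2, suppressNext_of_ne, facePerm_apply]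
  exact fun h => h3 (by rw [← h, M.edgePerm_edgePerm])

theorem Fan.facePerm (h : M.Fan e u w v f) : M.facePerm u = w ∧ M.facePerm w = M.edgePerm e ∧
    M.facePerm (M.edgePerm e) = u ∧ M.facePerm (M.edgePerm w) = v ∧ M.facePerm v = M.edgePerm f ∧
    M.facePerm (M.edgePerm f) = M.edgePerm w ∧ M.facePerm (M.edgePerm v) = M.edgePerm u ∧
    M.facePerm (M.edgePerm u) = M.vertexPerm u := by
  simp only [facePerm_apply, M.edgePerm_edgePerm]
  exact ⟨h.qu, h.sw, h.pe, h.qw, h.rv, h.sf, h.qv, trivial⟩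

theorem not_offMiddle {x : D} : ¬ M.OffMiddle u w v x ↔
    x = w ∨ x = v ∨ x = M.edgePerm u ∨ x = M.edgePerm w := by
  simp only [OffMiddle, List.mem_cons, List.not_mem_nil, or_false, not_not]

theorem not_offMiddle_self : ¬ M.OffMiddle u w v w ∧ ¬ M.OffMiddle u w v v ∧
    ¬ M.OffMiddle u w v (M.edgePerm u) ∧ ¬ M.OffMiddle u w v (M.edgePerm w) := by
  simp [OffMiddle]

theorem Fan.off (h : M.Fan e u w v f) : M.OffMiddle u w v e ∧ M.OffMiddle u w v u ∧
    M.OffMiddle u w v f ∧ M.OffMiddle u w v (M.edgePerm e) ∧ M.OffMiddle u w v (M.edgePerm v) ∧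
    M.OffMiddle u w v (M.edgePerm f) ∧ M.OffMiddle u w v (M.vertexPerm u) ∧
    M.OffMiddle u w v (M.vertexPerm (M.edgePerm f)) := by
  have := h.nodup
  simp only [OffMiddle, List.nodup_cons, List.mem_cons, List.not_mem_nil, or_false,
    not_or] at this ⊢
  grind

/-- The extension is zero at the two triangle corners of the middle vertex, repeats the apex corner,
and takes on the remaining corner the value that balances the edge `u`. The two zeros lie at one
vertex, so the face part of the splitting agrees on the two triangles and descends to their union.
-/
theorem Jordan.suppress [Finite D] (J : M.Jordan) (h : M.Fan e u w v f) : (suppress h).Jordan := by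
  classical
  intro k hk
  let kx : D → ZMod 2 := fun x => if hx : M.OffMiddle u w v x then k ⟨x, hx⟩ else 0
  let K : D → ZMod 2 := fun x => if x = M.edgePerm w then kx (M.edgePerm e) else
    if x = M.edgePerm u then kx u + kx (M.vertexPerm u) else kx x
  have hnd := h.nodup
  simp only [List.nodup_cons, List.mem_cons, List.not_mem_nil, or_false, not_or] at hnd
  obtain ⟨oe, ou, of', oe', ov', of'', oup, ofp⟩ := h.off
  obtain ⟨n1, n2, n3, n4⟩ := not_offMiddle_self (M := M) (u := u) (w := w) (v := v)
  have Koff : ∀ x, (hx : M.OffMiddle u w v x) → K x = k ⟨x, hx⟩ := by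
    intro x hx
    have h1 : x ≠ M.edgePerm w := fun h => n4 (h ▸ hx)
    have h2 : x ≠ M.edgePerm u := fun h => n3 (h ▸ hx)
    simp only [K, kx, if_neg h1, if_neg h2, dif_pos hx]
  have Kw : K w = 0 := by
    simp only [K, kx, dif_neg n1]; rw [if_neg, if_neg] <;> grind
  have Kv : K v = 0 := by
    simp only [K, kx, dif_neg n2]; rw [if_neg, if_neg] <;> grind
  have Kw' : K (M.edgePerm w) = K (M.edgePerm e) := by
    rw [Koff _ oe']; simp only [K, kx, if_true, dif_pos oe']
  have Ku' : K (M.edgePerm u) = K u + K (M.vertexPerm u) := by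
    rw [Koff _ ou, Koff _ oup]
    have : M.edgePerm u ≠ M.edgePerm w := by grind
    simp only [K, kx, if_neg this, if_true, dif_pos ou, dif_pos oup]
  have e2 := M.edgePerm_edgePerm
  have h2 : (2 : ZMod 2) = 0 := rfl
  have Kn : ∀ x, K (M.suppressNext e f x) = K (M.vertexPerm x) := by
    intro x
    by_cases hx : x = f
    · rw [hx, suppressNext_self, h.sf, Kw']
    · rw [suppressNext_of_ne hx]
  have hk' : ∀ x, M.OffMiddle u w v x → K x + K (M.vertexPerm x) + (K (M.suppressRev u v x) +
      K (M.vertexPerm (M.suppressRev u v x))) = 0 := by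
    intro x hx
    rw [← Kn, ← Kn, Koff _ hx, Koff _ (h.off_next hx), Koff _ (h.off_rev hx),
      Koff _ (h.off_next (h.off_rev hx))]
    exact hk ⟨x, hx⟩
  have hku := hk' u ou
  rw [suppressRev_left, h.rv] at hku
  have key_w : K w + K (M.vertexPerm w) + (K (M.edgePerm w) + K (M.vertexPerm (M.edgePerm w)))
      = 0 := by
    rw [h.qw, h.sw, Kw, Kv, Kw']; linear_combination K (M.edgePerm e) * h2
  have key_u : K u + K (M.vertexPerm u) + (K (M.edgePerm u) + K (M.vertexPerm (M.edgePerm u)))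
      = 0 := by
    rw [h.qu, Kw, Ku']; linear_combination (K u + K (M.vertexPerm u)) * h2
  have key_v : K v + K (M.vertexPerm v) + (K (M.edgePerm v) + K (M.vertexPerm (M.edgePerm v)))
      = 0 := by
    rw [h.qv, h.rv, Kv, Ku']; linear_combination hku
  obtain ⟨a, g, ha, hg, hag⟩ := J K (by
    intro d
    by_cases hd : M.OffMiddle u w v d
    · by_cases h1 : d = u
      · rw [h1]; exact key_u
      by_cases h2 : d = M.edgePerm v
      · rw [h2, e2]; linear_combination key_v
      have := hk' d hd
      rwa [suppressRev_of_ne h1 h2] at this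
    · rcases not_offMiddle.1 hd with rfl | rfl | rfl | rfl
      · exact key_w
      · exact key_v
      · rw [e2]; linear_combination key_u
      · rw [e2]; linear_combination key_w)
  obtain ⟨p1, p2, p3, p4, p5, p6, p7, p8⟩ := h.facePerm
  have awv : a w = a v := by
    have h1 := hag w
    have h3 := hag v
    have h4 := hg w
    rw [h.qw] at h4
    rw [Kw] at h1
    rw [Kv] at h3
    linear_combination h3 - h1 + h4
  refine ⟨fun x => a x, fun x => g x, fun x => ?_, fun x => ?_, fun x => ?_⟩
  · show a (M.suppressNext e f (M.suppressRev u v x)) = a x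
    by_cases h1 : (x : D) = u
    · rw [h1, h.face_u, ← p5, ha, ← awv, ← p1, ha]
    by_cases h2 : (x : D) = M.edgePerm v
    · rw [h2, h.face_v, ← p8, ha, ← p7, ha]
    by_cases h3 : (x : D) = M.edgePerm f
    · rw [h3, h.face_f, ← p2, ha, awv, ← p5, ha]
    rw [suppress_face_of_ne h1 h2 h3, ha]
  · show g (M.suppressNext e f x) = g x
    by_cases h1 : (x : D) = f
    · rw [h1, suppressNext_self, ← h.sw, hg, ← h.sf, hg]
    · rw [suppressNext_of_ne h1, hg]
  · rw [← hag, Koff _ x.2]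

theorem Fan.suppress_sameCycle [Finite D] (h : M.Fan e u w v f)
    {x y : {x // M.OffMiddle u w v x}} (hxy : M.vertexPerm.SameCycle x y) :
    (suppress h).vertexPerm.SameCycle x y := by
  classical
  obtain ⟨oe, ou, of', oe', ov', of'', oup, ofp⟩ := h.off
  obtain ⟨n1, n2, n3, n4⟩ := not_offMiddle_self (M := M) (u := u) (w := w) (v := v)
  let ρ : D → {x // M.OffMiddle u w v x} :=
    fun x => if hx : M.OffMiddle u w v x then ⟨x, hx⟩ else ⟨_, oe'⟩
  have hρ : ∀ x, (hx : M.OffMiddle u w v x) → ρ x = ⟨x, hx⟩ := fun x hx => dif_pos hx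
  have hρ' : ∀ x, ¬ M.OffMiddle u w v x → ρ x = ⟨_, oe'⟩ := fun x hx => dif_neg hx
  have := sameCycle_transfer (f := M.vertexPerm) (g := (suppress h).vertexPerm) ρ (by
    intro x
    by_cases hx : M.OffMiddle u w v x
    · have h4 : ρ (M.vertexPerm x) = (suppress h).vertexPerm ⟨x, hx⟩ := by
        apply Subtype.ext
        rw [suppress_vertexPerm]
        by_cases h1 : x = f
        · subst h1
          rw [h.sf, suppressNext_self, hρ' _ n4]
        · have h5 := suppressNext_of_ne (M := M) (e := e) h1
          rw [hρ _ (h5 ▸ h.off_next hx)]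
          exact h5.symm
      rw [h4, hρ _ hx]
      exact sameCycle_apply_self _ _
    · rcases not_offMiddle.1 hx with rfl | rfl | rfl | rfl
      · rw [h.qw, hρ' _ n1, hρ' _ n2]
      · rw [h.qv, hρ' _ n2, hρ' _ n3]
      · rw [h.qu, hρ' _ n3, hρ' _ n1]
      · rw [h.sw, hρ' _ n4, hρ _ oe']) hxy
  rwa [hρ _ x.2, hρ _ y.2] at this

theorem Fan.suppress_sameCycle_facePerm [Finite D] (h : M.Fan e u w v f)
    {x y : D} {x' y' : {x // M.OffMiddle u w v x}} (hxy : M.facePerm.SameCycle x y)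
    (hx : x = x' ∨ (x = M.edgePerm w ∧ x' = M.edgePerm e))
    (hy : y = y' ∨ (y = M.edgePerm w ∧ y' = M.edgePerm e)) :
    (suppress h).facePerm.SameCycle x' y' := by
  classical
  obtain ⟨oe, ou, of', oe', ov', of'', oup, ofp⟩ := h.off
  obtain ⟨n1, n2, n3, n4⟩ := not_offMiddle_self (M := M) (u := u) (w := w) (v := v)
  have hnd := h.nodup
  simp only [List.nodup_cons, List.mem_cons, List.not_mem_nil, or_false, not_or] at hnd
  let ρ : D → {x // M.OffMiddle u w v x} :=
    fun x => if hx : M.OffMiddle u w v x then ⟨x, hx⟩ else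
      if x = M.edgePerm u then ⟨_, oup⟩ else ⟨_, oe'⟩
  have hρ : ∀ x, (hx : M.OffMiddle u w v x) → ρ x = ⟨x, hx⟩ := fun x hx => dif_pos hx
  have rw' : ρ w = ⟨_, oe'⟩ := by
    simp only [ρ, dif_neg n1]; rw [if_neg]; grind
  have rv : ρ v = ⟨_, oe'⟩ := by
    simp only [ρ, dif_neg n2]; rw [if_neg]; grind
  have ru : ρ (M.edgePerm u) = ⟨_, oup⟩ := by
    simp only [ρ, dif_neg n3, if_true]
  have rw2 : ρ (M.edgePerm w) = ⟨_, oe'⟩ := by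
    simp only [ρ, dif_neg n4]; rw [if_neg]; grind
  obtain ⟨p1, p2, p3, p4, p5, p6, p7, p8⟩ := h.facePerm
  have q1 : (suppress h).facePerm ⟨_, ou⟩ = ⟨_, of''⟩ := Subtype.ext h.face_u
  have q2 : (suppress h).facePerm ⟨_, ov'⟩ = ⟨_, oup⟩ := Subtype.ext h.face_v
  have q3 : (suppress h).facePerm ⟨_, of''⟩ = ⟨_, oe'⟩ := Subtype.ext h.face_f
  have c1 := sameCycle_apply_self (suppress h).facePerm ⟨_, ou⟩
  have c2 := sameCycle_apply_self (suppress h).facePerm ⟨_, ov'⟩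
  have c3 := sameCycle_apply_self (suppress h).facePerm ⟨_, of''⟩
  rw [q1] at c1
  rw [q2] at c2
  rw [q3] at c3
  have := sameCycle_transfer (f := M.facePerm) (g := (suppress h).facePerm) ρ (by
    intro x
    by_cases hx : M.OffMiddle u w v x
    · by_cases h1 : x = u
      · rw [h1, p1, rw', hρ _ ou]; exact c1.trans c3
      by_cases h2 : x = M.edgePerm v
      · rw [h2, p7, ru, hρ _ ov']; exact c2
      by_cases h3 : x = M.edgePerm f
      · rw [h3, p6, rw2, hρ _ of'']; exact c3
      have h4 : ρ (M.facePerm x) = (suppress h).facePerm ⟨x, hx⟩ := by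
        apply Subtype.ext
        rw [suppress_facePerm]
        have h5 := suppress_face_of_ne (M := M) (e := e) h1 h2 h3
        rw [hρ _ (h5 ▸ h.off_next (h.off_rev hx))]
        exact h5.symm
      rw [h4, hρ _ hx]
      exact sameCycle_apply_self _ _
    · rcases not_offMiddle.1 hx with rfl | rfl | rfl | rfl
      · rw [p2, rw', hρ _ oe']
      · rw [p5, rv, hρ _ of'']; exact c3.symm
      · rw [p8, ru, hρ _ oup]
      · rw [p4, rw2, rv]) hxy
  have hfin : ∀ (z : D) (z' : {x // M.OffMiddle u w v x}),
      (z = z' ∨ (z = M.edgePerm w ∧ z' = M.edgePerm e)) → ρ z = z' := by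
    rintro z z' (hz | ⟨hz, hz'⟩)
    · rw [hz]; exact hρ _ z'.2
    · rw [hz, rw2]; exact Subtype.ext hz'.symm
  rwa [hfin _ _ hx, hfin _ _ hy] at this

end CombMap

/-! ### The D3b configuration in an embedded graph -/

namespace Emb

variable {V D : Type u} {G : SimpleGraph V} {M : CombMap D} {o : D → V} {e u w v f : D}
  {p q r s : V}

theorem fan (E : Emb G M o) (h : IsD3bConfig G p q r s) (oe : o e = p) (oe' : o (M.edgePerm e) = s)
    (ou : o u = p) (ou' : o (M.edgePerm u) = q) (ow : o w = q) (ow' : o (M.edgePerm w) = s)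
    (ov : o v = q) (ov' : o (M.edgePerm v) = r) (of' : o f = s) (of'' : o (M.edgePerm f) = r)
    (p1 : M.facePerm u = w) (p2 : M.facePerm w = M.edgePerm e) (p3 : M.facePerm (M.edgePerm e) = u)
    (p4 : M.facePerm (M.edgePerm w) = v) (p5 : M.facePerm v = M.edgePerm f)
    (p6 : M.facePerm (M.edgePerm f) = M.edgePerm w) : M.Fan e u w v f := by
  simp only [CombMap.facePerm_apply, M.edgePerm_edgePerm] at p1 p2 p3 p4 p5 p6
  obtain ⟨a1, a2, a3⟩ := E.three (d := e) (oe ▸ h.deg_p)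
  obtain ⟨b1, b2, b3⟩ := E.three (d := M.edgePerm u) (ou' ▸ h.deg_q)
  obtain ⟨c1, c2, c3⟩ := E.three (d := M.edgePerm v) (ov' ▸ h.deg_r)
  rw [p3] at a1 a2 a3
  rw [p1, p4] at b1 b3
  rw [p1] at b2
  rw [p5] at c1 c2 c3
  have n1 := h.adj_pq.ne
  have n2 := h.adj_qr.ne
  have n3 := h.ne_pr
  have n4 := h.adj_sp.ne
  have n5 := h.adj_sq.ne
  have n6 := h.adj_sr.ne
  have ou2 := E.o_vertexPerm u
  have of2 := E.o_vertexPerm (M.edgePerm f)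
  have hsu : M.vertexPerm u ≠ u := fun h => a3 (h.trans (by rw [h, h] at a1; exact a1))
  have hsf : M.vertexPerm (M.edgePerm f) ≠ M.edgePerm f :=
    fun h => c3 (h.trans (by rw [h, h] at c1; exact c1))
  have hwv : w ≠ v := fun h => b2 (by rw [← h] at p4; rw [← h, p4] at b1; exact b1)
  refine ⟨p3, a1, p1, p4, b1, p6, p2, p5, c1, ?_⟩
  have g1 : M.edgePerm w ≠ M.edgePerm e := fun h => n1 (by
    rw [← oe, ← ow, M.edgePerm.injective h])
  have g2 : M.edgePerm w ≠ f := fun h => n2 (by rw [← of'', ← h, M.edgePerm_edgePerm, ow])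
  have g3 : M.edgePerm e ≠ f := fun h => n3 (by rw [← of'', ← h, M.edgePerm_edgePerm, oe])
  simp only [List.nodup_cons, List.mem_cons, List.not_mem_nil, or_false, not_or]
  refine ⟨⟨?_, ?_, ?_, ?_, ?_, ?_, ?_, ?_, ?_, ?_, ?_⟩, ⟨?_, ?_, ?_, ?_, ?_, ?_, ?_, ?_, ?_, ?_⟩,
    ⟨?_, ?_, ?_, ?_, ?_, ?_, ?_, ?_, ?_⟩, ⟨?_, ?_, ?_, ?_, ?_, ?_, ?_, ?_⟩,
    ⟨?_, ?_, ?_, ?_, ?_, ?_, ?_⟩, ⟨?_, ?_, ?_, ?_, ?_, ?_⟩, ⟨?_, ?_, ?_, ?_, ?_⟩,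
    ⟨?_, ?_, ?_, ?_⟩, ⟨?_, ?_, ?_⟩, ⟨?_, ?_⟩, ?_, ?_, ?_⟩
  all_goals grind

/-- Both triangles bound faces. Opposite orientations of these faces would identify `p` and `r`; if
both are reversed, `p` and `r` exchange roles. -/
theorem exists_fan (E : Emb G M o) (J : M.Jordan) (h : IsD3bConfig G p q r s)
    (h1 : G.ConnectedOff {p, q, s}) (h2 : G.ConnectedOff {q, r, s}) :
    ∃ p' r', ((p' = p ∧ r' = r) ∨ (p' = r ∧ r' = p)) ∧ ∃ e u w v f, M.Fan e u w v f ∧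
      o e = p' ∧ o w = q ∧ o (M.edgePerm f) = r' ∧ o f = s := by
  obtain ⟨e, oe, oe'⟩ := E.ex _ _ h.adj_sp.symm
  obtain ⟨u, ou, ou'⟩ := E.ex _ _ h.adj_pq
  obtain ⟨w, ow, ow'⟩ := E.ex _ _ h.adj_sq.symm
  obtain ⟨v, ov, ov'⟩ := E.ex _ _ h.adj_qr
  obtain ⟨f, of', of''⟩ := E.ex _ _ h.adj_sr
  have e2 := M.edgePerm_edgePerm
  have t1 := E.triangle_face J (ab := u) (bc := w) (ca := M.edgePerm e) (by rw [ou', ow])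
    (by rw [ow', oe']) (by rw [e2, oe, ou]) (by rwa [ou, ow, oe'])
  have t2 := E.triangle_face J (ab := v) (bc := M.edgePerm f) (ca := M.edgePerm w)
      (by rw [ov', of''])
    (by rw [e2, of', ow']) (by rw [e2, ov, ow]) (by rwa [ov, of'', ow'])
  simp only [e2] at t1 t2
  have npr := h.ne_pr
  rcases t1 with ⟨p1, p2, p3⟩ | ⟨p1, p2, p3⟩ <;> rcases t2 with ⟨p4, p5, p6⟩ | ⟨p4, p5, p6⟩
  · exact ⟨p, r, Or.inl ⟨rfl, rfl⟩, e, u, w, v, f, E.fan h oe oe' ou ou' ow ow' ov ov' of' of''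
      p1 p2 p3 p6 p4 p5, oe, ow, of'', of'⟩
  · exact (npr (by rw [← oe, ← of'', ← p2.symm.trans p5, e2])).elim
  · exact (npr (by rw [← ou, ← ov', ← p3.symm.trans p6, e2])).elim
  · exact ⟨r, p, Or.inr ⟨rfl, rfl⟩, M.edgePerm f, M.edgePerm v, w, M.edgePerm u, M.edgePerm e,
      E.fan h.swap of'' (by rw [e2, of']) ov' (by rw [e2, ov]) ow ow' ou' (by rw [e2, ou]) oe'
        (by rw [e2, oe]) p4 (by rw [e2, p5]) (by rw [e2, p6]) p3 (by rw [p1, e2]) (by rw [e2, p2]),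
      of'', ow, by rw [e2, oe], oe'⟩

theorem fan_o (E : Emb G M o) (h : M.Fan e u w v f) : o u = o e ∧ o (M.edgePerm u) = o w ∧
    o v = o w ∧ o (M.edgePerm v) = o (M.edgePerm f) ∧ o (M.edgePerm w) = o f ∧
    o (M.edgePerm e) = o f := by
  have e6 : o (M.edgePerm w) = o f := by rw [← h.sf, E.o_vertexPerm]
  exact ⟨by rw [← h.pe, E.o_vertexPerm], by rw [← h.qu, E.o_vertexPerm],
    by rw [← h.qw, E.o_vertexPerm], by rw [← h.rv, E.o_vertexPerm], e6,
    by rw [← h.sw, E.o_vertexPerm, e6]⟩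

theorem eq_of_o_middle (E : Emb G M o) (h : M.Fan e u w v f) {x : D} (hx : o x = o w) :
    x = w ∨ x = v ∨ x = M.edgePerm u := by
  rcases sameCycle_of_three (f := M.vertexPerm) (d := w) (by rw [h.qw, h.qv, h.qu])
    ((E.same _ _).2 hx.symm) with h1 | h1 | h1
  · exact Or.inl h1
  · exact Or.inr (Or.inl (h1.trans h.qw))
  · rw [h.qw, h.qv] at h1
    exact Or.inr (Or.inr h1)

/-- If the apex had degree three, the middle vertex and the apex would have no neighbours besides
each other, `p` and `r`, so `p` and `r` would separate them from the third neighbour of `p`. -/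
theorem fan_apex (E : Emb G M o) (hG : G.ThreeConnected)
    (hc : IsD3bConfig G (o e) (o w) (o (M.edgePerm f)) (o f)) (h : M.Fan e u w v f) :
    M.vertexPerm (M.edgePerm e) ≠ f := by
  intro hf
  obtain ⟨p', hp1, hp2, hp3⟩ := exists_third_neighbor (a := o w) (b := o f) hc.deg_p
  obtain ⟨o1, o2, o3, o4, o5, o6⟩ := E.fan_o h
  have hs : ∀ x, G.Adj (o f) x → x = o e ∨ x = o w ∨ x = o (M.edgePerm f) := by
    intro x hx
    obtain ⟨d, hd, rfl⟩ := E.ex _ _ hx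
    rcases sameCycle_of_three (f := M.vertexPerm) (d := f) (by rw [h.sf, h.sw, hf])
      ((E.same _ _).2 hd.symm) with h1 | h1 | h1
    · rw [h1]; simp
    · rw [h1, h.sf, M.edgePerm_edgePerm]; simp
    · rw [h1, h.sf, h.sw, M.edgePerm_edgePerm]; simp
  have hq : ∀ x, G.Adj (o w) x → x = o e ∨ x = o f ∨ x = o (M.edgePerm f) := by
    intro x hx
    obtain ⟨d, hd, rfl⟩ := E.ex _ _ hx
    rcases E.eq_of_o_middle h hd with rfl | rfl | rfl
    · right; left; exact o5
    · right; right; exact o4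
    · left; rw [M.edgePerm_edgePerm, o1]
  have hp4 : p' ≠ o (M.edgePerm f) := fun h' => hc.not_adj_pr (h' ▸ hp1)
  have := hG (o e) (o (M.edgePerm f)) (fun x => x = o w ∨ x = o f) (by
    intro x hx y hy hxy
    simp only [Set.mem_insert_iff, Set.mem_singleton_iff, not_or] at hx hy
    constructor
    · rintro (rfl | rfl)
      · rcases hq y hxy with h1 | h1 | h1
        exacts [(hy.1 h1).elim, Or.inr h1, (hy.2 h1).elim]
      · rcases hs y hxy with h1 | h1 | h1
        exacts [(hy.1 h1).elim, Or.inl h1, (hy.2 h1).elim]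
    · rintro (rfl | rfl)
      · rcases hq x hxy.symm with h1 | h1 | h1
        exacts [(hx.1 h1).elim, Or.inr h1, (hx.2 h1).elim]
      · rcases hs x hxy.symm with h1 | h1 | h1
        exacts [(hx.1 h1).elim, Or.inl h1, (hx.2 h1).elim])
    (o f) (by simp [hc.adj_sp.ne, hc.adj_sr.ne]) p' (by simp [hp1.ne.symm, hp4])
  rcases this.1 (Or.inr rfl) with h1 | h1
  exacts [hp2 h1, hp3 h1]

/-- A triangular face on the far side of the path would have `pr` as an edge. -/
theorem not_triangle_of_middle (E : Emb G M o)
    (hc : IsD3bConfig G (o e) (o w) (o (M.edgePerm f)) (o f)) (h : M.Fan e u w v f) {d : D}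
    (hd : M.facePerm.SameCycle (M.edgePerm v) d) : M.facePerm (M.facePerm (M.facePerm d)) ≠ d := by
  intro h3
  have h4 := CombMap.pow_three_of_sameCycle hd.symm h3
  obtain ⟨-, -, -, -, -, -, p7, p8⟩ := h.facePerm
  obtain ⟨o1, o2, o3, o4, o5, o6⟩ := E.fan_o h
  rw [p7, p8, CombMap.facePerm_apply] at h4
  apply hc.not_adj_pr
  have := E.adj (M.vertexPerm u)
  rwa [E.o_vertexPerm, o1, ← E.o_vertexPerm (M.edgePerm (M.vertexPerm u)), h4, o4] at this

theorem o_ne_of_offMiddle (E : Emb G M o) (h : M.Fan e u w v f) {x : D} (hx : M.OffMiddle u w v x) :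
    o x ≠ o w := by
  intro h'
  simp only [CombMap.OffMiddle, List.mem_cons, List.not_mem_nil, or_false, not_or] at hx
  rcases E.eq_of_o_middle h h' with h1 | h1 | h1
  exacts [hx.1 h1, hx.2.1 h1, hx.2.2.1 h1]

theorem suppress [Finite D] (E : Emb G M o) (h : M.Fan e u w v f)
    (hc : IsD3bConfig G p q r s) (hp : o e = p) (hq : o w = q) (hr : o (M.edgePerm f) = r) :
    Emb (d3bReduce G p q r hc.ne_pr) (CombMap.suppress h)
      (fun x => ⟨o x, hq ▸ E.o_ne_of_offMiddle h x.2⟩) := by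
  subst hp hq hr
  obtain ⟨o1, o2, o3, o4, o5, o6⟩ := E.fan_o h
  refine ⟨?_, ?_, ?_, ?_⟩
  · intro d e'
    constructor
    · apply CombMap.invariants_sameCycle
      intro x
      apply Subtype.ext
      show o (M.suppressNext e f x) = o x
      by_cases h1 : (x : D) = f
      · rw [h1, CombMap.suppressNext_self, o6]
      · rw [CombMap.suppressNext_of_ne h1, E.o_vertexPerm]
    · intro hde
      exact h.suppress_sameCycle ((E.same _ _).2 (congrArg Subtype.val hde))
  · intro x
    show G.Adj (o x) (o (M.suppressRev u v x)) ∨ (o x = o e ∧ o (M.suppressRev u v x) =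
      o (M.edgePerm f)) ∨ (o x = o (M.edgePerm f) ∧ o (M.suppressRev u v x) = o e)
    by_cases h1 : (x : D) = u
    · rw [h1, CombMap.suppressRev_left, o1, o4]; simp
    by_cases h2 : (x : D) = M.edgePerm v
    · rw [h2, h.suppressRev_right, o1, o4]; simp
    left
    show G.Adj (o x) (o (M.suppressRev u v x))
    rw [CombMap.suppressRev_of_ne h1 h2]
    exact E.adj x
  · rintro ⟨x, hx⟩ ⟨y, hy⟩ (hxy | ⟨rfl, rfl⟩ | ⟨rfl, rfl⟩)
    · obtain ⟨d, rfl, rfl⟩ := E.ex _ _ hxy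
      have hd : M.OffMiddle u w v d := by
        by_contra hd
        rcases CombMap.not_offMiddle.1 hd with rfl | rfl | rfl | rfl
        · exact hx rfl
        · exact hx o3
        · exact hx o2
        · exact hy (by rw [M.edgePerm_edgePerm])
      refine ⟨⟨d, hd⟩, rfl, Subtype.ext ?_⟩
      show o (M.suppressRev u v d) = o (M.edgePerm d)
      rw [CombMap.suppressRev_of_ne]
      · rintro rfl; exact hy o2
      · rintro rfl; exact hy (by rw [M.edgePerm_edgePerm, o3])
    · refine ⟨⟨u, h.off.2.1⟩, Subtype.ext o1, Subtype.ext ?_⟩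
      show o (M.suppressRev u v u) = o (M.edgePerm f)
      rw [CombMap.suppressRev_left, o4]
    · refine ⟨⟨M.edgePerm v, h.off.2.2.2.2.1⟩, Subtype.ext o4, Subtype.ext ?_⟩
      show o (M.suppressRev u v (M.edgePerm v)) = o e
      rw [h.suppressRev_right, o1]
  · intro d d' h1 h2
    replace h1 : o d = o d' := congrArg Subtype.val h1
    replace h2 : o (M.suppressRev u v d) = o (M.suppressRev u v d') := congrArg Subtype.val h2
    apply Subtype.ext
    -- As `p` and `r` are not adjacent in `G`, the added edge is not a double edge.
    have hnadj : ∀ x : D, o x = o e → o (M.edgePerm x) ≠ o (M.edgePerm f) := fun x h1 h2 =>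
      hc.not_adj_pr (h1 ▸ h2 ▸ E.adj x)
    have hnadj' : ∀ x : D, o x = o (M.edgePerm f) → o (M.edgePerm x) ≠ o e := fun x h1 h2 =>
      hc.not_adj_pr (h1 ▸ h2 ▸ (E.adj x).symm)
    have npr := hc.ne_pr
    by_cases a1 : (d : D) = u
    · rw [a1, CombMap.suppressRev_left, o4] at h2
      rw [a1, o1] at h1
      by_cases b1 : (d' : D) = u
      · rw [a1, b1]
      by_cases b2 : (d' : D) = M.edgePerm v
      · exact (npr (by rw [h1, b2, o4])).elim
      rw [CombMap.suppressRev_of_ne b1 b2] at h2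
      exact (hnadj _ h1.symm h2.symm).elim
    by_cases a2 : (d : D) = M.edgePerm v
    · rw [a2, h.suppressRev_right, o1] at h2
      rw [a2, o4] at h1
      by_cases b1 : (d' : D) = u
      · exact (npr (by rw [h1, b1, o1])).elim
      by_cases b2 : (d' : D) = M.edgePerm v
      · rw [a2, b2]
      rw [CombMap.suppressRev_of_ne b1 b2] at h2
      exact (hnadj' _ h1.symm h2.symm).elim
    rw [CombMap.suppressRev_of_ne a1 a2] at h2
    by_cases b1 : (d' : D) = u
    · rw [b1, CombMap.suppressRev_left, o4] at h2
      rw [b1, o1] at h1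
      exact (hnadj _ h1 h2).elim
    by_cases b2 : (d' : D) = M.edgePerm v
    · rw [b2, h.suppressRev_right, o1] at h2
      rw [b2, o4] at h1
      exact (hnadj' _ h1 h2).elim
    rw [CombMap.suppressRev_of_ne b1 b2] at h2
    exact E.uniq _ _ h1 h2

end Emb

/-! ### Corners labelled by chains of disks -/

namespace CombMap

open OCircle

variable {D B : Type u}

/-- The conditions at a corner that carries a chain of disks: its face is a triangle, and the ends of
the chain are the disks at the other two corners. -/
structure AdmissibleAt (M : CombMap D) (C : D → List B) (d : D) : Prop where
  tri : M.facePerm (M.facePerm (M.facePerm d)) = d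
  deg_fst : M.vertexPerm (M.vertexPerm (M.vertexPerm (M.facePerm d))) = M.facePerm d
  deg_snd : M.vertexPerm (M.vertexPerm (M.vertexPerm (M.facePerm (M.facePerm d)))) =
    M.facePerm (M.facePerm d)
  last : C (M.facePerm d) = (C d).getLast?.toList
  head : C (M.facePerm (M.facePerm d)) = (C d).head?.toList
  fst_one : ¬ 2 ≤ (C (M.vertexPerm (M.facePerm d))).length
  fst_two : ¬ 2 ≤ (C (M.vertexPerm (M.vertexPerm (M.facePerm d)))).length
  snd_one : ¬ 2 ≤ (C (M.vertexPerm (M.facePerm (M.facePerm d)))).length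
  snd_two : ¬ 2 ≤ (C (M.vertexPerm (M.vertexPerm (M.facePerm (M.facePerm d))))).length
  opposite : ¬ 2 ≤ (C (M.facePerm (M.vertexPerm (M.facePerm d)))).length

/-- Admissible labels: the corners of a face carry the same disk, except that a triangular face may
carry a chain of disks at one corner, whose ends are the disks at the other two corners. -/
structure Admissible (M : CombMap D) (C : D → List B) : Prop where
  ne_nil : ∀ d, C d ≠ []
  nodup : ∀ d, (C d).Nodup
  face : ∀ b d e, b ∈ C d → b ∈ C e → M.facePerm.SameCycle d e
  const : ∀ d, ¬ 2 ≤ (C d).length → ¬ 2 ≤ (C (M.facePerm d)).length →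
    ¬ 2 ≤ (C (M.facePerm (M.facePerm d))).length → C (M.facePerm (M.facePerm d)) = C (M.facePerm d)
  chain : ∀ d, 2 ≤ (C d).length → M.AdmissibleAt C d

/-- The pairs of labels whose disks are tangent. -/
def Touch (M : CombMap D) (C : D → List B) (b b' : B) : Prop :=
  (∃ e, [b, b'] <:+: C e ++ C (M.vertexPerm e)) ∨
    ∃ d, 2 ≤ (C d).length ∧ b ∈ C d ∧ b' ∈ C (M.vertexPerm (M.facePerm d))

/-- The disks of three labels are mutually tangent, and all other disks lie on one side of the
orthogonal circle. -/
def EmptyTriangle (C : D → List B) (v : B → OCircle) (b₁ b₂ b₃ : B) : Prop :=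
  ∃ n, Frame (v b₁) (v b₂) (v b₃) n ∧ ∀ d, ∀ b ∈ C d, inn n (v b) ≤ 0

/-- The disks around a vertex form the image of a standard ring. -/
def RingAt (M : CombMap D) (C : D → List B) (v : B → OCircle) (d : D) : Prop :=
  ∃ N, 3 ≤ N ∧ ∃ (h : SL(2, ℂ)) (P : B → ZMod N), ∀ e, M.vertexPerm.SameCycle d e →
    (∀ b ∈ C e, v b = pull h (rd N (P b))) ∧
      (C e ++ C (M.vertexPerm e)).IsChain (fun b b' => P b' = P b + 1)

/-- The disks `v` realize the labelled map. -/
structure Realizes (M : CombMap D) (C : D → List B) (v : B → OCircle) : Prop where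
  norm : ∀ d, ∀ b ∈ C d, inn (v b) (v b) = 1
  sep : ∀ d d', ∀ b ∈ C d, ∀ b' ∈ C d', b ≠ b' → inn (v b) (v b') ≤ -1
  touch : ∀ d d', ∀ b ∈ C d, ∀ b' ∈ C d', b ≠ b' → inn (v b) (v b') = -1 →
    M.Touch C b b' ∨ M.Touch C b' b
  ring : ∀ d, M.RingAt C v d
  vertex : ∀ d b₁ b₂ b₃, M.vertexPerm (M.vertexPerm (M.vertexPerm d)) = d → C d = [b₁] →
    C (M.vertexPerm d) = [b₂] → C (M.vertexPerm (M.vertexPerm d)) = [b₃] →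
    EmptyTriangle C v b₁ b₂ b₃
  fan : ∀ d b b' y, 2 ≤ (C d).length → [b, b'] <:+: C d → y ∈ C (M.vertexPerm (M.facePerm d)) →
    EmptyTriangle C v b' b y

theorem EmptyTriangle.rot {C : D → List B} {v : B → OCircle} {b₁ b₂ b₃ : B}
    (h : EmptyTriangle C v b₁ b₂ b₃) : EmptyTriangle C v b₂ b₃ b₁ := by
  obtain ⟨n, h1, h2⟩ := h
  exact ⟨n, h1.rot, h2⟩

namespace Admissible

variable {M : CombMap D} {C : D → List B} {d x : D}

theorem exists_eq_singleton (A : M.Admissible C) (h : ¬ 2 ≤ (C d).length) : ∃ b, C d = [b] := by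
  have h1 := List.length_pos_iff.2 (A.ne_nil d)
  exact List.length_eq_one_iff.1 (by omega)

theorem not_fst (A : M.Admissible C) (h : 2 ≤ (C d).length) :
    ¬ 2 ≤ (C (M.facePerm d)).length := by
  rw [(A.chain d h).last]
  cases (C d).getLast? <;> simp

theorem not_snd (A : M.Admissible C) (h : 2 ≤ (C d).length) :
    ¬ 2 ≤ (C (M.facePerm (M.facePerm d))).length := by
  rw [(A.chain d h).head]
  cases (C d).head? <;> simp

/-- For a chain of length one this is the constancy of the label, since its head and its last entry
coincide. -/
theorem ends (A : M.Admissible C) (h3 : M.facePerm (M.facePerm (M.facePerm d)) = d)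
    (h1 : ¬ 2 ≤ (C (M.facePerm d)).length) (h2 : ¬ 2 ≤ (C (M.facePerm (M.facePerm d))).length) :
    C (M.facePerm d) = (C d).getLast?.toList ∧
      C (M.facePerm (M.facePerm d)) = (C d).head?.toList := by
  by_cases hd : 2 ≤ (C d).length
  · exact ⟨(A.chain d hd).last, (A.chain d hd).head⟩
  · have e1 := A.const (M.facePerm (M.facePerm d)) h2 (by rwa [h3]) (by rwa [h3])
    have e2 := A.const d hd h1 h2
    rw [h3] at e1
    obtain ⟨b, hb⟩ := A.exists_eq_singleton hd
    rw [e2, e1, hb]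
    exact ⟨rfl, rfl⟩

/-- Chains occur in triangles only, so in any other face `const` propagates the single label around
the whole cycle. -/
theorem const_of_not_tri (A : M.Admissible C) (h3 : M.facePerm (M.facePerm (M.facePerm d)) ≠ d)
    (hx : M.facePerm.SameCycle d x) : ¬ 2 ≤ (C x).length ∧ C x = C d := by
  classical
  have h1 : ∀ x, M.facePerm.SameCycle d x → ¬ 2 ≤ (C x).length := fun x hx hw =>
    h3 (pow_three_of_sameCycle hx.symm (A.chain x hw).tri)
  refine ⟨h1 x hx, ?_⟩
  have := invariants_sameCycle (π := M.facePerm)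
    (f := fun x => if M.facePerm.SameCycle d x then C x else []) (fun x => by
      by_cases hx : M.facePerm.SameCycle d x
      · rw [if_pos hx, if_pos (hx.trans (sameCycle_apply_self _ _))]
        obtain ⟨z, rfl⟩ := M.facePerm.surjective x
        have hz := hx.trans (sameCycle_apply_self M.facePerm z).symm
        exact A.const z (h1 _ hz) (h1 _ hx) (h1 _ (hx.trans (sameCycle_apply_self _ _)))
      · rw [if_neg hx, if_neg]
        exact fun h => hx (h.trans (sameCycle_apply_self _ _).symm)) hx
  rw [if_pos (Equiv.Perm.SameCycle.refl _ _), if_pos hx] at this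
  exact this.symm

end Admissible

section Suppress

variable {V : Type u} {G : SimpleGraph V} {M : CombMap D} {o : D → V} {C : D → List B}
  {e u w v f : D}

open Classical in
/-- The labels after suppressing the middle vertex of a fan. -/
noncomputable def suppressLabel (M : CombMap D) (C : D → List B) (e u w v : D)
    (x : {x // M.OffMiddle u w v x}) : List B :=
  if (x : D) = M.edgePerm e then C (M.edgePerm w) ++ C (M.edgePerm e) else C x

theorem suppressLabel_self {x : {x // M.OffMiddle u w v x}} (h : (x : D) = M.edgePerm e) :
    suppressLabel M C e u w v x = C (M.edgePerm w) ++ C (M.edgePerm e) := if_pos h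

theorem suppressLabel_of_ne {x : {x // M.OffMiddle u w v x}} (h : (x : D) ≠ M.edgePerm e) :
    suppressLabel M C e u w v x = C x := if_neg h

/-- The labels around a fan. -/
structure FanLabels (M : CombMap D) (C : D → List B) (e u w v f : D) : Prop where
  apex : ∀ x, M.vertexPerm.SameCycle f x → M.vertexPerm (M.vertexPerm (M.vertexPerm x)) ≠ x
  single_e : ¬ 2 ≤ (C e).length
  single_u : ¬ 2 ≤ (C u).length
  single_w : ¬ 2 ≤ (C w).length
  single_v : ¬ 2 ≤ (C v).length
  single_ef : ¬ 2 ≤ (C (M.edgePerm f)).length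
  single_rf : ¬ 2 ≤ (C (M.vertexPerm (M.edgePerm f))).length
  outer : ∀ x, M.facePerm.SameCycle (M.edgePerm v) x →
    ¬ 2 ≤ (C x).length ∧ C x = C (M.edgePerm v)
  eq_u : C u = (C (M.edgePerm e)).getLast?.toList
  eq_w : C w = (C (M.edgePerm e)).head?.toList
  eq_v : C v = (C (M.edgePerm w)).getLast?.toList
  eq_f : C (M.edgePerm f) = (C (M.edgePerm w)).head?.toList

/-- A chain at any of these corners would require degree three at the apex, which `fan_apex`
excludes. The face beyond the path is no triangle and carries a single label. -/
theorem Admissible.fanLabels (A : M.Admissible C) (E : Emb G M o) (hG : G.ThreeConnected)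
    (hc : IsD3bConfig G (o e) (o w) (o (M.edgePerm f)) (o f)) (h : M.Fan e u w v f) :
    FanLabels M C e u w v f := by
  have hs : ∀ x, M.vertexPerm.SameCycle f x → M.vertexPerm (M.vertexPerm (M.vertexPerm x)) ≠ x := by
    intro x hx h3
    have := pow_three_of_sameCycle hx.symm h3
    rw [h.sf, h.sw] at this
    exact E.fan_apex hG hc h this
  obtain ⟨p1, p2, p3, p4, p5, p6, p7, p8⟩ := h.facePerm
  have se : M.vertexPerm.SameCycle f (M.edgePerm w) := h.sf ▸ sameCycle_apply_self M.vertexPerm f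
  have sf : M.vertexPerm.SameCycle f (M.edgePerm e) :=
    se.trans (h.sw ▸ sameCycle_apply_self M.vertexPerm _)
  have nu : ¬ 2 ≤ (C u).length := fun hw => hs _ sf (by
    have := (A.chain _ hw).deg_snd; rwa [p1, p2] at this)
  have nw : ¬ 2 ≤ (C w).length := fun hw => hs _ sf (by
    have := (A.chain _ hw).deg_fst; rwa [p2] at this)
  have nv : ¬ 2 ≤ (C v).length := fun hw => hs _ se (by
    have := (A.chain _ hw).deg_snd; rwa [p5, p6] at this)
  have nf : ¬ 2 ≤ (C (M.edgePerm f)).length := fun hw => hs _ se (by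
    have := (A.chain _ hw).deg_fst; rwa [p6] at this)
  have h1 := A.ends (d := M.edgePerm e) (by rw [p3, p1, p2]) (by rwa [p3]) (by rwa [p3, p1])
  have h2 := A.ends (d := M.edgePerm w) (by rw [p4, p5, p6]) (by rwa [p4]) (by rwa [p4, p5])
  rw [p3, p1] at h1
  rw [p4, p5] at h2
  refine ⟨hs, fun hw => ?_, nu, nw, nv, nf, fun hw => ?_, fun x hx =>
    A.const_of_not_tri (E.not_triangle_of_middle hc h (Equiv.Perm.SameCycle.refl _ _)) hx,
    h1.1, h1.2, h2.1, h2.2⟩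
  · exact hs _ (sf.trans (sameCycle_apply_self _ _)) (A.chain _ hw).deg_fst
  · have e1 : M.facePerm f = M.vertexPerm (M.edgePerm f) := rfl
    have e2 : M.facePerm (M.facePerm (M.vertexPerm (M.edgePerm f))) = f := by
      apply M.facePerm.injective
      rw [(A.chain _ hw).tri, e1]
    have := (A.chain _ hw).deg_snd
    rw [e2] at this
    exact hs f (Equiv.Perm.SameCycle.refl _ _) this

end Suppress

end CombMap

/-! ### Labels after suppressing the middle of a fan -/

namespace CombMap

open OCircle

variable {D B V : Type u} {G : SimpleGraph V} {M : CombMap D} {o : D → V} {C : D → List B}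
  {e u w v f : D}

/-- The only corners of the fan's faces that may carry a chain are the two at the apex, so the face
of any other chain is unaffected by the suppression. -/
theorem FanLabels.away (F : FanLabels M C e u w v f) (h : M.Fan e u w v f) {d : D}
    (hd : 2 ≤ (C d).length) (h1 : d ≠ M.edgePerm e) (h2 : d ≠ M.edgePerm w) {x : D}
    (hx : M.facePerm.SameCycle d x) : (x ≠ u ∧ x ≠ w ∧ x ≠ M.edgePerm e) ∧
      (x ≠ v ∧ x ≠ M.edgePerm f ∧ x ≠ M.edgePerm w) ∧ x ≠ M.edgePerm v ∧ x ≠ M.edgePerm u := by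
  obtain ⟨p1, p2, p3, p4, p5, p6, p7, p8⟩ := h.facePerm
  have sc := fun y => sameCycle_apply_self M.facePerm y
  have k1 : ¬ M.facePerm.SameCycle (M.edgePerm e) d := by
    intro hc
    rcases sameCycle_of_three (by rw [p3, p1, p2]) hc with rfl | rfl | rfl
    · exact h1 rfl
    · rw [p3] at hd; exact F.single_u hd
    · rw [p3, p1] at hd; exact F.single_w hd
  have k2 : ¬ M.facePerm.SameCycle (M.edgePerm w) d := by
    intro hc
    rcases sameCycle_of_three (by rw [p4, p5, p6]) hc with rfl | rfl | rfl
    · exact h2 rfl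
    · rw [p4] at hd; exact F.single_v hd
    · rw [p4, p5] at hd; exact F.single_ef hd
  have k3 : ¬ M.facePerm.SameCycle (M.edgePerm v) d := fun hc => (F.outer d hc).1 hd
  have q1 := sc (M.edgePerm e)
  have q2 := sc w
  have q3 := sc (M.edgePerm w)
  have q4 := sc (M.edgePerm f)
  have q5 := sc (M.edgePerm v)
  rw [p3] at q1
  rw [p2] at q2
  rw [p4] at q3
  rw [p6] at q4
  rw [p7] at q5
  refine ⟨⟨?_, ?_, ?_⟩, ⟨?_, ?_, ?_⟩, ?_, ?_⟩ <;> rintro rfl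
  exacts [k1 (q1.trans hx.symm), k1 (q2.symm.trans hx.symm), k1 hx.symm, k2 (q3.trans hx.symm),
    k2 (q4.symm.trans hx.symm), k2 hx.symm, k3 hx.symm, k3 (q5.trans hx.symm)]

theorem getLast?_append_toList {α : Type*} {l₁ l₂ : List α} (h : l₂ ≠ []) :
    (l₁ ++ l₂).getLast?.toList = l₂.getLast?.toList := by
  rw [List.getLast?_append_of_ne_nil _ h]

theorem head?_append_toList {α : Type*} {l₁ l₂ : List α} (h : l₁ ≠ []) :
    (l₁ ++ l₂).head?.toList = l₁.head?.toList := by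
  rw [List.head?_append_of_ne_nil _ h]

section

variable [Finite D] (E : Emb G M o) (J : M.Jordan) (hG : G.ThreeConnected)
  (A : M.Admissible C) (h : M.Fan e u w v f) (F : FanLabels M C e u w v f)

include E J hG A h F

/-- The merged corner at the apex is where the concatenated chain sits. The other two vertices of
its face are `p` and `r`, which keep degree three, and `FanLabels` makes all labels near them
single. Any other chain lies in a face away from the fan. -/
theorem Admissible.suppress : (suppress h).Admissible (suppressLabel M C e u w v) := by
  obtain ⟨p1, p2, p3, p4, p5, p6, p7, p8⟩ := h.facePerm
  obtain ⟨oe, ou, of', oe', ov', of'', oup, ofp⟩ := h.off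
  obtain ⟨o1, o2, o3, o4, o5, o6⟩ := E.fan_o h
  have sc := fun y => sameCycle_apply_self M.facePerm y
  have hnd := h.nodup
  simp only [List.nodup_cons, List.mem_cons, List.not_mem_nil, or_false, not_or] at hnd
  have hmem : ∀ (b : B) (d : {x // M.OffMiddle u w v x}), b ∈ suppressLabel M C e u w v d →
      ∃ x : D, b ∈ C x ∧ (x = d ∨ (x = M.edgePerm w ∧ (d : D) = M.edgePerm e)) := by
    intro b d hb
    by_cases hd : (d : D) = M.edgePerm e
    · rw [suppressLabel_self hd, List.mem_append] at hb
      rcases hb with hb | hb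
      · exact ⟨_, hb, Or.inr ⟨rfl, hd⟩⟩
      · exact ⟨_, hb, Or.inl hd.symm⟩
    · rw [suppressLabel_of_ne hd] at hb
      exact ⟨_, hb, Or.inl rfl⟩
  have hlen : ∀ x : {x // M.OffMiddle u w v x}, (x : D) = M.edgePerm e →
      2 ≤ (suppressLabel M C e u w v x).length := by
    intro x hx
    rw [suppressLabel_self hx, List.length_append]
    have := List.length_pos_iff.2 (A.ne_nil (M.edgePerm w))
    have := List.length_pos_iff.2 (A.ne_nil (M.edgePerm e))
    omega
  refine ⟨fun d => ?_, fun d => ?_, fun b d d' hb hb' => ?_, fun d h1 h2 h3 => ?_, fun d hw => ?_⟩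
  · by_cases hd : (d : D) = M.edgePerm e
    · rw [suppressLabel_self hd]
      simp [A.ne_nil]
    · rw [suppressLabel_of_ne hd]
      exact A.ne_nil _
  · by_cases hd : (d : D) = M.edgePerm e
    · rw [suppressLabel_self hd]
      refine (A.nodup _).append (A.nodup _) fun b hb hb' => ?_
      -- A common label of the two chains would put both apex corners on one face, but a face meets
      -- a vertex only once.
      have := E.eq_of_sameCycle J hG (o5.trans o6.symm) (A.face b _ _ hb hb')
      grind
    · rw [suppressLabel_of_ne hd]
      exact A.nodup _
  · obtain ⟨x, hx, hx'⟩ := hmem b d hb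
    obtain ⟨y, hy, hy'⟩ := hmem b d' hb'
    exact h.suppress_sameCycle_facePerm (A.face b x y hx hy) hx' hy'
  · have n1 : (d : D) ≠ M.edgePerm e := fun h => h1 (hlen d h)
    have n2 : ((CombMap.suppress h).facePerm d : D) ≠ M.edgePerm e := fun h => h2 (hlen _ h)
    have n3 : ((CombMap.suppress h).facePerm ((CombMap.suppress h).facePerm d) : D)
        ≠ M.edgePerm e :=
      fun h => h3 (hlen _ h)
    rw [suppressLabel_of_ne n1] at h1
    rw [suppressLabel_of_ne n2] at h2
    rw [suppressLabel_of_ne n3] at h3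
    rw [suppressLabel_of_ne n2, suppressLabel_of_ne n3]
    obtain ⟨x, hx⟩ : ∃ x, x = (CombMap.suppress h).facePerm d := ⟨_, rfl⟩
    rw [← hx] at h2 h3 n2 n3 ⊢
    rw [suppress_facePerm] at h3 n3 ⊢
    by_cases x1 : (x : D) = u
    · exfalso
      apply n1
      have : (CombMap.suppress h).facePerm ⟨_, oe'⟩ = x := by
        apply Subtype.ext
        rw [suppress_facePerm, suppress_face_of_ne, p3, x1] <;> grind
      exact (congrArg Subtype.val ((CombMap.suppress h).facePerm.injective (this.trans hx))).symm
    by_cases x2 : (x : D) = M.edgePerm f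
    · exact (n3 (by rw [x2, h.face_f])).elim
    by_cases x3 : (x : D) = M.edgePerm v
    · rw [x3, h.face_v, ← p8, ← p7]
      exact (F.outer _ ((sc _).trans (sc _))).2
    rw [suppress_face_of_ne x1 x3 x2] at h3 n3 ⊢
    have hx' := congrArg Subtype.val hx
    rw [suppress_facePerm] at hx'
    by_cases d1 : (d : D) = u
    · rw [d1, h.face_u] at hx'; exact (x2 hx').elim
    by_cases d2 : (d : D) = M.edgePerm f
    · rw [d2, h.face_f] at hx'; exact (n2 hx').elim
    by_cases d3 : (d : D) = M.edgePerm v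
    · rw [d3, h.face_v, ← p8, ← p7] at hx'
      rw [hx', (F.outer _ ((sc _).trans (sc _))).2,
          (F.outer _ (((sc _).trans (sc _)).trans (sc _))).2]
    rw [suppress_face_of_ne d1 d3 d2] at hx'
    rw [hx'] at h2 h3 ⊢
    exact A.const d h1 h2 h3
  have lab : ∀ x, (hx : M.OffMiddle u w v x) → x ≠ M.edgePerm e →
      suppressLabel M C e u w v ⟨x, hx⟩ = C x := fun x hx h => suppressLabel_of_ne h
  by_cases hd : (d : D) = M.edgePerm e
  · obtain rfl : d = ⟨_, oe'⟩ := Subtype.ext hd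
    have q1 : (CombMap.suppress h).facePerm ⟨_, oe'⟩ = ⟨_, ou⟩ := Subtype.ext (by
      rw [suppress_facePerm, suppress_face_of_ne, p3] <;> grind)
    have q2 : (CombMap.suppress h).facePerm ⟨_, ou⟩ = ⟨_, of''⟩ := Subtype.ext h.face_u
    have q3 : (CombMap.suppress h).facePerm ⟨_, of''⟩ = ⟨_, oe'⟩ := Subtype.ext h.face_f
    have r1 : (CombMap.suppress h).vertexPerm ⟨_, ou⟩ = ⟨_, oup⟩ := Subtype.ext (by
      rw [suppress_vertexPerm, suppressNext_of_ne]; grind)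
    have r2 : (CombMap.suppress h).vertexPerm ⟨_, oup⟩ = ⟨_, oe⟩ := Subtype.ext (by
      rw [suppress_vertexPerm, suppressNext_of_ne, h.pu]; grind)
    have r3 : (CombMap.suppress h).vertexPerm ⟨_, oe⟩ = ⟨_, ou⟩ := Subtype.ext (by
      rw [suppress_vertexPerm, suppressNext_of_ne, h.pe]; grind)
    have s1 : (CombMap.suppress h).vertexPerm ⟨_, of''⟩ = ⟨_, ofp⟩ := Subtype.ext (by
      rw [suppress_vertexPerm, suppressNext_of_ne]; grind)
    have s2 : (CombMap.suppress h).vertexPerm ⟨_, ofp⟩ = ⟨_, ov'⟩ := Subtype.ext (by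
      rw [suppress_vertexPerm, suppressNext_of_ne, h.rf]; grind)
    have s3 : (CombMap.suppress h).vertexPerm ⟨_, ov'⟩ = ⟨_, of''⟩ := Subtype.ext (by
      rw [suppress_vertexPerm, suppressNext_of_ne, h.rv]; grind)
    have t1 : ((CombMap.suppress h).facePerm ⟨_, oup⟩ : D) = M.facePerm (M.vertexPerm u) := by
      rw [suppress_facePerm, suppress_face_of_ne] <;> grind
    have y1 : M.facePerm.SameCycle (M.edgePerm v) (M.vertexPerm u) := by
      rw [← p8, ← p7]; exact (sc _).trans (sc _)
    refine ⟨?_, ?_, ?_, ?_, ?_, ?_, ?_, ?_, ?_, ?_⟩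
    · rw [q1, q2, q3]
    · rw [q1, r1, r2, r3]
    · rw [q1, q2, s1, s2, s3]
    · rw [q1, lab _ ou (by grind), suppressLabel_self rfl, F.eq_u,
        getLast?_append_toList (A.ne_nil _)]
    · rw [q1, q2, lab _ of'' (by grind), suppressLabel_self rfl, F.eq_f,
        head?_append_toList (A.ne_nil _)]
    · rw [q1, r1, lab _ oup (by grind)]
      exact (F.outer _ y1).1
    · rw [q1, r1, r2, lab _ oe (by grind)]
      exact F.single_e
    · rw [q1, q2, s1, lab _ ofp (by grind)]
      exact F.single_rf
    · rw [q1, q2, s1, s2, lab _ ov' (by grind)]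
      exact (F.outer _ (Equiv.Perm.SameCycle.refl _ _)).1
    · rw [q1, r1, suppressLabel_of_ne, t1]
      · exact (F.outer _ (y1.trans (sc _))).1
      · rw [t1, ← p2]
        intro h'
        have := M.facePerm.injective h'
        grind
  · rw [suppressLabel_of_ne hd] at hw
    have hdw : (d : D) ≠ M.edgePerm w := fun h' => not_offMiddle_self.2.2.2 (h' ▸ d.2)
    have away := fun x hx => F.away h hw hd hdw (x := x) hx
    have Ad := A.chain _ hw
    have f1 : M.facePerm.SameCycle d (M.facePerm d) := sc _
    have f2 : M.facePerm.SameCycle d (M.facePerm (M.facePerm d)) := f1.trans (sc _)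
    have hf : ∀ x : {x // M.OffMiddle u w v x}, M.facePerm.SameCycle d x →
        ((CombMap.suppress h).facePerm x : D) = M.facePerm x := fun x hx => by
      have := away x hx
      rw [suppress_facePerm, suppress_face_of_ne this.1.1 this.2.2.1 this.2.1.2.1]
    have se : M.vertexPerm.SameCycle f (M.edgePerm e) := by
      rw [E.same, o6]
    have hσ : ∀ (x : {x // M.OffMiddle u w v x}) (X : D), (x : D) = X →
        ¬ M.vertexPerm.SameCycle f X → ((CombMap.suppress h).vertexPerm x : D) = M.vertexPerm X ∧
          suppressLabel M C e u w v x = C X ∧ ¬ M.vertexPerm.SameCycle f (M.vertexPerm X) := by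
      rintro x X rfl hX
      refine ⟨?_, ?_, fun h' => hX (h'.trans (sameCycle_apply_self _ _).symm)⟩
      · rw [suppress_vertexPerm, suppressNext_of_ne]
        intro h'
        exact hX (h' ▸ Equiv.Perm.SameCycle.refl _ _)
      · exact suppressLabel_of_ne (fun h' => hX (h' ▸ se))
    have a1 := hf d (Equiv.Perm.SameCycle.refl _ _)
    have a2 := hf ((CombMap.suppress h).facePerm d) (by rw [a1]; exact f1)
    rw [a1] at a2
    have a3 := hf _ (by rw [a2]; exact f2)
    rw [a2] at a3
    obtain ⟨b1, b2, b3⟩ := hσ _ _ a1 (fun h' => F.apex _ h' Ad.deg_fst)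
    obtain ⟨b4, b5, b6⟩ := hσ _ _ b1 b3
    obtain ⟨b7, b8, b9⟩ := hσ _ _ b4 b6
    obtain ⟨c1, c2, c3⟩ := hσ _ _ a2 (fun h' => F.apex _ h' Ad.deg_snd)
    obtain ⟨c4, c5, c6⟩ := hσ _ _ c1 c3
    obtain ⟨c7, c8, c9⟩ := hσ _ _ c4 c6
    refine ⟨?_, ?_, ?_, ?_, ?_, ?_, ?_, ?_, ?_, ?_⟩
    · exact Subtype.ext (a3.trans Ad.tri)
    · exact Subtype.ext (b7.trans (Ad.deg_fst.trans a1.symm))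
    · exact Subtype.ext (c7.trans (Ad.deg_snd.trans a2.symm))
    · rw [b2, suppressLabel_of_ne hd]; exact Ad.last
    · rw [c2, suppressLabel_of_ne hd]; exact Ad.head
    · rw [b5]; exact Ad.fst_one
    · rw [b8]; exact Ad.fst_two
    · rw [c5]; exact Ad.snd_one
    · rw [c8]; exact Ad.snd_two
    · obtain ⟨⟨g1, g2, g3⟩, ⟨g4, g5, g6⟩, g7, g8⟩ := away _ f1
      obtain ⟨z, hz⟩ : ∃ z, z = (CombMap.suppress h).vertexPerm ((CombMap.suppress h).facePerm d) :=
        ⟨_, rfl⟩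
      rw [← hz] at b1 b5 ⊢
      have z1 : (z : D) ≠ u := by
        rw [b1]
        intro h'
        have h'' := M.vertexPerm.injective (h'.trans h.pe.symm)
        apply F.apex _ (se.trans (sameCycle_apply_self _ _))
        rw [show M.vertexPerm (M.edgePerm e) = M.facePerm (M.facePerm d) by rw [h'']; rfl]
        exact Ad.deg_snd
      have z2 : (z : D) ≠ M.edgePerm f := by
        rw [b1, ← h.rv]
        exact fun h' => g7 (M.vertexPerm.injective h')
      by_cases z3 : (z : D) = M.edgePerm v
      · have : ((CombMap.suppress h).facePerm z : D) = M.vertexPerm u := by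
          rw [suppress_facePerm, z3, h.face_v]
        rw [suppressLabel_of_ne, this, ← p8, ← p7]
        · exact (F.outer _ ((sc _).trans (sc _))).1
        · rw [this]; grind
      · have : ((CombMap.suppress h).facePerm z : D) = M.facePerm z := by
          rw [suppress_facePerm, suppress_face_of_ne z1 z3 z2]
        rw [suppressLabel_of_ne, this, b1]
        · exact Ad.opposite
        · rw [this, b1]
          exact fun h' => g8 (M.vertexPerm.injective
            ((M.facePerm.injective (h'.trans p2.symm)).trans h.qu.symm))

end

end CombMap

/-- The middle list is nonempty, so two adjacent entries cannot reach from the first list to the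
third. -/
theorem List.pair_infix_append {α : Type*} {b b' : α} {l₁ l₂ l₃ : List α} (h2 : l₂ ≠ [])
    (h : [b, b'] <:+: l₁ ++ l₂ ++ l₃) : [b, b'] <:+: l₁ ++ l₂ ∨ [b, b'] <:+: l₂ ++ l₃ := by
  induction l₁ with
  | nil => exact Or.inr (by simpa using h)
  | cons a l ih =>
    simp only [List.cons_append, List.infix_cons_iff] at h
    rcases h with h | h
    · left
      refine List.IsPrefix.isInfix ?_
      rw [List.cons_append, List.cons_prefix_cons]
      rw [List.cons_prefix_cons] at h
      refine ⟨h.1, ?_⟩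
      have hne : l ++ l₂ ≠ [] := by simp [h2]
      obtain ⟨c, t, ht⟩ := List.exists_cons_of_ne_nil hne
      have h3 := h.2
      rw [ht] at h3 ⊢
      rw [List.cons_append, List.cons_prefix_cons] at h3
      rw [List.cons_prefix_cons]
      exact ⟨h3.1, List.nil_prefix⟩
    · rcases ih h with h | h
      · exact Or.inl (h.trans (List.suffix_cons _ _).isInfix)
      · exact Or.inr h

namespace OCircle

/-- Any gap can thus be moved onto any other; this puts a gap into standard position before a chain
is inserted. -/
theorem Frame.exists_pull {a b c n a' b' c' n' : OCircle} (h : Frame a b c n)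
    (h' : Frame a' b' c' n') :
    ∃ g : SL(2, ℂ), a = OCircle.pull g a' ∧ b = OCircle.pull g b' ∧ c = OCircle.pull g c' ∧
      n = OCircle.pull g n' := by
  obtain ⟨k, rfl, rfl, rfl, rfl⟩ := h
  obtain ⟨k', rfl, rfl, rfl, rfl⟩ := h'
  refine ⟨k'⁻¹ * k, ?_, ?_, ?_, ?_⟩ <;> rw [pull_mul, pull_pull_inv]

theorem Frame.ne {a b c n : OCircle} (h : Frame a b c n) : a ≠ b := by
  intro hab
  have h1 := h.inn_ab
  have h2 := h.inn_aa
  rw [← hab, h2] at h1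
  norm_num at h1

end OCircle

/-! ### Realizations of a suppressed map realize the original map -/

namespace CombMap

open OCircle

/-- Any three mutually tangent disks are a Möbius image of the regular ring of three, so the ring
condition at a vertex of degree three with single labels only requires a frame. -/
theorem ringAt_of_frame {D B : Type u} {M : CombMap D} {C : D → List B} {v : B → OCircle}
    {d x : D} {a b c : B} {n : OCircle} (h3 : M.vertexPerm (M.vertexPerm (M.vertexPerm x)) = x)
    (ha : C x = [a]) (hb : C (M.vertexPerm x) = [b])
    (hc : C (M.vertexPerm (M.vertexPerm x)) = [c]) (h : Frame (v a) (v b) (v c) n)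
    (hd : M.vertexPerm.SameCycle x d) : M.RingAt C v d := by
  classical
  obtain ⟨g, h1, h2, h4, -⟩ := h.exists_pull (frame_rd_three 0)
  have nab : a ≠ b := fun h' => h.ne (h' ▸ rfl)
  have nbc : b ≠ c := fun h' => h.rot.ne (h' ▸ rfl)
  have nca : c ≠ a := fun h' => h.rot.rot.ne (h' ▸ rfl)
  refine ⟨3, le_rfl, g, fun z => if z = a then 0 else if z = b then 1 else 2, fun e he => ?_⟩
  rcases sameCycle_of_three h3 (hd.trans he) with rfl | rfl | rfl
  · rw [ha, hb]
    simp [h1, nab.symm]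
  · rw [hb, hc]
    have : (0 : ZMod 3) + 1 = 1 := by decide
    have h5 : (2 : ZMod 3) = 1 + 1 := by decide
    simp [h2, nab.symm, nbc.symm, nca, h5]
  · rw [h3, hc, ha]
    have h5 : (2 : ZMod 3) = 0 + 1 + 1 := by decide
    have h6 : (0 : ZMod 3) = 2 + 1 := by decide
    simp only [List.mem_singleton, forall_eq, nca, nbc.symm, if_false, List.cons_append,
      List.nil_append, List.isChain_cons_cons, List.isChain_singleton, and_true, if_true]
    exact ⟨by rw [h4, h5], h6⟩

variable {D B V : Type u} {G : SimpleGraph V} {M : CombMap D} {o : D → V} {C : D → List B}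
  {e u w v f : D}

theorem Fan.step [Finite D] (h : M.Fan e u w v f)
    {x : {x // M.OffMiddle u w v x}} {X : D} (hx : (x : D) = X)
    (hX : ¬ M.vertexPerm.SameCycle f X) :
    ((CombMap.suppress h).vertexPerm x : D) = M.vertexPerm X ∧
      suppressLabel M C e u w v x = C X ∧ ¬ M.vertexPerm.SameCycle f (M.vertexPerm X) := by
  subst hx
  refine ⟨?_, ?_, fun h' => hX (h'.trans (sameCycle_apply_self _ _).symm)⟩
  · rw [suppress_vertexPerm, suppressNext_of_ne]
    intro h'
    exact hX (h' ▸ Equiv.Perm.SameCycle.refl _ _)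
  · refine suppressLabel_of_ne (fun h' => hX ?_)
    rw [h', ← h.sw, ← h.sf]
    exact (sameCycle_apply_self _ _).trans (sameCycle_apply_self _ _)

theorem FanLabels.face_step [Finite D] (F : FanLabels M C e u w v f) (h : M.Fan e u w v f)
    {d : {x // M.OffMiddle u w v x}} (hd : (d : D) ≠ M.edgePerm e) (hw : 2 ≤ (C d).length) :
    ((CombMap.suppress h).facePerm d : D) = M.facePerm d := by
  have hdw : (d : D) ≠ M.edgePerm w := fun h' => not_offMiddle_self.2.2.2 (h' ▸ d.2)
  have := F.away h hw hd hdw (Equiv.Perm.SameCycle.refl _ _)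
  rw [suppress_facePerm, suppress_face_of_ne this.1.1 this.2.2.1 this.2.1.2.1]

section

variable {vv : B → OCircle} (h : M.Fan e u w v f) (F : FanLabels M C e u w v f)

include h F

/-- No disk is lost by the suppression: the deleted corners repeat labels of the merged chain or of
the face beyond the path. Hence a gap that is empty for the reduced map is empty for `M`. -/
theorem FanLabels.cover {b : B} {x : D} (hb : b ∈ C x) :
    ∃ d, b ∈ suppressLabel M C e u w v d := by
  have oe' := h.off.2.2.2.1
  have ov' := h.off.2.2.2.2.1
  have hnd := h.nodup
  simp only [List.nodup_cons, List.mem_cons, List.not_mem_nil, or_false, not_or] at hnd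
  have he : ∀ b, b ∈ C (M.edgePerm w) ∨ b ∈ C (M.edgePerm e) →
      b ∈ suppressLabel M C e u w v ⟨_, oe'⟩ := by
    intro b hb
    rw [suppressLabel_self rfl, List.mem_append]
    exact hb
  by_cases hx : M.OffMiddle u w v x
  · by_cases hxe : x = M.edgePerm e
    · exact ⟨⟨_, oe'⟩, he b (Or.inr (hxe ▸ hb))⟩
    · exact ⟨⟨x, hx⟩, by rwa [suppressLabel_of_ne hxe]⟩
  · rcases not_offMiddle.1 hx with rfl | rfl | rfl | rfl
    · rw [F.eq_w, Option.mem_toList] at hb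
      exact ⟨⟨_, oe'⟩, he b (Or.inr (List.mem_of_mem_head? hb))⟩
    · rw [F.eq_v, Option.mem_toList] at hb
      exact ⟨⟨_, oe'⟩, he b (Or.inl (List.mem_of_getLast? hb))⟩
    · have h1 := sameCycle_apply_self M.facePerm (M.edgePerm v)
      rw [h.facePerm.2.2.2.2.2.2.1] at h1
      rw [(F.outer _ h1).2] at hb
      refine ⟨⟨_, ov'⟩, ?_⟩
      rw [suppressLabel_of_ne]
      · exact hb
      · show M.edgePerm v ≠ M.edgePerm e
        grind
    · exact ⟨⟨_, oe'⟩, he b (Or.inl hb)⟩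

theorem FanLabels.emptyTriangle {b₁ b₂ b₃ : B}
    (hE : EmptyTriangle (suppressLabel M C e u w v) vv b₁ b₂ b₃) : EmptyTriangle C vv b₁ b₂ b₃ := by
  obtain ⟨n, h1, h2⟩ := hE
  refine ⟨n, h1, fun d b hb => ?_⟩
  obtain ⟨d', hd'⟩ := F.cover h hb
  exact h2 d' b hd'

theorem FanLabels.outer_eq : C (M.vertexPerm u) = C (M.edgePerm v) ∧
    C (M.edgePerm u) = C (M.edgePerm v) ∧ ¬ 2 ≤ (C (M.edgePerm v)).length := by
  obtain ⟨p1, p2, p3, p4, p5, p6, p7, p8⟩ := h.facePerm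
  have sc := fun y => sameCycle_apply_self M.facePerm y
  refine ⟨?_, ?_, (F.outer _ (Equiv.Perm.SameCycle.refl _ _)).1⟩
  · rw [← p8, ← p7]
    exact (F.outer _ ((sc _).trans (sc _))).2
  · rw [← p7]
    exact (F.outer _ (sc _)).2

variable [Finite D]

theorem FanLabels.merged_target {y : B} (hy : y ∈ C (M.edgePerm v)) :
    y ∈ suppressLabel M C e u w v ((CombMap.suppress h).vertexPerm
      ((CombMap.suppress h).facePerm ⟨_, h.off.2.2.2.1⟩)) := by
  have hnd := h.nodup
  simp only [List.nodup_cons, List.mem_cons, List.not_mem_nil, or_false, not_or] at hnd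
  have : ((CombMap.suppress h).vertexPerm ((CombMap.suppress h).facePerm ⟨_, h.off.2.2.2.1⟩) : D) =
      M.vertexPerm u := by
    rw [suppress_vertexPerm, suppress_facePerm, suppress_face_of_ne, h.facePerm.2.2.1,
      suppressNext_of_ne] <;> grind
  rw [suppressLabel_of_ne, this, (F.outer_eq h).1]
  · exact hy
  · rw [this]; grind

variable (A : M.Admissible C)

include A

/-- The last disk of the first chain and the first disk of the second are consecutive where the
chains join. Together with the disk beyond the path they bound the gap of the middle vertex, which
is empty by `Realizes.fan`. -/
theorem FanLabels.middle (R : Realizes (CombMap.suppress h) (suppressLabel M C e u w v) vv) :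
    ∃ x y z, C w = [x] ∧ C v = [y] ∧ C (M.edgePerm u) = [z] ∧ EmptyTriangle C vv x y z := by
  obtain ⟨x, hx⟩ := A.exists_eq_singleton F.single_w
  obtain ⟨y, hy⟩ := A.exists_eq_singleton F.single_v
  obtain ⟨-, h2, h3⟩ := F.outer_eq h
  obtain ⟨z, hz⟩ := A.exists_eq_singleton h3
  refine ⟨x, y, z, hx, hy, h2.trans hz, ?_⟩
  have e1 := F.eq_w
  have e2 := F.eq_v
  rw [hx] at e1
  rw [hy] at e2
  obtain ⟨l, hl⟩ : ∃ l, C (M.edgePerm e) = x :: l := by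
    cases hc : C (M.edgePerm e) with
    | nil => exact (A.ne_nil _ hc).elim
    | cons a l => rw [hc] at e1; simp at e1; exact ⟨l, by rw [e1]⟩
  obtain ⟨l', hl'⟩ : ∃ l, C (M.edgePerm w) = l ++ [y] := by
    rcases List.eq_nil_or_concat (C (M.edgePerm w)) with hc | ⟨l, a, hc⟩
    · exact (A.ne_nil _ hc).elim
    · rw [hc] at e2; simp at e2; exact ⟨l, by rw [hc, e2, List.concat_eq_append]⟩
  have hs : suppressLabel M C e u w v ⟨_, h.off.2.2.2.1⟩ = (l' ++ [y]) ++ x :: l := by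
    rw [suppressLabel_self rfl, hl, hl']
  apply F.emptyTriangle h
  apply R.fan ⟨_, h.off.2.2.2.1⟩
  · rw [hs]; simp; omega
  · rw [hs]
    exact ⟨l', l, by simp⟩
  · apply F.merged_target h
    rw [hz]; simp

variable (E : Emb G M o)

include E

/-- The same disks work. Contacts and gaps of the merged chain restrict to its two parts, and only
the ring and the gap at the middle vertex are new; `FanLabels.middle` supplies both. -/
theorem Realizes.of_suppress (R : Realizes (CombMap.suppress h) (suppressLabel M C e u w v) vv) :
    Realizes M C vv := by
  obtain ⟨o1, o2, o3, o4, o5, o6⟩ := E.fan_o h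
  have oe' := h.off.2.2.2.1
  have hnd := h.nodup
  simp only [List.nodup_cons, List.mem_cons, List.not_mem_nil, or_false, not_or] at hnd
  obtain ⟨p1, p2, p3, p4, p5, p6, p7, p8⟩ := h.facePerm
  obtain ⟨y1, y2, y3⟩ := F.outer_eq h
  have lab_next : ∀ x : {x // M.OffMiddle u w v x}, (x : D) ≠ f →
      suppressLabel M C e u w v ((CombMap.suppress h).vertexPerm x) = C (M.vertexPerm x) := by
    intro x hx
    have h1 : ((CombMap.suppress h).vertexPerm x : D) = M.vertexPerm x := by
      rw [suppress_vertexPerm, suppressNext_of_ne hx]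
    rw [suppressLabel_of_ne, h1]
    rw [h1]
    exact fun h' => not_offMiddle_self.2.2.2
      (M.vertexPerm.injective (h'.trans h.sw.symm) ▸ x.2)
  have lab_f : ∀ x : {x // M.OffMiddle u w v x}, (x : D) = f →
      suppressLabel M C e u w v ((CombMap.suppress h).vertexPerm x) =
        C (M.edgePerm w) ++ C (M.edgePerm e) := by
    intro x hx
    apply suppressLabel_self
    rw [suppress_vertexPerm, hx, suppressNext_self]
  have touch : ∀ b b', (CombMap.suppress h).Touch (suppressLabel M C e u w v) b b' →
      M.Touch C b b' := by
    rintro b b' (⟨x, hx⟩ | ⟨d, hd, hb, hb'⟩)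
    · by_cases hxe : (x : D) = M.edgePerm e
      · rw [suppressLabel_self hxe, lab_next x (by rw [hxe]; grind), hxe] at hx
        rcases List.pair_infix_append (A.ne_nil _) hx with hx | hx
        · exact Or.inl ⟨M.edgePerm w, by rwa [h.sw]⟩
        · exact Or.inl ⟨M.edgePerm e, hx⟩
      rw [suppressLabel_of_ne hxe] at hx
      by_cases hxf : (x : D) = f
      · rw [lab_f x hxf, hxf, ← List.append_assoc] at hx
        rcases List.pair_infix_append (A.ne_nil _) hx with hx | hx
        · exact Or.inl ⟨f, by rwa [h.sf]⟩
        · exact Or.inl ⟨M.edgePerm w, by rwa [h.sw]⟩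
      · rw [lab_next x hxf] at hx
        exact Or.inl ⟨x, hx⟩
    · by_cases hde : (d : D) = M.edgePerm e
      · have hfd : ((CombMap.suppress h).facePerm d : D) = u := by
          rw [suppress_facePerm, hde, suppress_face_of_ne, p3] <;> grind
        rw [lab_next _ (by rw [hfd]; grind), hfd, y1] at hb'
        rw [suppressLabel_self hde, List.mem_append] at hb
        obtain ⟨y, hy⟩ := A.exists_eq_singleton y3
        obtain rfl : b' = y := by rw [hy] at hb'; simpa using hb'
        rcases hb with hb | hb
        · by_cases hw : 2 ≤ (C (M.edgePerm w)).length
          · exact Or.inr ⟨_, hw, hb, by rwa [p4, h.qv, y2]⟩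
          · obtain ⟨x, hx⟩ := A.exists_eq_singleton hw
            have ev := F.eq_v
            rw [hx] at hb ev
            obtain rfl : b = x := by simpa using hb
            exact Or.inl ⟨v, by rw [ev, h.qv, y2, hy]; simp⟩
        · by_cases hw : 2 ≤ (C (M.edgePerm e)).length
          · exact Or.inr ⟨_, hw, hb, by rwa [p3, y1]⟩
          · obtain ⟨x, hx⟩ := A.exists_eq_singleton hw
            have eu := F.eq_u
            rw [hx] at hb eu
            obtain rfl : b = x := by simpa using hb
            exact Or.inl ⟨u, by rw [eu, y1, hy]; simp⟩
      · rw [suppressLabel_of_ne hde] at hd hb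
        have h1 := F.face_step h hde hd
        have h2 := h.step (C := C) h1 (fun h' => F.apex _ h' (A.chain _ hd).deg_fst)
        have h3 := h.step (C := C) h2.1 h2.2.2
        rw [h3.2.1] at hb'
        exact Or.inr ⟨d, hd, hb, hb'⟩
  have hmid := F.middle h A R
  refine ⟨fun d b hb => ?_, fun d d' b hb b' hb' hne => ?_, fun d d' b hb b' hb' hne h1 => ?_,
    fun d => ?_, fun d b₁ b₂ b₃ h3 h1 h2 h4 => ?_, fun d b b' y hd hbb hy => ?_⟩
  · obtain ⟨x, hx⟩ := F.cover h hb
    exact R.norm x b hx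
  · obtain ⟨x, hx⟩ := F.cover h hb
    obtain ⟨x', hx'⟩ := F.cover h hb'
    exact R.sep x x' b hx b' hx' hne
  · obtain ⟨x, hx⟩ := F.cover h hb
    obtain ⟨x', hx'⟩ := F.cover h hb'
    exact (R.touch x x' b hx b' hx' hne h1).imp (touch _ _) (touch _ _)
  · by_cases hdw : o d = o w
    · obtain ⟨x, y, z, hx, hy, hz, n, hn, -⟩ := hmid
      exact ringAt_of_frame (x := w) (by rw [h.qw, h.qv, h.qu]) hx (by rw [h.qw, hy])
        (by rw [h.qw, h.qv, hz]) hn ((E.same _ _).2 hdw.symm)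
    · obtain ⟨d', hd'⟩ : ∃ d' : {x // M.OffMiddle u w v x}, o d' = o d := by
        by_cases hd : M.OffMiddle u w v d
        · exact ⟨⟨d, hd⟩, rfl⟩
        · rcases not_offMiddle.1 hd with rfl | rfl | rfl | rfl
          exacts [(hdw rfl).elim, (hdw o3).elim, (hdw o2).elim, ⟨⟨_, oe'⟩, o6.trans o5.symm⟩]
      -- The ring in the reduced map serves unchanged. At the apex the merged list is cut back into
      -- its two corners, and a piece of a chain is a chain.
      obtain ⟨N, hN, g, P, hP⟩ := R.ring d'
      refine ⟨N, hN, g, P, fun x hx => ?_⟩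
      have hox : o x = o d' := by rw [hd', (E.same _ _).1 hx]
      by_cases hxo : M.OffMiddle u w v x
      · obtain ⟨h1, h2⟩ := hP ⟨x, hxo⟩ (h.suppress_sameCycle ((E.same _ _).2 hox.symm))
        by_cases hxe : x = M.edgePerm e
        · rw [suppressLabel_self hxe] at h1 h2
          rw [lab_next _ (by show x ≠ f; rw [hxe]; grind)] at h2
          refine ⟨fun b hb => h1 b (List.mem_append.2 (Or.inr (hxe ▸ hb))), ?_⟩
          subst hxe
          rw [List.append_assoc] at h2
          exact h2.right_of_append
        · rw [suppressLabel_of_ne hxe] at h1 h2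
          refine ⟨h1, ?_⟩
          by_cases hxf : x = f
          · rw [lab_f _ hxf, ← List.append_assoc] at h2
            subst hxf
            rw [h.sf]
            exact h2.left_of_append
          · rw [lab_next _ hxf] at h2
            exact h2
      · rcases not_offMiddle.1 hxo with rfl | rfl | rfl | rfl
        · exact (hdw (hd' ▸ hox.symm)).elim
        · exact (hdw (hd' ▸ hox.symm.trans o3)).elim
        · exact (hdw (hd' ▸ hox.symm.trans o2)).elim
        · obtain ⟨h1, h2⟩ := hP ⟨_, oe'⟩ (h.suppress_sameCycle ((E.same _ _).2
            (hox.symm.trans (o5.trans o6.symm))))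
          rw [suppressLabel_self rfl] at h1 h2
          refine ⟨fun b hb => h1 b (List.mem_append.2 (Or.inl hb)), ?_⟩
          rw [h.sw]
          exact h2.left_of_append
  · by_cases hdw : o d = o w
    · obtain ⟨x, y, z, hx, hy, hz, hE⟩ := hmid
      rcases E.eq_of_o_middle h hdw with rfl | rfl | rfl
      · rw [h.qw] at h2 h4
        rw [h.qv] at h4
        rw [hx] at h1
        rw [hy] at h2
        rw [hz] at h4
        simp only [List.cons.injEq, and_true] at h1 h2 h4
        rw [← h1, ← h2, ← h4]
        exact hE
      · rw [h.qv] at h2 h4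
        rw [h.qu] at h4
        rw [hy] at h1
        rw [hz] at h2
        rw [hx] at h4
        simp only [List.cons.injEq, and_true] at h1 h2 h4
        rw [← h1, ← h2, ← h4]
        exact hE.rot
      · rw [h.qu] at h2 h4
        rw [h.qw] at h4
        rw [hz] at h1
        rw [hx] at h2
        rw [hy] at h4
        simp only [List.cons.injEq, and_true] at h1 h2 h4
        rw [← h1, ← h2, ← h4]
        exact hE.rot.rot
    · have hap : ¬ M.vertexPerm.SameCycle f d := fun h' => F.apex d h' h3
      have hd : M.OffMiddle u w v d := by
        by_contra hd
        rcases not_offMiddle.1 hd with rfl | rfl | rfl | rfl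
        exacts [hdw rfl, hdw o3, hdw o2, hap ((E.same _ _).2 o5.symm)]
      obtain ⟨a1, a2, a3⟩ := h.step (x := ⟨d, hd⟩) rfl hap
      obtain ⟨a4, a5, a6⟩ := h.step a1 a3
      obtain ⟨a7, a8, a9⟩ := h.step a4 a6
      exact F.emptyTriangle h (R.vertex ⟨d, hd⟩ b₁ b₂ b₃ (Subtype.ext (a7.trans h3))
        (a2.trans h1) (a5.trans h2) (a8.trans h4))
  · apply F.emptyTriangle h
    have hlen : 2 ≤ (suppressLabel M C e u w v ⟨_, oe'⟩).length := by
      rw [suppressLabel_self rfl, List.length_append]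
      have := List.length_pos_iff.2 (A.ne_nil (M.edgePerm w))
      have := List.length_pos_iff.2 (A.ne_nil (M.edgePerm e))
      omega
    by_cases hde : d = M.edgePerm e
    · subst hde
      refine R.fan ⟨_, oe'⟩ b b' y hlen ?_ (F.merged_target h ?_)
      · rw [suppressLabel_self rfl]
        exact hbb.trans (List.suffix_append _ _).isInfix
      · rwa [p3, y1] at hy
    by_cases hdw : d = M.edgePerm w
    · subst hdw
      refine R.fan ⟨_, oe'⟩ b b' y hlen ?_ (F.merged_target h ?_)
      · rw [suppressLabel_self rfl]
        exact hbb.trans (List.prefix_append _ _).isInfix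
      · rwa [p4, h.qv, y2] at hy
    have hdo : M.OffMiddle u w v d := by
      by_contra hdo
      rcases not_offMiddle.1 hdo with rfl | rfl | rfl | rfl
      · exact F.single_w hd
      · exact F.single_v hd
      · rw [y2] at hd; exact y3 hd
      · exact hdw rfl
    have h1 := F.face_step h (d := ⟨d, hdo⟩) hde hd
    have h2 := h.step (C := C) h1 (fun h' => F.apex _ h' (A.chain _ hd).deg_fst)
    have h3 := h.step (C := C) h2.1 h2.2.2
    refine R.fan ⟨d, hdo⟩ b b' y ?_ ?_ ?_
    · rwa [suppressLabel_of_ne hde]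
    · rwa [suppressLabel_of_ne hde]
    · rwa [h3.2.1]

end

end CombMap

/-! ### Cyclic lists of disks -/

section Cyclic

variable {α : Type*} [DecidableEq α] {L : List α} {x y : α}

/-- The position of an entry of a list, up to rotation. -/
def List.cyclicIdx (L : List α) (N : ℕ) (x : α) : ZMod N := (L.idxOf x : ℕ)

theorem List.cyclicIdx_getElem (hL : L.Nodup) (N i : ℕ) (hi : i < L.length) :
    L.cyclicIdx N L[i] = i := by
  rw [cyclicIdx, hL.idxOf_getElem]

theorem List.cyclicIdx_inj {N : ℕ} (hN : L.length ≤ N) (hx : x ∈ L) (hy : y ∈ L)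
    (h : L.cyclicIdx N x = L.cyclicIdx N y) : x = y := by
  have h1 := List.idxOf_lt_length_of_mem hx
  have h2 := List.idxOf_lt_length_of_mem hy
  rw [cyclicIdx, cyclicIdx, ZMod.natCast_eq_natCast_iff', Nat.mod_eq_of_lt (by omega),
    Nat.mod_eq_of_lt (by omega)] at h
  exact (List.idxOf_inj hx).1 h

theorem List.isChain_cyclicIdx (hL : L.Nodup) (N : ℕ) :
    L.IsChain (fun x y => L.cyclicIdx N y = L.cyclicIdx N x + 1) := by
  rw [List.isChain_iff_getElem]
  intro i hi
  rw [List.cyclicIdx_getElem hL, List.cyclicIdx_getElem hL]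
  push_cast
  rfl

theorem List.pair_of_cyclicIdx {N : ℕ} (hN : L.length = N) (hx : x ∈ L) (hy : y ∈ L)
    (h : L.cyclicIdx N y = L.cyclicIdx N x + 1) :
    [x, y] <:+: L ∨ (L.getLast? = some x ∧ L.head? = some y) := by
  have h1 := List.idxOf_lt_length_of_mem hx
  have h2 := List.idxOf_lt_length_of_mem hy
  have e1 := List.getElem_idxOf h1
  have e2 := List.getElem_idxOf h2
  have h' : ((L.idxOf y : ℕ) : ZMod N) = ((L.idxOf x + 1 : ℕ) : ZMod N) := by
    push_cast; exact h
  rw [ZMod.natCast_eq_natCast_iff', Nat.mod_eq_of_lt (by omega)] at h'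
  by_cases hlt : L.idxOf x + 1 < N
  · left
    rw [Nat.mod_eq_of_lt hlt] at h'
    refine ⟨L.take (L.idxOf x), L.drop (L.idxOf x + 2), ?_⟩
    have e3 : L[L.idxOf x + 1] = y := by simp only [← h', e2]
    conv_rhs => rw [← List.take_append_drop (L.idxOf x) L]
    rw [List.drop_eq_getElem_cons h1, List.drop_eq_getElem_cons (hlt.trans_eq hN.symm), e1, e3]
    simp
  · right
    have h3 : L.idxOf x + 1 = N := by omega

    rw [h3, Nat.mod_self] at h'
    constructor
    · rw [List.getLast?_eq_getElem?, ← e1, List.getElem?_eq_getElem (by omega)]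
      congr 2
      omega
    · rw [List.head?_eq_getElem?, List.getElem?_eq_getElem (by omega)]
      conv_rhs => rw [← e2]
      congr 2
      exact h'.symm

end Cyclic

namespace OCircle

/-- The circle orthogonal to the first and last disk of a ring and to the outer disk bounds a region
that contains all other disks of the ring. -/
theorem inn_rd_outside {N : ℕ} [NeZero N] (hN : 3 ≤ N) {i : ZMod N} (h0 : i ≠ 0) (h1 : i ≠ -1)
    {z : OCircle}
    (ha : inn z (rd N (-1)) ≤ -1) (hb : inn z (rd N 0) ≤ -1) (hc : inn z (od N) ≤ -1)
    (hn : inn (oc N (-1)) z ≤ 0) : inn (rd N i) z ≤ -3 := by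
  have hF := frame_rd hN (-1)
  rw [neg_add_cancel] at hF
  refine hF.inn_le_neg_three (inn_rd_le hN h1).1 (inn_rd_le hN h0).1 ?_ ?_ ha hb hc ?_
  · rw [inn_comm, inn_od_rd hN]
  · rw [inn_comm]; exact inn_oc_rd hN _ _
  · rwa [inn_comm]

theorem inn_nonpos_outside {N : ℕ} [NeZero N] (hN : 3 ≤ N) {f z : OCircle}
    (hf : ∀ j, inn f (rd N j) ≤ 0) (hf' : inn f (od N) ≤ 0) (hf2 : 0 ≤ inn f (oc N (-1)))
    (ha : inn z (rd N (-1)) ≤ -1) (hb : inn z (rd N 0) ≤ -1) (hc : inn z (od N) ≤ -1)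
    (hn : inn (oc N (-1)) z ≤ 0) : inn f z ≤ 0 := by
  have hF := frame_rd hN (-1)
  rw [neg_add_cancel] at hF
  refine hF.inn_nonpos (hf _) (hf _) hf' (by linarith) (by linarith) (by linarith) ?_
  rw [inn_comm z]
  exact mul_nonpos_of_nonneg_of_nonpos hf2 hn

end OCircle

namespace CombMap

open OCircle

variable {D B : Type u} {M : CombMap D} {C : D → List B} {v : B → OCircle}

theorem EmptyTriangle.pull {b₁ b₂ b₃ : B} (h : EmptyTriangle C v b₁ b₂ b₃) (g : SL(2, ℂ)) :
    EmptyTriangle C (fun b => OCircle.pull g (v b)) b₁ b₂ b₃ := by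
  obtain ⟨n, h1, h2⟩ := h
  exact ⟨_, h1.pull g, fun d b hb => by rw [inn_pull]; exact h2 d b hb⟩

theorem Realizes.pull (R : Realizes M C v) (g : SL(2, ℂ)) :
    Realizes M C (fun b => OCircle.pull g (v b)) where
  norm d b hb := by rw [inn_pull]; exact R.norm d b hb
  sep d d' b hb b' hb' h := by rw [inn_pull]; exact R.sep d d' b hb b' hb' h
  touch d d' b hb b' hb' h h1 := by rw [inn_pull] at h1; exact R.touch d d' b hb b' hb' h h1
  ring d := by
    obtain ⟨N, hN, h, P, hP⟩ := R.ring d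
    refine ⟨N, hN, h * g, P, fun e he => ⟨fun b hb => ?_, (hP e he).2⟩⟩
    simp only [pull_mul, (hP e he).1 b hb]
  vertex d b₁ b₂ b₃ h3 h1 h2 h4 := (R.vertex d b₁ b₂ b₃ h3 h1 h2 h4).pull g
  fan d b b' y h1 h2 h3 := (R.fan d b b' y h1 h2 h3).pull g

theorem EmptyTriangle.of_sameCycle {d x : D} {a b c b₁ b₂ b₃ : B}
    (h : EmptyTriangle C v a b c) (h3 : M.vertexPerm (M.vertexPerm (M.vertexPerm x)) = x)
    (ha : C x = [a]) (hb : C (M.vertexPerm x) = [b]) (hc : C (M.vertexPerm (M.vertexPerm x)) = [c])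
    (hd : M.vertexPerm.SameCycle x d) (h1 : C d = [b₁]) (h2 : C (M.vertexPerm d) = [b₂])
    (h4 : C (M.vertexPerm (M.vertexPerm d)) = [b₃]) : EmptyTriangle C v b₁ b₂ b₃ := by
  rcases sameCycle_of_three h3 hd with rfl | rfl | rfl
  · rw [ha] at h1; rw [hb] at h2; rw [hc] at h4
    simp only [List.cons.injEq, and_true] at h1 h2 h4
    rw [← h1, ← h2, ← h4]
    exact h
  · rw [h3] at h4
    rw [hb] at h1; rw [hc] at h2; rw [ha] at h4
    simp only [List.cons.injEq, and_true] at h1 h2 h4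
    rw [← h1, ← h2, ← h4]
    exact h.rot
  · rw [h3] at h2 h4
    rw [hc] at h1; rw [ha] at h2; rw [hb] at h4
    simp only [List.cons.injEq, and_true] at h1 h2 h4
    rw [← h1, ← h2, ← h4]
    exact h.rot.rot

end CombMap

theorem List.getLast?_ne_of_pair {α : Type*} {L : List α} {b b' : α} (hL : L.Nodup)
    (h : [b, b'] <:+: L) : L.getLast? ≠ some b := by
  obtain ⟨l, l', rfl⟩ := h
  intro h1
  rw [List.append_assoc, List.getLast?_append_of_ne_nil _ (by simp)] at h1
  have h2 : (b' :: l').getLast? = some b := by simpa using h1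
  have h3 := List.mem_of_getLast? h2
  rw [List.append_assoc, List.nodup_append] at hL
  exact (List.nodup_cons.1 hL.2.1).1 h3

namespace OCircle

/-! ### Inserting a chain of disks -/

variable {B : Type u}

/-- The disks `v` of the labels in `S`, of which `α`, `β`, `γ` are in standard position and bound an
empty triangle, and a chain `X` of new labels. -/
structure Insertion (v : B → OCircle) (S : Set B) (X : List B) (α β γ : B) (N : ℕ) : Prop where
  len : X.length + 2 = N
  ne_nil : X ≠ []
  nodup : (γ :: X ++ [β]).Nodup
  alpha_mem : α ∈ S
  beta_mem : β ∈ S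
  gamma_mem : γ ∈ S
  disj : ∀ z ∈ S, z ∉ X
  v_alpha : v α = od N
  v_beta : v β = rd N (-1)
  v_gamma : v γ = rd N 0
  norm : ∀ z ∈ S, inn (v z) (v z) = 1
  sep : ∀ z ∈ S, ∀ z' ∈ S, z ≠ z' → inn (v z) (v z') ≤ -1
  normal : ∀ z ∈ S, inn (oc N (-1)) (v z) ≤ 0

open Classical in
/-- The position of a label in the ring. -/
noncomputable def ringIdx (X : List B) (β γ : B) (N : ℕ) (z : B) : ZMod N :=
  (γ :: X ++ [β]).cyclicIdx N z

open Classical in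
/-- The disks after inserting the chain `X` as part of a regular ring. -/
noncomputable def insertDisks (v : B → OCircle) (X : List B) (β γ : B) (N : ℕ) (z : B) : OCircle :=
  if z ∈ X then rd N (ringIdx X β γ N z) else v z

namespace Insertion

variable {v : B → OCircle} {S : Set B} {X : List B} {α β γ : B} {N : ℕ}
  {z z' : B}

theorem idx_gamma : ringIdx X β γ N γ = 0 := by
  classical
  simp [ringIdx, List.cyclicIdx]

theorem mem_ring : z ∈ γ :: X ++ [β] ↔ z = γ ∨ z ∈ X ∨ z = β := by
  simp

variable (I : Insertion v S X α β γ N)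

include I

theorem three_le : 3 ≤ N := by
  have := List.length_pos_iff.2 I.ne_nil
  have := I.len
  omega

theorem length_ring : (γ :: X ++ [β]).length = N := by
  rw [← I.len]; simp

theorem idx_beta : ringIdx X β γ N β = -1 := by
  classical
  have h := List.cyclicIdx_getElem I.nodup N (X.length + 1) (by simp)
  have h2 : (γ :: X ++ [β])[X.length + 1]'(by simp) = β := by simp
  rw [h2] at h
  rw [ringIdx, h, eq_neg_iff_add_eq_zero]
  have := I.len
  have h3 := ZMod.natCast_self N
  rw [← I.len] at h3 ⊢
  push_cast at h3 ⊢
  rw [add_assoc, one_add_one_eq_two]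
  exact h3

theorem idx_inj (hz : z ∈ γ :: X ++ [β]) (hz' : z' ∈ γ :: X ++ [β])
    (h : ringIdx X β γ N z = ringIdx X β γ N z') : z = z' := by
  classical
  exact List.cyclicIdx_inj I.length_ring.le hz hz' h

theorem idx_mem (hz : z ∈ X) : ringIdx X β γ N z ≠ 0 ∧ ringIdx X β γ N z ≠ -1 := by
  have h : z ∈ γ :: X ++ [β] := mem_ring.2 (Or.inr (Or.inl hz))
  constructor
  · intro h'
    have := I.idx_inj h (mem_ring.2 (Or.inl rfl)) (h'.trans idx_gamma.symm)
    exact I.disj _ I.gamma_mem (this ▸ hz)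
  · intro h'
    have := I.idx_inj h (mem_ring.2 (Or.inr (Or.inr rfl))) (h'.trans I.idx_beta.symm)
    exact I.disj _ I.beta_mem (this ▸ hz)

theorem disks_old (hz : z ∈ S) : insertDisks v X β γ N z = v z := if_neg (I.disj z hz)

theorem disks_alpha : insertDisks v X β γ N α = od N := by
  rw [I.disks_old I.alpha_mem, I.v_alpha]

theorem disks_ring (hz : z ∈ γ :: X ++ [β]) :
    insertDisks v X β γ N z = rd N (ringIdx X β γ N z) := by
  rcases mem_ring.1 hz with rfl | hz | rfl
  · rw [I.disks_old I.gamma_mem, I.v_gamma, idx_gamma]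
  · exact if_pos hz
  · rw [I.disks_old I.beta_mem, I.v_beta, I.idx_beta]

theorem disks_norm (hz : z ∈ X ∨ z ∈ S) :
    inn (insertDisks v X β γ N z) (insertDisks v X β γ N z) = 1 := by
  rcases hz with hz | hz
  · rw [I.disks_ring (mem_ring.2 (Or.inr (Or.inl hz)))]
    exact inn_rd_self I.three_le _
  · rw [I.disks_old hz, I.norm z hz]

theorem outside (hz : z ∈ S) (h : z ≠ α ∧ z ≠ β ∧ z ≠ γ) :
    inn (v z) (rd N (-1)) ≤ -1 ∧ inn (v z) (rd N 0) ≤ -1 ∧ inn (v z) (od N) ≤ -1 := by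
  rw [← I.v_alpha, ← I.v_beta, ← I.v_gamma]
  exact ⟨I.sep _ hz _ I.beta_mem h.2.1, I.sep _ hz _ I.gamma_mem h.2.2,
    I.sep _ hz _ I.alpha_mem h.1⟩

/-- Against the ring and its outer disk a new disk behaves as in the regular ring. All other old
disks lie beyond the base triangle, where the product is at most -3 by `inn_rd_outside`. -/
theorem disks_new (hz : z ∈ X) (hz' : z' ∈ X ∨ z' ∈ S) (hne : z ≠ z') :
    inn (insertDisks v X β γ N z) (insertDisks v X β γ N z') ≤ -1 ∧
      (inn (insertDisks v X β γ N z) (insertDisks v X β γ N z') = -1 →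
        z' = α ∨ [z, z'] <:+: γ :: X ++ [β] ∨ [z', z] <:+: γ :: X ++ [β]) := by
  classical
  have hN := I.three_le
  have : NeZero N := ⟨by omega⟩
  have hzr : z ∈ γ :: X ++ [β] := mem_ring.2 (Or.inr (Or.inl hz))
  by_cases hr : z' ∈ γ :: X ++ [β]
  · rw [I.disks_ring hzr, I.disks_ring hr]
    have h1 := inn_rd_le hN (fun h => hne (I.idx_inj hzr hr h))
    refine ⟨h1.1, fun h => Or.inr ?_⟩
    -- The pair that closes up the cyclic order consists of `β` and `γ`, and neither of them is new.
    have key : ∀ {x y : B}, [x, y] <:+: γ :: X ++ [β] ∨ ((γ :: X ++ [β]).getLast? = some x ∧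
        (γ :: X ++ [β]).head? = some y) → (x ∈ X ∨ y ∈ X) → [x, y] <:+: γ :: X ++ [β] := by
      rintro x y (h | ⟨h, h'⟩) hxy
      · exact h
      · simp only [List.getLast?_append, List.getLast?_singleton, Option.some_or,
          Option.some_inj] at h
        simp only [List.cons_append, List.head?_cons, Option.some_inj] at h'
        subst h h'
        rcases hxy with hx | hx
        exacts [(I.disj _ I.beta_mem hx).elim, (I.disj _ I.gamma_mem hx).elim]
    rcases h1.2 h with h2 | h2
    · exact Or.inl (key (List.pair_of_cyclicIdx I.length_ring hzr hr h2) (Or.inl hz))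
    · exact Or.inr (key (List.pair_of_cyclicIdx I.length_ring hr hzr h2) (Or.inr hz))
  · rw [mem_ring] at hr
    have hS : z' ∈ S := hz'.resolve_left (fun h => hr (Or.inr (Or.inl h)))
    by_cases hα : z' = α
    · subst hα
      rw [I.disks_ring hzr, I.disks_alpha, inn_comm, inn_od_rd hN]
      exact ⟨le_rfl, fun _ => Or.inl rfl⟩
    · obtain ⟨h1, h2, h3⟩ := I.outside hS
        ⟨hα, fun h => hr (Or.inr (Or.inr h)), fun h => hr (Or.inl h)⟩
      have := inn_rd_outside hN (I.idx_mem hz).1 (I.idx_mem hz).2 h1 h2 h3 (I.normal _ hS)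
      rw [I.disks_ring hzr, I.disks_old hS]
      exact ⟨by linarith, fun h => by linarith⟩

theorem disks_sep (hz : z ∈ X ∨ z ∈ S) (hz' : z' ∈ X ∨ z' ∈ S) (hne : z ≠ z') :
    inn (insertDisks v X β γ N z) (insertDisks v X β γ N z') ≤ -1 := by
  rcases hz with hz | hz
  · exact (I.disks_new hz hz' hne).1
  rcases hz' with hz' | hz'
  · rw [inn_comm]
    exact (I.disks_new hz' (Or.inr hz) hne.symm).1
  · rw [I.disks_old hz, I.disks_old hz']
    exact I.sep _ hz _ hz' hne

/-- A circle that keeps the ring on one side, and crosses or surrounds the base triangle. -/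
theorem normal_nonpos {f : OCircle} (hf : ∀ j, inn f (rd N j) ≤ 0) (hf' : inn f (od N) ≤ 0)
    (hf2 : 0 ≤ inn f (oc N (-1))) (hz : z ∈ X ∨ z ∈ S) :
    inn f (insertDisks v X β γ N z) ≤ 0 := by
  have hN := I.three_le
  have : NeZero N := ⟨by omega⟩
  by_cases hr : z ∈ γ :: X ++ [β]
  · rw [I.disks_ring hr]
    exact hf _
  · rw [mem_ring] at hr
    have hS : z ∈ S := hz.resolve_left (fun h => hr (Or.inr (Or.inl h)))
    rw [I.disks_old hS]
    by_cases hα : z = α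
    · rw [hα, I.v_alpha]
      exact hf'
    · obtain ⟨h1, h2, h3⟩ := I.outside hS
        ⟨hα, fun h => hr (Or.inr (Or.inr h)), fun h => hr (Or.inl h)⟩
      exact inn_nonpos_outside hN hf hf' hf2 h1 h2 h3 (I.normal _ hS)

theorem idx_succ {b b' : B} (h : [b, b'] <:+: γ :: X ++ [β]) :
    ringIdx X β γ N b' = ringIdx X β γ N b + 1 := by
  classical
  have := (List.isChain_cyclicIdx I.nodup N).infix h
  rw [List.isChain_pair] at this
  exact this

/-- Two consecutive ring disks and the outer disk bound a gap outside the ring. The reversed `oc`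
has the ring on one side, and the old disks lie in the gap of a different pair. -/
theorem frame_pair {b b' : B} (h : [b, b'] <:+: γ :: X ++ [β]) :
    ∃ n, Frame (insertDisks v X β γ N b') (insertDisks v X β γ N b) (insertDisks v X β γ N α) n ∧
      ∀ z, z ∈ X ∨ z ∈ S → inn n (insertDisks v X β γ N z) ≤ 0 := by
  have hN := I.three_le
  have hs := h.sublist.subset
  have hb : b ∈ γ :: X ++ [β] := hs (by simp)
  have hb' : b' ∈ γ :: X ++ [β] := hs (by simp)
  have h1 := I.idx_succ h
  refine ⟨neg (oc N (ringIdx X β γ N b)), ?_, fun z hz => ?_⟩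
  · rw [I.disks_ring hb, I.disks_ring hb', I.disks_alpha, h1]
    exact (frame_rd hN _).flip
  · apply I.normal_nonpos
    · intro j
      rw [inn_neg_left, neg_nonpos]
      exact inn_oc_rd hN _ _
    · rw [inn_neg_left, inn_oc_od hN, neg_zero]
    · rw [inn_neg_left, Left.nonneg_neg_iff]
      apply inn_oc_oc hN
      -- Index -1 would make `b` the last entry `β`, which has no successor in the list.
      intro h2
      rw [h2, neg_add_cancel] at h1
      have h3 := I.idx_inj hb (mem_ring.2 (Or.inr (Or.inr rfl))) (h2.trans I.idx_beta.symm)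
      have h4 := I.idx_inj hb' (mem_ring.2 (Or.inl rfl)) (h1.trans idx_gamma.symm)
      subst h3 h4
      exact List.getLast?_ne_of_pair I.nodup h List.getLast?_concat
    · exact hz

/-- For a chain of one disk the ring has three disks and encloses a further gap, which belongs to
the restored vertex at the corner of the chain. -/
theorem frame_three {x : B} (hX : X = [x]) :
    ∃ n, Frame (insertDisks v X β γ N γ) (insertDisks v X β γ N x) (insertDisks v X β γ N β) n ∧
      ∀ z, z ∈ X ∨ z ∈ S → inn n (insertDisks v X β γ N z) ≤ 0 := by
  have hl := I.len
  have h1 := I.idx_succ (b := γ) (b' := x) ⟨[], [β], by simp [hX]⟩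
  have h2 := I.idx_succ (b := x) (b' := β) ⟨[γ], [], by simp [hX]⟩
  rw [I.disks_ring (mem_ring.2 (Or.inl rfl)), I.disks_ring (mem_ring.2 (Or.inr (Or.inr rfl))),
    I.disks_ring (mem_ring.2 (Or.inr (Or.inl (by simp [hX])))), h2, h1]
  obtain rfl : N = 3 := by rw [← hl, hX]; rfl
  have hF := frame_rd_three (ringIdx X β γ 3 γ)
  refine ⟨_, hF, fun z hz => I.normal_nonpos (fun j => ?_) inn_three_od (inn_three_oc _) hz⟩
  exact (frame_rd_three j).inn_na.le

/-- A triangle that is not the base triangle stays empty. -/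
theorem upgrade {a b c : B} {n : OCircle} (h : Frame (v a) (v b) (v c) n) (ha : a ∈ S)
    (hn : ∀ z ∈ S, inn n (v z) ≤ 0) (ha' : a ≠ α ∧ a ≠ β ∧ a ≠ γ) (hz : z ∈ X ∨ z ∈ S) :
    inn n (insertDisks v X β γ N z) ≤ 0 := by
  have hN := I.three_le
  rcases hz with hz | hz
  · have hF := frame_rd hN (-1)
    rw [neg_add_cancel] at hF
    have h1 := hn _ I.beta_mem
    have h2 := hn _ I.gamma_mem
    have h3 := hn _ I.alpha_mem
    rw [I.v_beta] at h1
    rw [I.v_gamma] at h2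
    rw [I.v_alpha] at h3
    obtain ⟨h4, h5, h6⟩ := I.outside ha ha'
    -- The base triangle and the other triangle lie on each other's outer side. So the new disks, on
    -- the inner side of the base, are on the outer side of the other.
    have h7 := hF.inn_normal_nonpos h h1 h2 h3 (I.normal _ ha) h4 h5 h6
    rw [I.disks_ring (mem_ring.2 (Or.inr (Or.inl hz)))]
    have h8 := inn_rd_le hN (I.idx_mem hz).1
    have h9 := inn_rd_le hN (I.idx_mem hz).2
    refine hF.inn_nonpos h1 h2 h3 (by linarith [h9.1]) (by linarith [h8.1]) ?_ ?_
    · rw [inn_comm, inn_od_rd hN]; norm_num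
    · refine mul_nonpos_of_nonpos_of_nonneg h7 ?_
      rw [inn_comm]
      exact inn_oc_rd hN _ _
  · rw [I.disks_old hz]
    exact hn z hz

end Insertion

end OCircle

namespace CombMap

open OCircle

/-! ### Labels after shrinking a triangle -/

variable {D B V : Type u} {G : SimpleGraph V} {M : CombMap D} {o : D → V} {C : D → List B}
  {a b c : D}

/-- The labels on the faces around a triangle. -/
structure LegLabels (M : CombMap D) (C : D → List B) (a b c : D) : Prop where
  leg_a : ∀ x, M.facePerm.SameCycle (M.vertexPerm a) x →
    M.facePerm (M.facePerm (M.facePerm x)) ≠ x ∧ ¬ 2 ≤ (C x).length ∧ C x = C (M.vertexPerm a)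
  leg_b : ∀ x, M.facePerm.SameCycle (M.vertexPerm b) x →
    M.facePerm (M.facePerm (M.facePerm x)) ≠ x ∧ ¬ 2 ≤ (C x).length ∧ C x = C (M.vertexPerm b)
  leg_c : ∀ x, M.facePerm.SameCycle (M.vertexPerm c) x →
    M.facePerm (M.facePerm (M.facePerm x)) ≠ x ∧ ¬ 2 ≤ (C x).length ∧ C x = C (M.vertexPerm c)

theorem facePerm_edgePerm (x : D) : M.facePerm (M.edgePerm x) = M.vertexPerm x := by
  rw [facePerm_apply, M.edgePerm_edgePerm]

theorem sameCycle_leg (x : D) : M.facePerm.SameCycle (M.vertexPerm x) (M.edgePerm x) := by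
  have := sameCycle_apply_self M.facePerm (M.edgePerm x)
  rw [facePerm_edgePerm] at this
  exact this.symm

theorem Admissible.legLabels (A : M.Admissible C) (E : Emb G M o) (h : M.TriFace a b c)
    (hc : IsD3aConfig G (o a) (o b) (o c)) : LegLabels M C a b c := by
  have key : ∀ {a b c : D}, M.TriFace a b c → IsD3aConfig G (o a) (o b) (o c) →
      ∀ x, M.facePerm.SameCycle (M.vertexPerm a) x → M.facePerm (M.facePerm (M.facePerm x)) ≠ x ∧
        ¬ 2 ≤ (C x).length ∧ C x = C (M.vertexPerm a) := fun h hc x hx =>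
    ⟨E.not_triangle_of_leg h hc hx,
      A.const_of_not_tri (E.not_triangle_of_leg h hc (Equiv.Perm.SameCycle.refl _ _)) hx⟩
  exact ⟨key h hc, key h.rotate hc.rotate, key h.rotate.rotate hc.rotate.rotate⟩

theorem TriFace.vertex_step [Finite D] (h : M.TriFace a b c) {x : D}
    {d : {x // M.OffTriangle a b c x}} (hd : (d : D) = x)
    (hx : x ≠ M.vertexPerm a ∧ x ≠ M.vertexPerm b ∧ x ≠ M.vertexPerm c) :
    ((CombMap.shrink h).vertexPerm d : D) = M.vertexPerm x ∧
      M.vertexPerm x ≠ M.vertexPerm a ∧ M.vertexPerm x ≠ M.vertexPerm b ∧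
        M.vertexPerm x ≠ M.vertexPerm c := by
  subst hd
  obtain ⟨n1, n2, n3, -⟩ := not_offTriangle_self (M := M) (a := a) (b := b) (c := c)
  refine ⟨by rw [shrink_vertexPerm, shrinkNext_of_ne hx.1 hx.2.1 hx.2.2], fun h' => n1 ?_,
    fun h' => n2 ?_, fun h' => n3 ?_⟩ <;>
  · have h5 := d.2
    rwa [M.vertexPerm.injective h'] at h5

theorem TriFace.vertex_cycle [Finite D] (h : M.TriFace a b c) {x : D}
    {d : {x // M.OffTriangle a b c x}} (hd : (d : D) = x)
    (hx : x ≠ M.vertexPerm a ∧ x ≠ M.vertexPerm b ∧ x ≠ M.vertexPerm c)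
    (h3 : M.vertexPerm (M.vertexPerm (M.vertexPerm x)) = x) :
    (CombMap.shrink h).vertexPerm ((CombMap.shrink h).vertexPerm
      ((CombMap.shrink h).vertexPerm d)) = d := by
  obtain ⟨h1, h2⟩ := h.vertex_step hd hx
  obtain ⟨h4, h5⟩ := h.vertex_step h1 h2
  obtain ⟨h6, h7⟩ := h.vertex_step h4 h5
  exact Subtype.ext (by rw [h6, h3, hd])

namespace LegLabels

variable (F : LegLabels M C a b c) (h : M.TriFace a b c) {x : D}

include F

theorem rotate : LegLabels M C b c a := ⟨F.leg_b, F.leg_c, F.leg_a⟩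

theorem edge_a : C (M.edgePerm a) = C (M.vertexPerm a) := (F.leg_a _ (sameCycle_leg a)).2.2

theorem not_leg_a (h3 : M.facePerm (M.facePerm (M.facePerm x)) = x) :
    x ≠ M.vertexPerm a ∧ x ≠ M.edgePerm a :=
  ⟨fun hx => (F.leg_a x (hx ▸ Equiv.Perm.SameCycle.refl _ _)).1 h3,
    fun hx => (F.leg_a x (hx ▸ sameCycle_leg a)).1 h3⟩

theorem offTriangle (h3 : M.facePerm (M.facePerm (M.facePerm x)) = x)
    (hx : x ≠ a ∧ x ≠ b ∧ x ≠ c) : M.OffTriangle a b c x := by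
  by_contra hx'
  rcases not_offTriangle.1 hx' with h' | h' | h' | h' | h' | h'
  exacts [hx.1 h', hx.2.1 h', hx.2.2 h', (F.not_leg_a h3).2 h', (F.rotate.not_leg_a h3).2 h',
    (F.rotate.rotate.not_leg_a h3).2 h']

theorem ne_legs (h3 : M.facePerm (M.facePerm (M.facePerm x)) = x) :
    x ≠ M.vertexPerm a ∧ x ≠ M.vertexPerm b ∧ x ≠ M.vertexPerm c :=
  ⟨(F.not_leg_a h3).1, (F.rotate.not_leg_a h3).1, (F.rotate.rotate.not_leg_a h3).1⟩

include h

theorem shrinkNext (x : D) : C (M.shrinkNext a b c x) = C (M.vertexPerm x) :=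
  h.comp_shrinkNext F.edge_a F.rotate.edge_a F.rotate.rotate.edge_a x

variable [Finite D]

theorem face_step {d : {x // M.OffTriangle a b c x}} {x : D} (hd : (d : D) = x)
    (h3 : M.facePerm (M.facePerm (M.facePerm x)) = x) :
    ((CombMap.shrink h).facePerm d : D) = M.facePerm x ∧
      M.facePerm (M.facePerm (M.facePerm (M.facePerm x))) = M.facePerm x := by
  subst hd
  refine ⟨?_, congrArg _ h3⟩
  have key : ∀ {a b c : D}, LegLabels M C a b c → M.TriFace a b c →
      M.edgePerm d ≠ M.vertexPerm a := by
    intro a b c F h hx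
    have h4 : M.facePerm d = M.edgePerm c := by
      rw [facePerm_apply, hx, h.a3]
    exact (F.rotate.rotate.not_leg_a (congrArg M.facePerm h3)).2 h4
  rw [shrink_facePerm, shrinkNext_of_ne (key F h) (key F.rotate h.rotate)
    (key F.rotate.rotate h.rotate.rotate)]
  rfl

theorem label_next (x : {x // M.OffTriangle a b c x}) :
    C ((CombMap.shrink h).vertexPerm x) = C (M.vertexPerm x) := F.shrinkNext h x

theorem label_face (x : {x // M.OffTriangle a b c x}) :
    C ((CombMap.shrink h).facePerm x) = C (M.facePerm x) := F.shrinkNext h (M.edgePerm x)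

/-- Shrinking alters only the faces along the legs. None of them is a triangle, so triangular faces
with chains keep their shape and their surroundings. -/
theorem shrink (A : M.Admissible C) :
    (CombMap.shrink h).Admissible (fun x => C x) where
  ne_nil d := A.ne_nil d
  nodup d := A.nodup d
  face b d e hd he := h.shrink_sameCycle_facePerm (A.face b d e hd he)
  const d h1 h2 h3 := by
    have key : ∀ {a b c : D}, LegLabels M C a b c → ∀ x : D, x = M.vertexPerm a →
        C (M.facePerm x) = C x := by
      rintro a b c F x rfl
      exact (F.leg_a _ (sameCycle_apply_self _ _)).2.2
    rw [F.label_face h] at h3 ⊢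
    by_cases ha : M.edgePerm d = M.vertexPerm a
    · exact key F.rotate.rotate _ (by rw [shrink_facePerm, ha, shrinkNext_a])
    by_cases hb : M.edgePerm d = M.vertexPerm b
    · exact key F _ (by rw [shrink_facePerm, hb, h.shrinkNext_b])
    by_cases hc : M.edgePerm d = M.vertexPerm c
    · exact key F.rotate _ (by rw [shrink_facePerm, hc, h.shrinkNext_c])
    have h4 : ((CombMap.shrink h).facePerm d : D) = M.facePerm d := by
      rw [shrink_facePerm, shrinkNext_of_ne ha hb hc]; rfl
    rw [h4] at h2 h3 ⊢
    exact A.const d h1 h2 h3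
  chain d hw := by
    have hd := A.chain d hw
    obtain ⟨e1, t1⟩ := F.face_step h (d := d) rfl hd.tri
    obtain ⟨e2, t2⟩ := F.face_step h e1 t1
    obtain ⟨e3, t3⟩ := F.face_step h e2 t2
    have s1 := h.vertex_step e1 (F.ne_legs t1)
    have s2 := h.vertex_step e2 (F.ne_legs t2)
    refine ⟨Subtype.ext (e3.trans hd.tri), h.vertex_cycle e1 (F.ne_legs t1) hd.deg_fst,
      h.vertex_cycle e2 (F.ne_legs t2) hd.deg_snd, ?_, ?_, ?_, ?_, ?_, ?_, ?_⟩
    · rw [e1]; exact hd.last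
    · rw [e2]; exact hd.head
    · rw [s1.1]; exact hd.fst_one
    · rw [F.label_next h, s1.1]; exact hd.fst_two
    · rw [s2.1]; exact hd.snd_one
    · rw [F.label_next h, s2.1]; exact hd.snd_two
    · rw [F.label_face h, s1.1]; exact hd.opposite

end LegLabels

end CombMap

/-! ### Filling the gap of a shrunk triangle with its chain -/

namespace CombMap

open OCircle

variable {D B V : Type u} {G : SimpleGraph V} {M : CombMap D} {o : D → V} {C : D → List B}
  {a b c : D}

/-- The labels of the darts that survive when a triangle shrinks to a vertex. -/
def shrinkLabels (M : CombMap D) (C : D → List B) (a b c : D) : Set B :=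
  {z | ∃ x : {x // M.OffTriangle a b c x}, z ∈ C x}

/-- The labels of the three faces around a triangle. -/
structure TriLabels (M : CombMap D) (C : D → List B) (a b c : D) (α β γ : B) : Prop where
  leg_a : C (M.vertexPerm a) = [β]
  leg_b : C (M.vertexPerm b) = [α]
  leg_c : C (M.vertexPerm c) = [γ]
  edge_a : C (M.edgePerm a) = [β]
  edge_b : C (M.edgePerm b) = [α]
  edge_c : C (M.edgePerm c) = [γ]
  last : C b = (C a).getLast?.toList
  head : C c = (C a).head?.toList

theorem LegLabels.exists_triLabels (F : LegLabels M C a b c) (A : M.Admissible C)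
    (h : M.TriFace a b c) (hb : ¬ 2 ≤ (C b).length) (hc : ¬ 2 ≤ (C c).length) :
    ∃ α β γ, TriLabels M C a b c α β γ := by
  obtain ⟨β, hβ⟩ := A.exists_eq_singleton (F.leg_a _ (Equiv.Perm.SameCycle.refl _ _)).2.1
  obtain ⟨α, hα⟩ := A.exists_eq_singleton (F.leg_b _ (Equiv.Perm.SameCycle.refl _ _)).2.1
  obtain ⟨γ, hγ⟩ := A.exists_eq_singleton (F.leg_c _ (Equiv.Perm.SameCycle.refl _ _)).2.1
  have e1 : M.facePerm a = b := h.ab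
  have e2 : M.facePerm b = c := h.bc
  have e3 : M.facePerm c = a := h.ca
  have h1 := A.ends (d := a) (by rw [e1, e2, e3]) (by rwa [e1]) (by rwa [e1, e2])
  rw [e1, e2] at h1
  exact ⟨α, β, γ, hβ, hα, hγ, F.edge_a.trans hβ, F.rotate.edge_a.trans hα,
    F.rotate.rotate.edge_a.trans hγ, h1.1, h1.2⟩

namespace TriLabels

variable {α β γ : B} (T : TriLabels M C a b c α β γ) (h : M.TriFace a b c)

include T h

theorem cover {z : B} {x : D} (hz : z ∈ C x) :
    z ∈ C a ∨ z ∈ shrinkLabels M C a b c := by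
  by_cases hx : M.OffTriangle a b c x
  · exact Or.inr ⟨⟨x, hx⟩, hz⟩
  rcases not_offTriangle.1 hx with rfl | rfl | rfl | rfl | rfl | rfl
  · exact Or.inl hz
  · rw [T.last, Option.mem_toList] at hz
    exact Or.inl (List.mem_of_getLast? hz)
  · rw [T.head, Option.mem_toList] at hz
    exact Or.inl (List.mem_of_mem_head? hz)
  · exact Or.inr ⟨⟨_, h.off_a⟩, by rwa [T.leg_a, ← T.edge_a]⟩
  · exact Or.inr ⟨⟨_, h.off_b⟩, by rwa [T.leg_b, ← T.edge_b]⟩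
  · exact Or.inr ⟨⟨_, h.off_c⟩, by rwa [T.leg_c, ← T.edge_c]⟩

/-- The disks around the new vertex bound an empty gap, which is moved onto that of the outer disk
and the ring disks -1 and 0. The ring has two disks more than the chain, to make room for `β` and
`γ`. -/
theorem exists_insertion [Finite D] (A : M.Admissible C) {v : B → OCircle}
    (R : Realizes (CombMap.shrink h) (fun x => C x) v) :
    ∃ v N, Realizes (CombMap.shrink h) (fun x => C x) v ∧
      Insertion v (shrinkLabels M C a b c) (C a) α β γ N := by
  have s1 : (CombMap.shrink h).vertexPerm ⟨_, h.off_b⟩ = ⟨_, h.off_a⟩ := Subtype.ext h.shrinkNext_b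
  have s2 : (CombMap.shrink h).vertexPerm ⟨_, h.off_a⟩ = ⟨_, h.off_c⟩ := Subtype.ext shrinkNext_a
  have s3 : (CombMap.shrink h).vertexPerm ⟨_, h.off_c⟩ = ⟨_, h.off_b⟩ := Subtype.ext h.shrinkNext_c
  obtain ⟨n, hn, hn'⟩ := (R.vertex ⟨_, h.off_b⟩ α β γ (by rw [s1, s2, s3]) T.leg_b
    (by rw [s1]; exact T.leg_a) (by rw [s1, s2]; exact T.leg_c)).rot
  have hlen := List.length_pos_iff.2 (A.ne_nil a)
  have hN : 3 ≤ (C a).length + 2 := by omega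
  have hF := frame_rd hN (-1)
  rw [neg_add_cancel] at hF
  obtain ⟨g, h1, h2, h4, h5⟩ := hn.exists_pull hF
  have disj : ∀ z ∈ shrinkLabels M C a b c, z ∉ C a := by
    rintro z ⟨x, hz⟩ hz'
    obtain ⟨n1, n2, n3, -⟩ := not_offTriangle_self (M := M) (a := a) (b := b) (c := c)
    have e1 : M.facePerm a = b := h.ab
    have e2 : M.facePerm b = c := h.bc
    have e3 : M.facePerm c = a := h.ca
    have hx := x.2
    rcases sameCycle_of_three (f := M.facePerm) (d := a) (by rw [e1, e2, e3])
      (A.face z a x hz' hz) with h' | h' | h'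
    · exact n1 (by rwa [h'] at hx)
    · exact n2 (by rwa [h', e1] at hx)
    · exact n3 (by rwa [h', e1, e2] at hx)
  have ma : α ∈ shrinkLabels M C a b c := ⟨⟨_, h.off_b⟩, by simp [T.leg_b]⟩
  have mb : β ∈ shrinkLabels M C a b c := ⟨⟨_, h.off_a⟩, by simp [T.leg_a]⟩
  have mc : γ ∈ shrinkLabels M C a b c := ⟨⟨_, h.off_c⟩, by simp [T.leg_c]⟩
  refine ⟨fun z => OCircle.pull g⁻¹ (v z), (C a).length + 2, R.pull g⁻¹, rfl, A.ne_nil a, ?_, ma,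
      mb,
    mc, disj, ?_, ?_, ?_, ?_, ?_, ?_⟩
  · have hne : β ≠ γ := fun h' => hn.ne (h' ▸ rfl)
    rw [List.cons_append, List.nodup_cons, List.nodup_append]
    refine ⟨?_, A.nodup a, List.nodup_singleton _, ?_⟩
    · rw [List.mem_append, not_or, List.mem_singleton]
      exact ⟨disj _ mc, hne.symm⟩
    · intro x hx y hy h'
      rw [List.mem_singleton.1 hy] at h'
      exact disj _ mb (h' ▸ hx)
  · show OCircle.pull g⁻¹ (v α) = _
    rw [h4, pull_pull_inv]
  · show OCircle.pull g⁻¹ (v β) = _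
    rw [h1, pull_pull_inv]
  · show OCircle.pull g⁻¹ (v γ) = _
    rw [h2, pull_pull_inv]
  · rintro z ⟨x, hz⟩
    rw [inn_pull]
    exact R.norm x z hz
  · rintro z ⟨x, hz⟩ z' ⟨x', hz'⟩ hne
    rw [inn_pull]
    exact R.sep x x' z hz z' hz' hne
  · rintro z ⟨x, hz⟩
    rw [← inn_pull g, pull_inv_pull, ← h5]
    exact hn' x z hz

end TriLabels

section

variable {α β γ : B} {N : ℕ} {v : B → OCircle}

/-- A vertex that is incident to the three faces around a triangle would be adjacent to all its
vertices. -/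
theorem TriLabels.exists_not_mem (T : TriLabels M C a b c α β γ) (h : M.TriFace a b c)
    (E : Emb G M o) (J : M.Jordan) (hG : G.ThreeConnected) (hc : IsD3aConfig G (o a) (o b) (o c))
    (A : M.Admissible C) {x y z : D} (hxy : o x = o y) (hxz : o x = o z) (ha : o x ≠ o a)
    (hb : o x ≠ o b) (hoc : o x ≠ o c) (hx : α ∈ C x) (hy : β ∈ C y) (hz : γ ∈ C z) : False := by
  have hnd := h.nodup
  simp only [List.nodup_cons, List.mem_cons, List.not_mem_nil, or_false, not_or] at hnd
  -- The faces of `α` and `β` meet along the leg at `b`, so a vertex on both of them is the far end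
  -- of this leg.
  have h1 := E.target_eq J hG (τ := M.vertexPerm b) (c₁ := x) (c₂ := y)
    (by rw [h.b3]; grind) (by rw [h.b3, h.ab]; grind) hxy (by rwa [E.o_vertexPerm])
    (A.face α _ _ (by rw [T.leg_b]; simp) hx)
    (A.face β _ _ (by rw [h.b3, T.edge_a]; simp) hy)
  have h2 := E.target_eq J hG (τ := M.vertexPerm a) (c₁ := y) (c₂ := z)
    (by rw [h.a3]; grind) (by rw [h.a3, h.ca]; grind) (hxy.symm.trans hxz)
    (by rw [E.o_vertexPerm, ← hxy]; exact ha)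
    (A.face β _ _ (by rw [T.leg_a]; simp) hy)
    (A.face γ _ _ (by rw [h.a3, T.edge_c]; simp) hz)
  have a1 := E.adj (M.vertexPerm a)
  have a2 := E.adj (M.vertexPerm b)
  rw [E.o_vertexPerm, h2, ← hxy] at a1
  rw [E.o_vertexPerm, h1] at a2
  exact hc.distinct_pq _ hoc ⟨a1, a2⟩

variable (I : Insertion v (shrinkLabels M C a b c) (C a) α β γ N)
  (T : TriLabels M C a b c α β γ) (h : M.TriFace a b c)

include I T h

theorem TriLabels.upgrade {x y z : B}
    (hE : EmptyTriangle (fun x : {x // M.OffTriangle a b c x} => C x) v x y z)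
    (hx : x ∈ shrinkLabels M C a b c) (hy : y ∈ shrinkLabels M C a b c)
    (hz : z ∈ shrinkLabels M C a b c) (h1 : x ≠ α ∧ x ≠ β ∧ x ≠ γ) :
    EmptyTriangle C (insertDisks v (C a) β γ N) x y z := by
  obtain ⟨n, hn, hn'⟩ := hE
  refine ⟨n, ?_, fun d w hw => I.upgrade hn hx ?_ h1 (T.cover h hw)⟩
  · rw [I.disks_old hx, I.disks_old hy, I.disks_old hz]
    exact hn
  · rintro z ⟨x, hz⟩
    exact hn' x z hz

theorem TriLabels.touch_ring {x y : B} (hxy : [x, y] <:+: γ :: C a ++ [β]) : M.Touch C x y := by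
  change [x, y] <:+: [γ] ++ C a ++ [β] at hxy
  rcases List.pair_infix_append I.ne_nil hxy with hxy | hxy
  · exact Or.inl ⟨M.edgePerm c, by rwa [h.ca, T.edge_c]⟩
  · exact Or.inl ⟨a, by rwa [T.leg_a]⟩

theorem TriLabels.touch_alpha {x : B} (hx : x ∈ C a) : M.Touch C x α := by
  by_cases hw : 2 ≤ (C a).length
  · exact Or.inr ⟨a, hw, hx, by rw [show M.facePerm a = b from h.ab, T.leg_b]; simp⟩
  · obtain ⟨y, hy⟩ : ∃ y, C a = [y] := by
      have := List.length_pos_iff.2 I.ne_nil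
      exact List.length_eq_one_iff.1 (by omega)
    have hb := T.last
    rw [hy] at hx hb
    obtain rfl : x = y := by simpa using hx
    exact Or.inl ⟨b, by rw [hb, T.leg_b]; simp⟩

theorem TriLabels.touch_new {x y : B} (hx : x ∈ C a) (hy : y ∈ C a ∨ y ∈ shrinkLabels M C a b c)
    (hne : x ≠ y) (h1 : inn (insertDisks v (C a) β γ N x) (insertDisks v (C a) β γ N y) = -1) :
    M.Touch C x y ∨ M.Touch C y x := by
  rcases (I.disks_new hx hy hne).2 h1 with rfl | h2 | h2
  · exact Or.inl (T.touch_alpha I h hx)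
  · exact Or.inl (T.touch_ring I h h2)
  · exact Or.inr (T.touch_ring I h h2)

/-- The last disk of the chain, `α` and `β` surround the restored vertex at the origin of `b`; their
gap lies between two ring disks and the outer disk. -/
theorem TriLabels.last_triangle : ∃ x, C b = [x] ∧
    EmptyTriangle C (insertDisks v (C a) β γ N) x α β := by
  obtain ⟨l, x, hl⟩ := (List.eq_nil_or_concat (C a)).resolve_left I.ne_nil
  rw [List.concat_eq_append] at hl
  obtain ⟨n, hn, hn'⟩ := I.frame_pair (b := x) (b' := β) ⟨γ :: l, [], by simp [hl]⟩
  exact ⟨x, by rw [T.last, hl]; simp, n, hn.rot, fun _ _ hz => hn' _ (T.cover h hz)⟩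

theorem TriLabels.head_triangle : ∃ x, C c = [x] ∧
    EmptyTriangle C (insertDisks v (C a) β γ N) x γ α := by
  obtain ⟨x, l, hl⟩ := List.exists_cons_of_ne_nil I.ne_nil
  obtain ⟨n, hn, hn'⟩ := I.frame_pair (b := γ) (b' := x) ⟨[], l ++ [β], by simp [hl]⟩
  exact ⟨x, by rw [T.head, hl]; simp, n, hn, fun _ _ hz => hn' _ (T.cover h hz)⟩

/-- The restored vertex at the corner of the chain sees the chain, then `β`, then `γ`, which is
exactly the inserted ring. -/
theorem TriLabels.ring_a {d : D} (hd : M.vertexPerm.SameCycle a d) :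
    M.RingAt C (insertDisks v (C a) β γ N) d := by
  classical
  have h3 : M.vertexPerm (M.vertexPerm (M.vertexPerm a)) = a := by rw [h.a3, h.ca]
  refine ⟨N, I.three_le, 1, ringIdx (C a) β γ N, fun e he => ?_⟩
  have hch : (γ :: C a ++ [β]).IsChain
      (fun b b' => ringIdx (C a) β γ N b' = ringIdx (C a) β γ N b + 1) :=
    List.isChain_cyclicIdx I.nodup N
  simp only [pull_one]
  rcases sameCycle_of_three h3 (hd.trans he) with rfl | rfl | rfl
  · refine ⟨fun x hx => I.disks_ring (Insertion.mem_ring.2 (Or.inr (Or.inl hx))), ?_⟩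
    rw [T.leg_a]
    exact hch.tail
  · refine ⟨fun x hx => I.disks_ring (Insertion.mem_ring.2 (Or.inr (Or.inr ?_))), ?_⟩
    · simpa [T.leg_a] using hx
    · rw [h.a3, T.leg_a, T.edge_c]
      simp [Insertion.idx_gamma, I.idx_beta]
  · rw [h.a3, h.ca]
    refine ⟨fun x hx => I.disks_ring (Insertion.mem_ring.2 (Or.inl ?_)), ?_⟩
    · simpa [T.edge_c] using hx
    · rw [T.edge_c]
      exact hch.left_of_append

end

end CombMap

namespace CombMap

open OCircle

variable {D B V : Type u} {G : SimpleGraph V} {M : CombMap D} {o : D → V} {C : D → List B}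
  {a b c : D} {α β γ : B} {N : ℕ} {v : B → OCircle}

/-- The three labels of a gap are distinct. Unless they are `α`, `β`, `γ`, one of them differs from
all of these, and `upgrade` applies after a rotation. -/
theorem TriLabels.upgrade_of_exists (I : Insertion v (shrinkLabels M C a b c) (C a) α β γ N)
    (T : TriLabels M C a b c α β γ) (h : M.TriFace a b c) {x y z : B}
    (hE : EmptyTriangle (fun x : {x // M.OffTriangle a b c x} => C x) v x y z)
    (hx : x ∈ shrinkLabels M C a b c) (hy : y ∈ shrinkLabels M C a b c)
    (hz : z ∈ shrinkLabels M C a b c) (H : α = x ∨ α = y ∨ α = z → β = x ∨ β = y ∨ β = z →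
      γ = x ∨ γ = y ∨ γ = z → False) : EmptyTriangle C (insertDisks v (C a) β γ N) x y z := by
  by_cases n1 : x ≠ α ∧ x ≠ β ∧ x ≠ γ
  · exact T.upgrade I h hE hx hy hz n1
  by_cases n2 : y ≠ α ∧ y ≠ β ∧ y ≠ γ
  · exact (T.upgrade I h hE.rot hy hz hx n2).rot.rot
  by_cases n3 : z ≠ α ∧ z ≠ β ∧ z ≠ γ
  · exact (T.upgrade I h hE.rot.rot hz hx hy n3).rot
  exfalso
  obtain ⟨n, hn, -⟩ := hE
  have n12 : x ≠ y := fun h' => hn.ne (h' ▸ rfl)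
  have n23 : y ≠ z := fun h' => hn.rot.ne (h' ▸ rfl)
  have n31 : z ≠ x := fun h' => hn.rot.rot.ne (h' ▸ rfl)
  clear hn hx hy hz I T h
  grind

variable [Finite D]

theorem LegLabels.touch (F : LegLabels M C a b c) (h : M.TriFace a b c) (A : M.Admissible C)
    {x y : B} (hxy : (CombMap.shrink h).Touch (fun x => C x) x y) : M.Touch C x y := by
  rcases hxy with ⟨e, he⟩ | ⟨d, hd, h1, h2⟩
  · dsimp only at he
    rw [F.label_next h] at he
    exact Or.inl ⟨e, he⟩
  · dsimp only at h1 h2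
    rw [F.label_next h, (F.face_step h rfl (A.chain d hd).tri).1] at h2
    exact Or.inr ⟨d, hd, h1, h2⟩

/-- Old disks stay in place, so old rings and contacts persist. The ring at the restored vertices is
the inserted ring or a ring of three, and gaps are either gaps of the inserted ring or upgraded old
gaps. -/
theorem Realizes.of_shrink_aux (h : M.TriFace a b c)
    (R : Realizes (CombMap.shrink h) (fun x => C x) v)
    (I : Insertion v (shrinkLabels M C a b c) (C a) α β γ N)
    (T : TriLabels M C a b c α β γ) (F : LegLabels M C a b c)
    (E : Emb G M o) (J : M.Jordan) (hG : G.ThreeConnected) (hc : IsD3aConfig G (o a) (o b) (o c))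
    (A : M.Admissible C) (hb : ¬ 2 ≤ (C b).length) (hcl : ¬ 2 ≤ (C c).length) :
    Realizes M C (insertDisks v (C a) β γ N) := by
  have cov := fun {z : B} {x : D} (hz : z ∈ C x) => T.cover h hz
  have hnew : ∀ x, o x ≠ o a → o x ≠ o b → o x ≠ o c → M.OffTriangle a b c x := by
    intro x h1 h2 h3
    by_contra hx
    have e1 := E.o_edge h
    have e2 := E.o_edge h.rotate
    have e3 := E.o_edge h.rotate.rotate
    rcases not_offTriangle.1 hx with rfl | rfl | rfl | rfl | rfl | rfl
    exacts [h1 rfl, h2 rfl, h3 rfl, h2 e1, h3 e2, h1 e3]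
  have hleg : ∀ x, o x ≠ o a → o x ≠ o b → o x ≠ o c →
      x ≠ M.vertexPerm a ∧ x ≠ M.vertexPerm b ∧ x ≠ M.vertexPerm c := by
    intro x h1 h2 h3
    refine ⟨?_, ?_, ?_⟩ <;> rintro rfl
    exacts [h1 (E.o_vertexPerm _), h2 (E.o_vertexPerm _), h3 (E.o_vertexPerm _)]
  have old : ∀ x : {x // M.OffTriangle a b c x}, ∀ z ∈ C x, z ∈ shrinkLabels M C a b c :=
    fun x z hz => ⟨x, hz⟩
  have hb3 : M.vertexPerm (M.vertexPerm (M.vertexPerm b)) = b := by rw [h.b3, h.ab]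
  have hc3 : M.vertexPerm (M.vertexPerm (M.vertexPerm c)) = c := by rw [h.c3, h.bc]
  obtain ⟨xb, hxb, hEb⟩ := T.last_triangle I h
  obtain ⟨xc, hxc, hEc⟩ := T.head_triangle I h
  refine ⟨fun d z hz => I.disks_norm (cov hz), fun d d' z hz z' hz' hne =>
    I.disks_sep (cov hz) (cov hz') hne, fun d d' z hz z' hz' hne h1 => ?_, fun d => ?_,
    fun d b₁ b₂ b₃ h3 h1 h2 h4 => ?_, fun d x y z hd hxy hz => ?_⟩
  · rcases cov hz with hza | hzS
    · exact T.touch_new I h hza (cov hz') hne h1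
    rcases cov hz' with hza' | hzS'
    · rw [inn_comm] at h1
      exact (T.touch_new I h hza' (Or.inr hzS) hne.symm h1).symm
    rw [I.disks_old hzS, I.disks_old hzS'] at h1
    obtain ⟨x, hx⟩ := hzS
    obtain ⟨x', hx'⟩ := hzS'
    exact (R.touch x x' z hx z' hx' hne h1).imp (F.touch h A) (F.touch h A)
  · by_cases ha : o d = o a
    · exact T.ring_a I h ((E.same _ _).2 ha.symm)
    by_cases hob : o d = o b
    · obtain ⟨n, hn, -⟩ := hEb
      exact ringAt_of_frame hb3 hxb T.leg_b (by rw [h.b3, T.edge_a]) hn ((E.same _ _).2 hob.symm)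
    by_cases hoc : o d = o c
    · obtain ⟨n, hn, -⟩ := hEc
      exact ringAt_of_frame hc3 hxc T.leg_c (by rw [h.c3, T.edge_b]) hn ((E.same _ _).2 hoc.symm)
    obtain ⟨n, hn, g, P, hP⟩ := R.ring ⟨d, hnew d ha hob hoc⟩
    refine ⟨n, hn, g, P, fun e he => ?_⟩
    have hoe := (E.same _ _).1 he
    have hoff := hnew e (hoe ▸ ha) (hoe ▸ hob) (hoe ▸ hoc)
    obtain ⟨h1, h2⟩ := hP ⟨e, hoff⟩ (h.shrink_sameCycle he)
    dsimp only at h1 h2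
    rw [F.label_next h] at h2
    refine ⟨fun z hz => ?_, h2⟩
    rw [I.disks_old (old ⟨e, hoff⟩ z hz)]
    exact h1 z hz
  · by_cases ha : o d = o a
    · have ha3 : M.vertexPerm (M.vertexPerm (M.vertexPerm a)) = a := by rw [h.a3, h.ca]
      have hs := (E.same _ _).2 ha.symm
      obtain ⟨x, hx⟩ : ∃ x, C a = [x] := by
        rcases sameCycle_of_three ha3 hs with rfl | rfl | rfl
        · exact ⟨_, h1⟩
        · rw [ha3] at h4; exact ⟨_, h4⟩
        · rw [ha3] at h2; exact ⟨_, h2⟩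
      obtain ⟨n, hn, hn'⟩ := I.frame_three hx
      have hE : EmptyTriangle C (insertDisks v (C a) β γ N) x β γ :=
        ⟨n, hn.rot, fun _ _ hz => hn' _ (cov hz)⟩
      exact hE.of_sameCycle ha3 hx T.leg_a (by rw [h.a3, T.edge_c]) hs h1 h2 h4
    by_cases hob : o d = o b
    · exact hEb.of_sameCycle hb3 hxb T.leg_b (by rw [h.b3, T.edge_a]) ((E.same _ _).2 hob.symm)
        h1 h2 h4
    by_cases hoc : o d = o c
    · exact hEc.of_sameCycle hc3 hxc T.leg_c (by rw [h.c3, T.edge_b]) ((E.same _ _).2 hoc.symm)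
        h1 h2 h4
    have hoff := hnew d ha hob hoc
    have o1 := E.o_vertexPerm d
    have o2 := (E.o_vertexPerm (M.vertexPerm d)).trans o1
    obtain ⟨s1, t1⟩ := h.vertex_step (d := ⟨d, hoff⟩) rfl (hleg d ha hob hoc)
    obtain ⟨s2, t2⟩ := h.vertex_step s1 t1
    have hE := R.vertex ⟨d, hoff⟩ b₁ b₂ b₃
      (h.vertex_cycle rfl (hleg d ha hob hoc) h3) h1 (by rw [s1]; exact h2) (by rw [s2]; exact h4)
    have m1 := old ⟨d, hoff⟩ b₁ (by simp [h1])
    have m2 := old ⟨_, hnew _ (o1 ▸ ha) (o1 ▸ hob) (o1 ▸ hoc)⟩ b₂ (by simp [h2])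
    have m3 := old ⟨_, hnew _ (o2 ▸ ha) (o2 ▸ hob) (o2 ▸ hoc)⟩ b₃ (by simp [h4])
    -- The only vertex gap not covered by `upgrade` has the labels `α`, `β`, `γ`; planarity and the
    -- distinct outside neighbours exclude such a vertex.
    refine T.upgrade_of_exists I h hE m1 m2 m3 fun hα hβ hγ => ?_
    have key : ∀ {z}, z = b₁ ∨ z = b₂ ∨ z = b₃ → ∃ x, o x = o d ∧ z ∈ C x := by
      rintro z (rfl | rfl | rfl)
      exacts [⟨d, rfl, by simp [h1]⟩, ⟨_, o1, by simp [h2]⟩, ⟨_, o2, by simp [h4]⟩]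
    obtain ⟨x, hx, hx'⟩ := key hα
    obtain ⟨y, hy, hy'⟩ := key hβ
    obtain ⟨z, hz, hz'⟩ := key hγ
    exact T.exists_not_mem h E J hG hc A (hx.trans hy.symm) (hx.trans hz.symm) (hx ▸ ha)
      (hx ▸ hob) (hx ▸ hoc) hx' hy' hz'
  · by_cases hda : d = a
    · subst hda
      rw [show M.facePerm d = b from h.ab, T.leg_b, List.mem_singleton] at hz
      subst hz
      obtain ⟨n, hn, hn'⟩ := I.frame_pair (b := x) (b' := y)
        (hxy.trans ⟨[γ], [β], by simp⟩)
      exact ⟨n, hn, fun _ _ hz => hn' _ (cov hz)⟩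
    have hch := A.chain d hd
    have hoff := F.offTriangle hch.tri ⟨hda, fun h' => hb (h' ▸ hd), fun h' => hcl (h' ▸ hd)⟩
    obtain ⟨s1, t1⟩ := F.face_step h (d := ⟨d, hoff⟩) rfl hch.tri
    have hE := R.fan ⟨d, hoff⟩ x y z hd hxy (by rwa [F.label_next h, s1])
    have hxm : x ∈ C d := hxy.sublist.subset (by simp)
    have hym : y ∈ C d := hxy.sublist.subset (by simp)
    -- The disk `y` belongs to a triangular face, while `α`, `β`, `γ` belong to the faces along the
    -- legs, which are not triangles.
    refine T.upgrade I h hE ⟨⟨d, hoff⟩, hym⟩ ⟨⟨d, hoff⟩, hxm⟩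
      ⟨(CombMap.shrink h).vertexPerm ((CombMap.shrink h).facePerm ⟨d, hoff⟩),
        by rwa [F.label_next h, s1]⟩ ⟨?_, ?_, ?_⟩ <;> rintro rfl
    · exact (F.leg_b d (A.face y _ _ (by rw [T.leg_b]; simp) hym)).1 hch.tri
    · exact (F.leg_a d (A.face y _ _ (by rw [T.leg_a]; simp) hym)).1 hch.tri
    · exact (F.leg_c d (A.face y _ _ (by rw [T.leg_c]; simp) hym)).1 hch.tri

theorem Realizes.of_shrink (h : M.TriFace a b c)
    (E : Emb G M o) (J : M.Jordan) (hG : G.ThreeConnected) (hc : IsD3aConfig G (o a) (o b) (o c))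
    (A : M.Admissible C) (hb : ¬ 2 ≤ (C b).length) (hcl : ¬ 2 ≤ (C c).length)
    (R : ∃ v, Realizes (CombMap.shrink h) (fun x => C x) v) : ∃ v, Realizes M C v := by
  have F := A.legLabels E h hc
  obtain ⟨v, R⟩ := R
  obtain ⟨α, β, γ, T⟩ := F.exists_triLabels A h hb hcl
  obtain ⟨v, N, R, I⟩ := T.exists_insertion h A R
  exact ⟨_, R.of_shrink_aux h I T F E J hG hc A hb hcl⟩

end CombMap

/-! ### The complete graph on four vertices -/

namespace CombMap

open OCircle

variable {D B V : Type u} {G : SimpleGraph V} {M : CombMap D} {o : D → V} {C : D → List B}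

/-- The map is the embedding of the tetrahedron. -/
structure IsTetrahedron (M : CombMap D) : Prop where
  vertex_three : ∀ x, M.vertexPerm (M.vertexPerm (M.vertexPerm x)) = x
  face_three : ∀ x, M.facePerm (M.facePerm (M.facePerm x)) = x
  vertex_ne : ∀ x, M.vertexPerm x ≠ x
  eq_of_sameCycle : ∀ x y, M.vertexPerm.SameCycle x y → M.facePerm.SameCycle x y → x = y
  cover : ∀ d x, ∃ e, M.vertexPerm.SameCycle d e ∧
    (x = e ∨ x = M.edgePerm e ∨ x = M.facePerm e ∨ x = M.edgePerm (M.facePerm e))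

namespace IsTetrahedron

variable (H : M.IsTetrahedron)

include H

theorem face_face (d : D) : M.facePerm (M.facePerm (M.vertexPerm d)) = M.edgePerm d := by
  apply M.facePerm.injective
  rw [H.face_three, facePerm_edgePerm]

theorem next_face (d : D) :
    M.vertexPerm (M.facePerm d) = M.edgePerm (M.facePerm (M.vertexPerm d)) := by
  apply M.vertexPerm.injective
  rw [← facePerm_apply, H.face_face, facePerm_apply, H.vertex_three]

theorem next_outer (d : D) :
    M.facePerm (M.edgePerm (M.facePerm d)) = M.edgePerm (M.facePerm (M.vertexPerm d)) := by
  rw [facePerm_edgePerm, H.next_face]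

theorem next_next_face (d : D) :
    M.vertexPerm (M.vertexPerm (M.facePerm d)) = M.edgePerm d := by
  rw [H.next_face, ← facePerm_apply, H.face_face]

end IsTetrahedron

/-- Two consecutive edges of a face close up to a triangle, which bounds a face because the rest of
a complete graph is connected. -/
theorem _root_.Emb.isTetrahedron (E : Emb G M o) (J : M.Jordan)
    (hG : Nonempty (G ≃g (⊤ : SimpleGraph (Fin 4)))) (h3 : G.ThreeConnected) :
    M.IsTetrahedron := by
  obtain ⟨i⟩ := hG
  have adj : ∀ u v, u ≠ v → G.Adj u v := by
    intro u v huv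
    rw [← i.map_adj_iff]
    simpa using huv
  have hcard : Nat.card V = 4 := by rw [Nat.card_congr i.toEquiv]; simp
  have hfin : Finite V := Finite.of_equiv _ i.symm.toEquiv
  have deg : ∀ v, (G.neighborSet v).ncard = 3 := by
    intro v
    have : G.neighborSet v = {v}ᶜ := by
      ext w
      simp only [SimpleGraph.mem_neighborSet, Set.mem_compl_iff, Set.mem_singleton_iff]
      exact ⟨fun h h' => h.ne h'.symm, fun h => adj _ _ fun h' => h h'.symm⟩
    rw [this, Set.ncard_compl, Set.ncard_singleton, hcard]
  have three := fun x => E.three (deg (o x))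
  have face : ∀ x, M.facePerm (M.facePerm (M.facePerm x)) = x := by
    intro x
    obtain ⟨y, hy⟩ : ∃ y, M.facePerm x = y := ⟨_, rfl⟩
    have oy : o y = o (M.edgePerm x) := by rw [← hy, facePerm_apply, E.o_vertexPerm]
    have hne : o (M.edgePerm y) ≠ o x := by
      intro h
      have := E.uniq y (M.edgePerm x) oy (by rw [M.edgePerm_edgePerm, h])
      exact (three (M.edgePerm x)).2.1 (by rw [← facePerm_apply, hy, this])
    obtain ⟨z, hz, hz'⟩ := E.ex _ _ (adj _ _ hne)
    rcases E.triangle_face J oy.symm hz.symm hz' (by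
      intro c hc u hu v hv
      by_cases huv : u = v
      · rw [huv]
      · exact hc u hu v hv (adj _ _ huv)) with ⟨h1, h2, h4⟩ | ⟨h1, h2, h4⟩
    · rw [h1, h2, h4]
    -- Were the face on the other side of the triangle, the middle vertex would have only two darts.
    · exfalso
      rw [facePerm_edgePerm] at h4
      apply (three (M.edgePerm x)).2.2
      rw [← facePerm_apply, hy, h4]
  refine ⟨fun x => (three x).1, face, fun x => (three x).2.1, fun x y h1 h2 =>
    E.eq_of_sameCycle J h3 ((E.same _ _).1 h1) h2, fun d x => ?_⟩
  · by_cases hx : o x = o d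
    · exact ⟨x, (E.same _ _).2 hx.symm, Or.inl rfl⟩
    · obtain ⟨e, h1, h2⟩ := E.ex _ _ (adj (o d) (o x) fun h => hx h.symm)
      have hd := (E.same _ _).2 h1.symm
      rcases sameCycle_of_three (three (M.edgePerm e)).1 ((E.same _ _).2 h2) with rfl | rfl | rfl
      · exact ⟨e, hd, Or.inr (Or.inl rfl)⟩
      · exact ⟨e, hd, Or.inr (Or.inr (Or.inl rfl))⟩
      · refine ⟨M.vertexPerm e, hd.trans (sameCycle_apply_self _ _), Or.inr (Or.inr (Or.inr ?_))⟩
        apply M.vertexPerm.injective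
        rw [(three _).1, ← facePerm_apply]
        apply M.facePerm.injective
        rw [face, facePerm_edgePerm]

/-- All corners outside the hub carry a single disk, and the outer face carries the disk `α`. -/
structure IsHub (M : CombMap D) (C : D → List B) (d : D) (α : B) : Prop where
  rim : ∀ e, M.vertexPerm.SameCycle d e → C (M.facePerm e) = (C e).getLast?.toList
  spoke : ∀ e, M.vertexPerm.SameCycle d e → C (M.edgePerm e) = (C (M.vertexPerm e)).head?.toList
  outer : ∀ e, M.vertexPerm.SameCycle d e → C (M.edgePerm (M.facePerm e)) = [α]

/-- If a corner with a chain exists, its vertex is the hub; otherwise any vertex will do. All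
corners away from the hub then carry single labels. -/
theorem IsTetrahedron.exists_isHub [Nonempty D] (H : M.IsTetrahedron) (A : M.Admissible C) :
    ∃ d α, M.IsHub C d α := by
  obtain ⟨d, hd⟩ : ∃ d, ∀ e, M.vertexPerm.SameCycle d e → ¬ 2 ≤ (C (M.facePerm e)).length ∧
      ¬ 2 ≤ (C (M.edgePerm e)).length ∧ ¬ 2 ≤ (C (M.edgePerm (M.facePerm e))).length := by
    by_cases hW : ∃ d, 2 ≤ (C d).length
    · obtain ⟨d, hW⟩ := hW
      refine ⟨d, fun e he => ?_⟩
      -- In the tetrahedron, the corners mentioned in the last five fields of `AdmissibleAt`,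
      -- together with the two ends of the chain, account for all but two of the corners off the
      -- hub. A chain at one of these two would violate the same conditions at `d`.
      have hd := A.chain d hW
      have f := H.next_face
      have k := H.face_face
      have l := H.next_next_face
      have n := H.next_outer
      have v := H.vertex_three d
      have k2 := k (M.vertexPerm (M.vertexPerm d))
      have k1 := k (M.vertexPerm d)
      have f2 := f (M.vertexPerm (M.vertexPerm d))
      have l2 := l (M.vertexPerm (M.vertexPerm d))
      rw [v] at k2 f2
      have h2 := hd.fst_one
      have h3 := hd.fst_two
      have h4 := hd.snd_one
      have h5 := hd.snd_two
      have h6 := hd.opposite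
      rw [k2, ← facePerm_apply] at h4 h5
      rw [f2] at h5
      rw [l] at h3
      rw [f, n] at h6
      rw [f] at h2
      rcases sameCycle_of_three (H.vertex_three d) he with rfl | rfl | rfl
      · exact ⟨A.not_fst hW, h3, h5⟩
      · refine ⟨fun h' => ?_, fun h' => ?_, h2⟩
        · have := (A.chain _ h').snd_two
          rw [H.face_three, v] at this
          exact this hW
        · have := (A.chain _ h').fst_one
          rw [facePerm_edgePerm, v] at this
          exact this hW
      · refine ⟨h4, ?_, h6⟩
        have := A.not_snd hW
        rwa [k2] at this
    · obtain ⟨d⟩ := ‹Nonempty D›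
      push Not at hW
      exact ⟨d, fun e _ => ⟨(hW _).not_ge, (hW _).not_ge, (hW _).not_ge⟩⟩
  obtain ⟨α, hα⟩ := A.exists_eq_singleton (hd d (Equiv.Perm.SameCycle.refl _ _)).2.2
  have next : ∀ {e}, M.vertexPerm.SameCycle d e → M.vertexPerm.SameCycle d (M.vertexPerm e) :=
    fun he => he.trans (sameCycle_apply_self _ _)
  have out : ∀ e, M.vertexPerm.SameCycle d e → C (M.edgePerm (M.facePerm (M.vertexPerm e))) =
      C (M.edgePerm (M.facePerm e)) := by
    intro e he
    have h1 := A.const (M.edgePerm (M.facePerm (M.vertexPerm (M.vertexPerm e))))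
      (hd _ (next (next he))).2.2
    rw [H.next_outer, H.vertex_three, H.next_outer] at h1
    exact h1 (hd _ he).2.2 (hd _ (next he)).2.2
  refine ⟨d, α, fun e he => ?_, fun e he => ?_, fun e he => ?_⟩
  · obtain ⟨z, rfl⟩ := M.vertexPerm.surjective e
    have hz : M.vertexPerm.SameCycle d z := he.trans (sameCycle_apply_self _ _).symm
    exact (A.ends (H.face_three _) (hd _ he).1 (by rw [H.face_face]; exact (hd z hz).2.1)).1
  · have := (A.ends (H.face_three (M.vertexPerm e)) (hd _ (next he)).1
      (by rw [H.face_face]; exact (hd e he).2.1)).2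
    rwa [H.face_face] at this
  · rcases sameCycle_of_three (H.vertex_three d) he with rfl | rfl | rfl
    · exact hα
    · rw [out _ (Equiv.Perm.SameCycle.refl _ _), hα]
    · rw [out _ (next (Equiv.Perm.SameCycle.refl _ _)), out _ (Equiv.Perm.SameCycle.refl _ _), hα]

end CombMap

/-! ### The regular ring around the hub of a tetrahedron -/

namespace CombMap

open OCircle

variable {D B V : Type u} {M : CombMap D} {C : D → List B} {d : D} {α β γ : B}

/-- The labels around the hub, in cyclic order. -/
def hubLabels (M : CombMap D) (C : D → List B) (d : D) : List B :=
  C d ++ C (M.vertexPerm d) ++ C (M.vertexPerm (M.vertexPerm d))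

namespace IsHub

variable (U : M.IsHub C d α) (H : M.IsTetrahedron) (A : M.Admissible C)

theorem mem_hubLabels (H : M.IsTetrahedron) {e : D} (he : M.vertexPerm.SameCycle d e) {z : B}
    (hz : z ∈ C e) : z ∈ hubLabels M C d := by
  simp only [hubLabels, List.mem_append]
  rcases sameCycle_of_three (H.vertex_three d) he with rfl | rfl | rfl
  exacts [Or.inl (Or.inl hz), Or.inl (Or.inr hz), Or.inr hz]

include A in
theorem nodup_hubLabels (H : M.IsTetrahedron) : (hubLabels M C d).Nodup := by
  have key : ∀ x y, M.vertexPerm.SameCycle x y → x ≠ y → ∀ z ∈ C x, ∀ z' ∈ C y, z ≠ z' :=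
    fun x y hxy hne z hz z' hz' h => hne (H.eq_of_sameCycle x y hxy (A.face z x y hz (h ▸ hz')))
  have s := sameCycle_apply_self M.vertexPerm
  simp only [hubLabels, List.nodup_append, List.mem_append]
  refine ⟨⟨A.nodup _, A.nodup _, key _ _ (s _) (H.vertex_ne d).symm⟩, A.nodup _, ?_⟩
  rintro z (hz | hz)
  · refine key _ _ ((s _).trans (s _)) (fun h => H.vertex_ne d ?_) z hz
    have := H.vertex_three d
    rwa [← h] at this
  · exact key _ _ (s _) (H.vertex_ne _).symm z hz

include U A in
theorem not_mem_hubLabels (H : M.IsTetrahedron) : α ∉ hubLabels M C d := by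
  have key : ∀ e, M.vertexPerm.SameCycle d e → α ∉ C e := by
    intro e he h
    have h1 := A.face α e (M.edgePerm (M.facePerm (M.vertexPerm e))) h
      (by rw [U.outer _ (he.trans (sameCycle_apply_self _ _))]; simp)
    rw [← H.next_face] at h1
    exact H.vertex_ne _ (H.eq_of_sameCycle _ _ (sameCycle_apply_self _ _)
      ((sameCycle_apply_self _ _).symm.trans h1)).symm
  have s := sameCycle_apply_self M.vertexPerm
  simp only [hubLabels, List.mem_append, not_or]
  exact ⟨⟨key _ (Equiv.Perm.SameCycle.refl _ _), key _ (s _)⟩, key _ ((s _).trans (s _))⟩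

include U in
theorem mem_or_eq (H : M.IsTetrahedron) {x : D} {z : B} (hz : z ∈ C x) :
    z ∈ hubLabels M C d ∨ z = α := by
  obtain ⟨e, he, rfl | rfl | rfl | rfl⟩ := H.cover d x
  · exact Or.inl (mem_hubLabels H he hz)
  · rw [U.spoke e he, Option.mem_toList] at hz
    exact Or.inl (mem_hubLabels H (he.trans (sameCycle_apply_self _ _)) (List.mem_of_mem_head? hz))
  · rw [U.rim e he, Option.mem_toList] at hz
    exact Or.inl (mem_hubLabels H he (List.mem_of_getLast? hz))
  · rw [U.outer e he, List.mem_singleton] at hz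
    exact Or.inr hz

include A in
theorem touch_of_pair {x y : B} (h : [x, y] <:+: hubLabels M C d) : M.Touch C x y := by
  rcases List.pair_infix_append (A.ne_nil _) h with h | h
  exacts [Or.inl ⟨_, h⟩, Or.inl ⟨_, h⟩]

include U A in
theorem touch_alpha (H : M.IsTetrahedron) {x : B} (h : x ∈ hubLabels M C d) : M.Touch C x α := by
  obtain ⟨e, he, hx⟩ : ∃ e, M.vertexPerm.SameCycle d e ∧ x ∈ C e := by
    have s := sameCycle_apply_self M.vertexPerm
    simp only [hubLabels, List.mem_append] at h
    rcases h with (h | h) | h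
    exacts [⟨_, Equiv.Perm.SameCycle.refl _ _, h⟩, ⟨_, s _, h⟩, ⟨_, (s _).trans (s _), h⟩]
  have hα : C (M.vertexPerm (M.facePerm e)) = [α] := by
    rw [H.next_face, U.outer _ (he.trans (sameCycle_apply_self _ _))]
  by_cases hw : 2 ≤ (C e).length
  · exact Or.inr ⟨e, hw, hx, by simp [hα]⟩
  · obtain ⟨y, hy⟩ := A.exists_eq_singleton hw
    have h1 := U.rim e he
    rw [hy] at h1 hx
    obtain rfl : x = y := by simpa using hx
    exact Or.inl ⟨M.facePerm e, by simp [h1, hα]⟩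

-- The labels around the hub are read as `γ`, `X`, `β`, so that the tetrahedron is an insertion into
-- a packing of only three disks.
include U A in
theorem exists_insertion (H : M.IsTetrahedron) : ∃ v X β γ N, Insertion v {α, β, γ} X α β γ N ∧
    hubLabels M C d = γ :: X ++ [β] ∧ (C d).head? = some γ ∧
      (C (M.vertexPerm (M.vertexPerm d))).getLast? = some β := by
  classical
  obtain ⟨γ, l, hl⟩ := List.exists_cons_of_ne_nil (A.ne_nil d)
  obtain ⟨l', β, hl'⟩ := (List.eq_nil_or_concat (C (M.vertexPerm (M.vertexPerm d)))).resolve_left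
    (A.ne_nil _)
  rw [List.concat_eq_append] at hl'
  obtain ⟨X, hX⟩ : ∃ X, X = l ++ C (M.vertexPerm d) ++ l' := ⟨_, rfl⟩
  have hL : hubLabels M C d = γ :: X ++ [β] := by simp [hubLabels, hl, hl', hX]
  have hX0 : X ≠ [] := by
    have := A.ne_nil (M.vertexPerm d)
    simp [hX, this]
  have hlen := List.length_pos_iff.2 hX0
  have hN : 3 ≤ X.length + 2 := by omega
  have hnd := nodup_hubLabels A H (d := d)
  have hα := U.not_mem_hubLabels A H
  rw [hL] at hnd hα
  simp only [List.cons_append, List.mem_cons, List.mem_append, List.not_mem_nil, or_false,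
    not_or] at hα
  have hγβ : γ ≠ β := by
    rintro rfl
    simp at hnd
  have hF := frame_rd hN (-1)
  rw [neg_add_cancel] at hF
  -- Only the values at `α`, `β`, `γ` matter, since `insertDisks` overwrites those on `X`.
  obtain ⟨v, hv⟩ : ∃ v : B → OCircle, v = fun z => if z = α then od (X.length + 2) else
    if z = β then rd (X.length + 2) (-1) else rd (X.length + 2) 0 := ⟨_, rfl⟩
  have va : v α = od (X.length + 2) := by simp [hv]
  have vb : v β = rd (X.length + 2) (-1) := by simp [hv, Ne.symm hα.2.2]
  have vc : v γ = rd (X.length + 2) 0 := by simp [hv, Ne.symm hα.1, hγβ]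
  have h1 := hF.inn_ab
  have h2 := hF.rot.inn_ab
  have h3 := hF.rot.rot.inn_ab
  refine ⟨v, X, β, γ, X.length + 2,
      ⟨rfl, hX0, hnd, by simp, by simp, by simp, ?_, va, vb, vc, ?_, ?_,
    ?_⟩, hL, by simp [hl], by simp [hl']⟩
  · rintro z (rfl | rfl | rfl)
    · exact hα.2.1
    · rw [List.cons_append, List.nodup_cons, List.nodup_append] at hnd
      exact fun h => hnd.2.2.2 _ h z (by simp) rfl
    · rw [List.cons_append, List.nodup_cons, List.mem_append] at hnd
      exact fun h => hnd.1 (Or.inl h)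
  · rintro z (rfl | rfl | rfl)
    · rw [va]; exact inn_od_self hN
    · rw [vb]; exact inn_rd_self hN _
    · rw [vc]; exact inn_rd_self hN _
  · rintro z (rfl | rfl | rfl) z' (rfl | rfl | rfl) hne <;>
      first | exact (hne rfl).elim | rw [va, vb] | rw [va, vc] | rw [vb, vc]
    · exact h3.le
    · rw [inn_comm]; exact h2.le
    · rw [inn_comm]; exact h3.le
    · exact h1.le
    · exact h2.le
    · rw [inn_comm]; exact h1.le
  · rintro z (rfl | rfl | rfl)
    · rw [va]; exact hF.rot.rot.inn_na.le
    · rw [vb]; exact hF.inn_na.le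
    · rw [vc]; exact hF.rot.inn_na.le

end IsHub

/-- The disks around the hub form a regular ring and the face opposite to it becomes the outer disk.
Each other vertex sees the outer disk and two consecutive disks of the ring. -/
theorem IsTetrahedron.exists_realizes [Nonempty D] (H : M.IsTetrahedron) (A : M.Admissible C) :
    ∃ v, Realizes M C v := by
  classical
  obtain ⟨d, α, U⟩ := H.exists_isHub A
  obtain ⟨v, X, β, γ, N, I, hL, hhead, hlast⟩ := U.exists_insertion A H
  have hN := I.three_le
  have cov : ∀ {x z}, z ∈ C x → z ∈ X ∨ z ∈ ({α, β, γ} : Set B) := by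
    intro x z hz
    have := U.mem_or_eq H hz
    rw [hL, Insertion.mem_ring] at this
    simp only [Set.mem_insert_iff, Set.mem_singleton_iff]
    tauto
  have ringd : ∀ {z}, z ∈ hubLabels M C d →
      insertDisks v X β γ N z = rd N (ringIdx X β γ N z) := fun hz => I.disks_ring (hL ▸ hz)
  have next : ∀ {e}, M.vertexPerm.SameCycle d e → M.vertexPerm.SameCycle d (M.vertexPerm e) :=
    fun he => he.trans (sameCycle_apply_self _ _)
  have three := H.vertex_three
  -- The pair `β`, `γ` that closes the ring is not covered by `frame_pair`. Its gap is empty as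
  -- well, since no disks exist besides the ring and the outer disk.
  have wrap : ∃ n, Frame (insertDisks v X β γ N γ) (insertDisks v X β γ N β)
      (insertDisks v X β γ N α) n ∧ ∀ z, z ∈ X ∨ z ∈ ({α, β, γ} : Set B) →
        inn n (insertDisks v X β γ N z) ≤ 0 := by
    have hF := frame_rd hN (-1)
    rw [neg_add_cancel] at hF
    refine ⟨neg (oc N (-1)), ?_, fun z hz => ?_⟩
    · rw [I.disks_alpha, I.disks_old I.beta_mem, I.disks_old I.gamma_mem, I.v_beta, I.v_gamma]
      exact hF.flip
    · rw [inn_neg_left, neg_nonpos]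
      by_cases hα : z = α
      · rw [hα, I.disks_alpha, inn_oc_od hN]
      · rw [I.disks_ring]
        · exact inn_oc_rd hN _ _
        · rw [Insertion.mem_ring]
          simp only [Set.mem_insert_iff, Set.mem_singleton_iff] at hz
          tauto
  have tri : ∀ e, M.vertexPerm.SameCycle d e → ∃ x y, C (M.facePerm e) = [x] ∧
      C (M.edgePerm e) = [y] ∧ EmptyTriangle C (insertDisks v X β γ N) y x α := by
    intro e he
    obtain ⟨l, x, hx⟩ := (List.eq_nil_or_concat (C e)).resolve_left (A.ne_nil e)
    rw [List.concat_eq_append] at hx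
    obtain ⟨y, l', hy⟩ := List.exists_cons_of_ne_nil (A.ne_nil (M.vertexPerm e))
    have hp : [x, y] <:+: C e ++ C (M.vertexPerm e) := ⟨l, l', by simp [hx, hy]⟩
    have h1 := U.rim e he
    have h2 := U.spoke e he
    refine ⟨x, y, by simp [h1, hx], by simp [h2, hy], ?_⟩
    suffices ∃ n, Frame (insertDisks v X β γ N y) (insertDisks v X β γ N x)
        (insertDisks v X β γ N α) n ∧ ∀ z, z ∈ X ∨ z ∈ ({α, β, γ} : Set B) →
          inn n (insertDisks v X β γ N z) ≤ 0 by
      obtain ⟨n, hn, hn'⟩ := this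
      exact ⟨n, hn, fun _ _ hz => hn' _ (cov hz)⟩
    rcases sameCycle_of_three (three d) he with rfl | rfl | rfl
    · apply I.frame_pair
      rw [← hL]
      exact hp.trans (List.prefix_append _ _).isInfix
    · apply I.frame_pair
      rw [← hL, hubLabels, List.append_assoc]
      exact hp.trans (List.suffix_append _ _).isInfix
    · rw [three] at hy
      rw [hx] at hlast
      rw [hy] at hhead
      obtain rfl : x = β := by simpa using hlast
      obtain rfl : y = γ := by simpa using hhead
      exact wrap
  have rim : ∀ x, ¬ M.vertexPerm.SameCycle d x → ∃ e, M.vertexPerm.SameCycle d e ∧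
      M.vertexPerm.SameCycle (M.edgePerm e) x := by
    intro x hx
    obtain ⟨e, he, rfl | rfl | rfl | rfl⟩ := H.cover d x
    · exact (hx he).elim
    · exact ⟨e, he, Equiv.Perm.SameCycle.refl _ _⟩
    · exact ⟨e, he, sameCycle_apply_self _ _⟩
    · obtain ⟨z, rfl⟩ := M.vertexPerm.surjective e
      refine ⟨z, he.trans (sameCycle_apply_self _ _).symm, ?_⟩
      rw [← H.next_face]
      exact (sameCycle_apply_self M.vertexPerm (M.edgePerm z)).trans (sameCycle_apply_self _ _)
  have outer : ∀ e, M.vertexPerm.SameCycle d e →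
      C (M.vertexPerm (M.vertexPerm (M.edgePerm e))) = [α] := by
    intro e he
    rw [← facePerm_apply, H.next_face, U.outer _ (next he)]
  have touch : ∀ x ∈ hubLabels M C d, ∀ y, y ∈ hubLabels M C d ∨ y = α → x ≠ y →
      inn (insertDisks v X β γ N x) (insertDisks v X β γ N y) = -1 →
      M.Touch C x y ∨ M.Touch C y x := by
    rintro x hx y (hy | rfl) hne h1
    · rw [ringd hx, ringd hy] at h1
      have key : ∀ {x y}, x ∈ hubLabels M C d → y ∈ hubLabels M C d →
          ringIdx X β γ N y = ringIdx X β γ N x + 1 → M.Touch C x y := by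
        intro x y hx hy h
        rw [hL] at hx hy
        rcases List.pair_of_cyclicIdx I.length_ring hx hy h with h | ⟨h2, h3⟩
        · rw [← hL] at h
          exact IsHub.touch_of_pair A h
        · rw [List.getLast?_concat, Option.some_inj] at h2
          rw [List.cons_append, List.head?_cons, Option.some_inj] at h3
          subst h2 h3
          refine Or.inl ⟨M.vertexPerm (M.vertexPerm d), ?_⟩
          rw [three]
          obtain ⟨l, hl⟩ := List.getLast?_eq_some_iff.1 hlast
          obtain ⟨l', hl'⟩ := List.head?_eq_some_iff.1 hhead
          exact ⟨l, l', by simp [hl, hl']⟩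
      refine ((inn_rd_le hN fun h => hne ?_).2 h1).imp (key hx hy) (key hy hx)
      rw [hL] at hx hy
      exact I.idx_inj hx hy h
    · exact Or.inl (U.touch_alpha A H hx)
  refine ⟨insertDisks v X β γ N, fun x z hz => I.disks_norm (cov hz), fun x x' z hz z' hz' hne =>
    I.disks_sep (cov hz) (cov hz') hne, fun x x' z hz z' hz' hne h1 => ?_, fun x => ?_,
    fun x b₁ b₂ b₃ h3 h1 h2 h4 => ?_, fun x z z' y hw hzz hy => ?_⟩
  · rcases U.mem_or_eq H hz with h | h
    · exact touch z h z' (U.mem_or_eq H hz') hne h1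
    · rcases U.mem_or_eq H hz' with h' | h'
      · rw [inn_comm] at h1
        exact (touch z' h' z (Or.inr h) hne.symm h1).symm
      · exact (hne (h.trans h'.symm)).elim
  · by_cases hx : M.vertexPerm.SameCycle d x
    · refine ⟨N, hN, 1, ringIdx X β γ N, fun e he => ⟨fun z hz => ?_, ?_⟩⟩
      · rw [pull_one]
        exact ringd (IsHub.mem_hubLabels H (hx.trans he) hz)
      · have hch : (γ :: X ++ [β]).IsChain
            (fun b b' => ringIdx X β γ N b' = ringIdx X β γ N b + 1) :=
          List.isChain_cyclicIdx I.nodup N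
        rw [← hL, hubLabels] at hch
        rcases sameCycle_of_three (three d) (hx.trans he) with rfl | rfl | rfl
        · exact hch.left_of_append
        · rw [List.append_assoc] at hch
          exact hch.right_of_append
        · rw [three, List.isChain_append]
          refine ⟨hch.right_of_append, hch.left_of_append.left_of_append, fun z hz z' hz' => ?_⟩
          rw [hlast] at hz
          rw [hhead] at hz'
          obtain rfl : β = z := by simpa using hz
          obtain rfl : γ = z' := by simpa using hz'
          rw [Insertion.idx_gamma, I.idx_beta, neg_add_cancel]
    · obtain ⟨e, he, hex⟩ := rim x hx
      obtain ⟨z, y, hz, hy, n, hn, -⟩ := tri e he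
      exact ringAt_of_frame (three _) hy hz (outer e he) hn hex
  · by_cases hx : M.vertexPerm.SameCycle d x
    · have hs : ∀ e, M.vertexPerm.SameCycle d e → ∃ b, C e = [b] := by
        intro e he
        rcases sameCycle_of_three h3 (hx.symm.trans he) with rfl | rfl | rfl
        exacts [⟨_, h1⟩, ⟨_, h2⟩, ⟨_, h4⟩]
      obtain ⟨a₁, ha₁⟩ := hs _ (Equiv.Perm.SameCycle.refl _ _)
      obtain ⟨a₂, ha₂⟩ := hs _ (next (Equiv.Perm.SameCycle.refl _ _))
      obtain ⟨a₃, ha₃⟩ := hs _ (next (next (Equiv.Perm.SameCycle.refl _ _)))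
      have hX : a₁ :: [a₂] ++ [a₃] = γ :: X ++ [β] := by rw [← hL, hubLabels, ha₁, ha₂, ha₃]; rfl
      simp only [List.cons_append, List.nil_append, List.cons.injEq] at hX
      obtain ⟨rfl, hX⟩ := hX
      obtain ⟨hX', h5⟩ := List.append_inj' (s₁ := [a₂]) (t₁ := [a₃]) hX rfl
      obtain rfl : a₃ = β := by simpa using h5
      obtain ⟨n, hn, hn'⟩ := I.frame_three hX'.symm
      exact EmptyTriangle.of_sameCycle ⟨n, hn, fun _ _ hz => hn' _ (cov hz)⟩ (three d) ha₁ ha₂ ha₃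
        hx h1 h2 h4
    · obtain ⟨e, he, hex⟩ := rim x hx
      obtain ⟨z, y, hz, hy, hE⟩ := tri e he
      exact hE.of_sameCycle (three _) hy hz (outer e he) hex h1 h2 h4
  · obtain ⟨e, he, hx⟩ := H.cover d x
    have single : ∀ {l : List B}, l = [α] ∨ (∃ b : Option B, l = b.toList) → ¬ 2 ≤ l.length := by
      rintro l (rfl | ⟨_ | b, rfl⟩) <;> simp
    obtain rfl : x = e := by
      rcases hx with h | rfl | rfl | rfl
      exacts [h, (single (Or.inr ⟨_, U.spoke e he⟩) hw).elim,
        (single (Or.inr ⟨_, U.rim e he⟩) hw).elim, (single (Or.inl (U.outer e he)) hw).elim]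
    rw [H.next_face, U.outer _ (next he), List.mem_singleton] at hy
    subst hy
    obtain ⟨n, hn, hn'⟩ := I.frame_pair (b := z) (b' := z') (by
      rw [← hL, hubLabels]
      rcases sameCycle_of_three (three d) he with rfl | rfl | rfl
      · rw [List.append_assoc]; exact hzz.trans (List.prefix_append _ _).isInfix
      · exact hzz.trans ⟨_, _, rfl⟩
      · exact hzz.trans (List.suffix_append _ _).isInfix)
    exact ⟨n, hn, fun _ _ hz => hn' _ (cov hz)⟩

end CombMap

open OCircle CombMap

/-! ### Induction over the reductions -/

/-- Maps, label types and labels are quantified inside the induction, because each reduction changes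
the map and D3b lengthens the chains. -/
theorem D3Reducible.exists_realizes {V : Type u} {G : SimpleGraph V} (hG : D3Reducible G) :
    ∀ {D : Type u} (M : CombMap D) (o : D → V), Emb G M o → M.Jordan →
      ∀ {B : Type u} (C : D → List B), M.Admissible C → ∃ v, Realizes M C v := by
  induction hG with
  | base G hK =>
    intro D M o E J B C A
    have h3 := (D3Reducible.base G hK).threeConnected
    obtain ⟨i⟩ := hK
    obtain ⟨d, -, -⟩ := E.ex (i.symm 0) (i.symm 1) (by rw [i.symm.map_adj_iff]; decide)
    have : Nonempty D := ⟨d⟩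
    exact (E.isTetrahedron J ⟨i⟩ h3).exists_realizes A
  | d3a G p q r hconf hred ih =>
    intro D M o E J B C A
    have hG := D3Reducible.d3a G p q r hconf hred
    have := hG.finite
    have := E.finite
    -- The triangle is rotated so that its chain, if it has one, sits at `a`.
    obtain ⟨a, b, c, h, hc, hpqr, hb, hcl⟩ : ∃ a b c, M.TriFace a b c ∧
        IsD3aConfig G (o a) (o b) (o c) ∧
        (∀ x, (x ≠ p ∧ x ≠ q ∧ x ≠ r) ↔ (x ≠ o a ∧ x ≠ o b ∧ x ≠ o c)) ∧
        ¬ 2 ≤ (C b).length ∧ ¬ 2 ≤ (C c).length := by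
      obtain ⟨a, b, c, h, hc, hpqr⟩ := E.exists_triFace J hconf
          (connectedOff_d3a hred.threeConnected)
      have e1 : M.facePerm a = b := h.ab
      have e2 : M.facePerm b = c := h.bc
      have e3 : M.facePerm c = a := h.ca
      by_cases ha : 2 ≤ (C a).length
      · have h1 := A.not_fst ha
        have h2 := A.not_snd ha
        rw [e1] at h1 h2
        rw [e2] at h2
        exact ⟨a, b, c, h, hc, hpqr, h1, h2⟩
      by_cases hb : 2 ≤ (C b).length
      · have h1 := A.not_fst hb
        rw [e2] at h1
        exact ⟨b, c, a, h.rotate, hc.rotate, fun x => by rw [hpqr]; tauto, h1, ha⟩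
      · exact ⟨c, a, b, h.rotate.rotate, hc.rotate.rotate, fun x => by rw [hpqr]; tauto, ha, hb⟩
    exact Realizes.of_shrink h E J hG.threeConnected hc A hb hcl
      (ih _ _ (E.shrink h hc hpqr) (J.shrink h) _ ((A.legLabels E h hc).shrink h A))
  | d3b G p q r s hconf hred ih =>
    intro D M o E J B C A
    have hG := D3Reducible.d3b G p q r s hconf hred
    have := hG.finite
    have := E.finite
    have key : ∀ p' r', (hc : IsD3bConfig G p' q r' s) →
        (∀ {D : Type u} (M : CombMap D) (o), Emb (d3bReduce G p' q r' hc.ne_pr) M o → M.Jordan →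
          ∀ {B : Type u} (C : D → List B), M.Admissible C → ∃ v, Realizes M C v) →
        ∀ e u w v f, M.Fan e u w v f → o e = p' → o w = q → o (M.edgePerm f) = r' → o f = s →
          ∃ v, Realizes M C v := by
      rintro p' r' hc ih e u w v f h rfl hw rfl rfl
      have hc' := hc
      rw [← hw] at hc'
      have F := A.fanLabels E hG.threeConnected hc' h
      obtain ⟨vv, R⟩ := ih _ _ (E.suppress h hc rfl hw rfl) (J.suppress h) _
        (Admissible.suppress E J hG.threeConnected A h F)
      exact ⟨vv, Realizes.of_suppress h F A E R⟩
    obtain ⟨p', r', hpr, e, u, w, v, f, h, h1, h2, h3, h4⟩ := E.exists_fan J hconf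
      (connectedOff_d3b hconf.ne_pr hred.threeConnected hconf.adj_pq.ne hconf.adj_sq.ne)
      (by
        have hred' := hred.threeConnected
        rw [d3bReduce_comm] at hred'
        have := connectedOff_d3b hconf.ne_pr.symm hred' hconf.adj_qr.ne.symm hconf.adj_sq.ne
        rwa [Set.insert_comm] at this)
    rcases hpr with ⟨rfl, rfl⟩ | ⟨rfl, rfl⟩
    · exact key _ _ hconf ih e u w v f h h1 h2 h3 h4
    · refine key _ _ hconf.swap ?_ e u w v f h h1 h2 h3 h4
      rw [d3bReduce_comm]
      exact ih

/-- Such a vertex provides the empty gap that is moved to infinity in the end. -/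
theorem D3Reducible.exists_degree_three {V : Type u} {G : SimpleGraph V} (h : D3Reducible G) :
    ∃ v, (G.neighborSet v).ncard = 3 := by
  cases h with
  | base G hK =>
    obtain ⟨i⟩ := hK
    refine ⟨i.symm 0, ?_⟩
    have : G.neighborSet (i.symm 0) = {i.symm 0}ᶜ := by
      ext w
      rw [SimpleGraph.mem_neighborSet, ← i.map_adj_iff, Set.mem_compl_iff, Set.mem_singleton_iff]
      simp only [RelIso.apply_symm_apply, SimpleGraph.top_adj, ne_eq, not_iff_not]
      rw [← i.injective.eq_iff, i.apply_symm_apply, eq_comm]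
    have hfin : Finite V := Finite.of_equiv _ i.symm.toEquiv
    rw [this, Set.ncard_compl, Set.ncard_singleton, Nat.card_congr i.toEquiv]
    simp
  | d3a G p q r hc _ => exact ⟨p, hc.deg_p⟩
  | d3b G p q r s hc _ => exact ⟨p, hc.deg_p⟩

/-! ### From labelled maps to the packing of the dual graph -/

namespace CombMap

variable {D : Type u} {M : CombMap D}

theorem dual_vertexOf_eq {d e : D} :
    M.dual.vertexOf d = M.dual.vertexOf e ↔ M.facePerm.SameCycle d e :=
  ⟨fun h => Quotient.exact h, fun h => Quotient.sound h⟩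

theorem dual_faceOf_eq {d e : D} :
    M.dual.faceOf d = M.dual.faceOf e ↔ M.vertexPerm.SameCycle d e := by
  rw [← dual_facePerm]
  exact ⟨fun h => Quotient.exact h, fun h => Quotient.sound h⟩

theorem dual_vertexOf_vertexPerm (d : D) :
    M.dual.vertexOf (M.vertexPerm d) = M.dual.vertexOf (M.edgePerm d) :=
  dual_vertexOf_eq.2 (sameCycle_leg d)

theorem admissible_dual (M : CombMap D) : M.Admissible (fun d => [M.dual.vertexOf d]) where
  ne_nil _ := by simp
  nodup _ := by simp
  face b d e hd he := by
    rw [List.mem_singleton] at hd he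
    exact dual_vertexOf_eq.1 (hd.symm.trans he)
  const d _ _ _ := by
    rw [dual_vertexOf_eq.2 (sameCycle_apply_self M.facePerm (M.facePerm d))]
  chain d h := by simp at h

variable {v : M.dual.Vertex → OCircle}

/-- When all labels are single, a contact comes from two consecutive corners at a vertex, and these
belong to the faces on the two sides of an edge. Conversely, such faces are neighbours in the ring
of that vertex. -/
theorem Realizes.adj_iff (R : Realizes M (fun d => [M.dual.vertexOf d]) v) (x y : M.dual.Vertex) :
    inn (v x) (v y) = -1 ↔ M.dual.graph.Adj x y := by
  obtain ⟨d, rfl⟩ : ∃ d, M.dual.vertexOf d = x := Quotient.exists_rep x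
  obtain ⟨e, rfl⟩ : ∃ d, M.dual.vertexOf d = y := Quotient.exists_rep y
  constructor
  · intro h
    have hne : M.dual.vertexOf d ≠ M.dual.vertexOf e := by
      intro h'
      have := R.norm d _ (List.mem_singleton_self _)
      rw [← h', this] at h
      norm_num at h
    have key : ∀ x y, x ≠ y → M.Touch (fun d => [M.dual.vertexOf d]) x y →
        M.dual.graph.Adj x y := by
      rintro x y hxy (⟨z, hz⟩ | ⟨z, hz, -⟩)
      · have := hz.eq_of_length rfl
        simp only [List.cons_append, List.nil_append, List.cons.injEq, and_true] at this
        exact ⟨hxy, z, this.1.symm, (this.2.trans (dual_vertexOf_vertexPerm z)).symm⟩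
      · simp at hz
    rcases R.touch d e _ (List.mem_singleton_self _) _ (List.mem_singleton_self _) hne h with h | h
    · exact key _ _ hne h
    · exact (key _ _ hne.symm h).symm
  · rintro ⟨-, z, h1, h2⟩
    have h3 : M.dual.vertexOf (M.vertexPerm z) = M.dual.vertexOf e :=
      (dual_vertexOf_vertexPerm z).trans h2
    obtain ⟨N, hN, h, P, hP⟩ := R.ring z
    obtain ⟨h4, h5⟩ := hP z (Equiv.Perm.SameCycle.refl _ _)
    obtain ⟨h6, -⟩ := hP _ (sameCycle_apply_self _ _)
    have h7 := h4 _ (List.mem_singleton_self _)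
    have h8 := h6 _ (List.mem_singleton_self _)
    simp only [List.cons_append, List.nil_append, List.isChain_pair] at h5
    rw [← h1, ← h3, h7, h8, inn_pull, h5]
    exact (frame_rd hN _).inn_ab

/-- The matrix from `RingAt` carries the disks into the regular ring. As a vertex meets a face only
once, different darts of a dual face give different disks, which makes the interiors disjoint. -/
theorem Realizes.isMobiusRing {V : Type u} {G : SimpleGraph V} {o : D → V}
    (R : Realizes M (fun d => [M.dual.vertexOf d]) v) (hb : ∀ x, 0 < (v x).b)
    (E : Emb G M o) (J : M.Jordan) (hG : G.ThreeConnected) (F : M.dual.Face) :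
    IsMobiusRing M.dual (fun x => (v x).w / (v x).b) (fun x => 1 / (v x).b) F := by
  obtain ⟨d, rfl⟩ : ∃ d, M.dual.faceOf d = F := Quotient.exists_rep F
  obtain ⟨N, hN, h, P, hP⟩ := R.ring d
  have hr := rad_pos hN
  have vP : ∀ e, M.dual.faceOf e = M.dual.faceOf d →
      v (M.dual.vertexOf e) = OCircle.pull h (rd N (P (M.dual.vertexOf e))) := fun e he =>
    (hP e (dual_faceOf_eq.1 he.symm)).1 _ (List.mem_singleton_self _)
  have bpos : ∀ j, 0 < (rd N j).b := fun j => one_div_pos.2 hr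
  have hrad : ∀ j, 1 / (rd N j).b = rad N := fun j => one_div_one_div _
  have hself := inn_rd_self hN
  refine ⟨h, fun e => (rd N (P (M.dual.vertexOf e))).w / (rd N (P (M.dual.vertexOf e))).b, rad N,
    ⟨hr, ⟨0, 1, one_pos, fun e _ => ?_⟩, fun e he => ?_, fun e e' he he' hne => ?_⟩, fun e he => ?_⟩
  · have hr' : (rad N : ℂ) ≠ 0 := Complex.ofReal_ne_zero.2 hr.ne'
    have h1 : ∀ j, (rd N j).w / (rd N j).b = Complex.exp (ang N j * Complex.I) := by
      intro j
      simp only [rd, unitDisk]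
      push_cast
      field_simp
    rw [h1, dist_zero_right, Complex.norm_exp_ofReal_mul_I]
  · have h1 := (hP e (dual_faceOf_eq.1 he.symm)).2
    simp only [List.cons_append, List.nil_append, List.isChain_pair] at h1
    have h2 := (dist_centre_eq (hself _) (hself _) (bpos _) (bpos _)).2
      (frame_rd hN (P (M.dual.vertexOf e))).inn_ab
    rw [hrad, hrad] at h2
    rw [dual_facePerm, h1, h2]
  · have hx : M.dual.vertexOf e ≠ M.dual.vertexOf e' := fun h' =>
      hne (E.eq_of_sameCycle J hG ((E.same _ _).1 (dual_faceOf_eq.1 (he.trans he'.symm)))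
        (dual_vertexOf_eq.1 h'))
    have h1 := R.sep e e' _ (List.mem_singleton_self _) _ (List.mem_singleton_self _) hx
    rw [vP e he, vP e' he', inn_pull] at h1
    have := disjoint_ball (hself _) (hself _) (bpos _) (bpos _) h1
    rwa [hrad, hrad] at this
  · rw [← sdisk_eq_sphereDisk (R.norm e _ (List.mem_singleton_self _)) (hb _), vP e he,
      image_sdisk_pull, sdisk_eq_sphereDisk (hself _) (bpos _), hrad]

end CombMap

theorem mainTheorem12 {V : Type u} (G' : SimpleGraph V) (hG' : D3Reducible G')
    (M : CombMap G'.Dart) (hM : M.IsEmbeddingOf) (hplanar : M.IsPlanar) :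
    ∃ (c : M.dual.Vertex → ℂ) (r : M.dual.Vertex → ℝ),
      IsTangencyPacking M.dual.graph c r ∧
        ∀ F : M.dual.Face, IsMobiusRing M.dual c r F := by
  have E := hM.emb
  have := hG'.finite
  have := E.finite
  have J := hplanar.jordan
  obtain ⟨v, R⟩ := hG'.exists_realizes M _ E J _ M.admissible_dual
  have rep : ∀ x, ∃ d, M.dual.vertexOf d = x := Quotient.exists_rep
  obtain ⟨x, hx⟩ := hG'.exists_degree_three
  obtain ⟨d, rfl⟩ : ∃ d : G'.Dart, d.fst = x := by
    obtain ⟨y, hy⟩ : (G'.neighborSet x).Nonempty := by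
      rw [← Set.ncard_pos]; omega
    exact ⟨⟨(x, y), hy⟩, rfl⟩
  -- All other disks lie on the outer side of this triple, so `Frame.exists_bounded` makes all disks
  -- bounded at once.
  obtain ⟨n, hF, hn⟩ := R.vertex d _ _ _ (E.three hx).1 rfl rfl rfl
  obtain ⟨g, hg⟩ := hF.exists_bounded
  have hb : ∀ x, 0 < (OCircle.pull g (v x)).b := by
    intro x
    obtain ⟨e, rfl⟩ := rep x
    have key : ∀ d, inn (v (M.dual.vertexOf e)) (v (M.dual.vertexOf d)) ≤ -1 ∨
        v (M.dual.vertexOf e) = v (M.dual.vertexOf d) := by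
      intro d
      by_cases h : M.dual.vertexOf e = M.dual.vertexOf d
      · exact Or.inr (congrArg v h)
      · exact Or.inl (R.sep e d _ (List.mem_singleton_self _) _ (List.mem_singleton_self _) h)
    exact hg _ (key _) (key _) (key _) (hn e _ (List.mem_singleton_self _))
  have R' := R.pull g
  refine ⟨_, _, isTangencyPacking M.dual.graph _ (fun x => ?_) hb (fun x y hxy => ?_) R'.adj_iff,
    fun F => R'.isMobiusRing hb E J hG'.threeConnected F⟩
  · obtain ⟨e, rfl⟩ := rep x
    exact R'.norm e _ (List.mem_singleton_self _)
  · obtain ⟨e, rfl⟩ := rep x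
    obtain ⟨e', rfl⟩ := rep y
    exact R'.sep e e' _ (List.mem_singleton_self _) _ (List.mem_singleton_self _) hxy
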